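/- Let $G=(V,E)$ be a finite, connected, simple, undirected and unweighted graph with $n$ vertices and diameter $D=\max_{u,v\in V} d_G(u,v)$. For $\emptyset\subsetneq A\subsetneq V$ the cut-set $\delta(A)$ is the set of edges with exactly one endpoint in $A$; a min-cut of $G$ is a cut-set that has the minimum number of edges among all cut-sets of $G$. In the CONGEST model the vertices of $G$ are computing nodes with pairwise distinct identifiers in $\{0,\dots,n^{c}-1\}$ for a constant $c$. Initially a node knows only its own identifier and the identifiers of its neighbours. All nodes run the same program in synchronous rounds; in each round a node may send over each incident link a message of $O(\log n)$ bits (with a constant that may depend on $c$), and then updates its state from the messages it received. Local computation is free. Each node eventually terminates with an output, after which it is silent and its output no longer changes. Theorem. There is a deterministic CONGEST algorithm that finds all min-cuts of size $3$ in $O(D^2)$ rounds. That is, there are a single deterministic algorithm and an absolute constant $C$ such that, on every finite connected graph $G$ and for every assignment of identifiers as above, all nodes terminate within $C D^2$ rounds, each node outputs a finite set of edge sets (edges being named by the identifiers of their endpoints), and the union of these outputs over all nodes is exactly the set of those min-cuts of $G$ that have exactly $3$ edges. (In particular all outputs are empty if the min-cuts of $G$ do not have size $3$.) -/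

import Mathlib

/-! ### Cuts of a graph -/

open Classical in
/-- The cut-set `δ(A)`: the edges of `G` with one endpoint in `A` and the other outside `A`. -/
noncomputable def cutSet {V : Type*} [Fintype V] (G : SimpleGraph V) (A : Finset V) :
    Finset (Sym2 V) :=
  Finset.univ.filter fun e => ∃ u w, G.Adj u w ∧ u ∈ A ∧ w ∉ A ∧ e = s(u, w)

/-- `F` is the cut-set of some cut `(A, V \ A)` with `∅ ⊊ A ⊊ V`. -/
def IsCutSet {V : Type*} [Fintype V] (G : SimpleGraph V) (F : Finset (Sym2 V)) : Prop :=
  ∃ A : Finset V, A.Nonempty ∧ A ≠ Finset.univ ∧ F = cutSet G A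

/-- A min-cut: a cut-set with the minimum number of edges among all cut-sets of `G`. -/
def IsMinCut {V : Type*} [Fintype V] (G : SimpleGraph V) (F : Finset (Sym2 V)) : Prop :=
  IsCutSet G F ∧ ∀ F' : Finset (Sym2 V), IsCutSet G F' → F.card ≤ F'.card

/-! ### The CONGEST model -/

/-- A deterministic synchronous message-passing algorithm with outputs in `O`. The same program
runs at every node of every network. Initially a node sees only its own identifier and the set of
identifiers of its neighbours. In every round it sends to each neighbour (addressed by identifier) a
bit string computed from its state, where the empty string is silence, and then updates its state
from the strings received. A node terminates as soon as its state carries an output. Local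
computation is unrestricted. -/
structure DistributedAlgorithm (O : Type) where
  State : Type
  init : (self : ℕ) → (neighbours : Finset ℕ) → State
  send : State → (receiver : ℕ) → List Bool
  step : State → (inbox : ℕ → List Bool) → State
  output : State → Option O

namespace DistributedAlgorithm

variable {O : Type} (𝒜 : DistributedAlgorithm O)

/-- The string that a node in state `s` actually sends to the neighbour with identifier `i`:
a terminated node is silent. -/
def message (s : 𝒜.State) (i : ℕ) : List Bool :=
  if (𝒜.output s).isSome then [] else 𝒜.send s i

/-- The state after a round in which `inbox` was received: a terminated node does not change
any more. -/
def next (s : 𝒜.State) (inbox : ℕ → List Bool) : 𝒜.State :=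
  if (𝒜.output s).isSome then s else 𝒜.step s inbox

open Classical in
/-- The state of each node after `t` rounds on the network `G` with identifiers `ident`.
The inbox of `v` gives, for the identifier of each neighbour `u` of `v`, the string that `u` sent
to `v` in this round, and the empty string at all other numbers. -/
noncomputable def run {V : Type*} [Fintype V] (G : SimpleGraph V) (ident : V ↪ ℕ) :
    ℕ → V → 𝒜.State
  | 0, v => 𝒜.init (ident v) ((Finset.univ.filter fun u => G.Adj v u).map ident)
  | t + 1, v => 𝒜.next (run G ident t v)
      (Function.extend (fun u : G.neighborSet v => ident u)
        (fun u => 𝒜.message (run G ident t u) (ident v)) (fun _ => []))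

/-- In every round, at most `b` bits are sent over each link in each direction. -/
def RespectsBandwidth {V : Type*} [Fintype V] (G : SimpleGraph V) (ident : V ↪ ℕ) (b : ℕ) : Prop :=
  ∀ (t : ℕ) (u v : V), G.Adj u v → (𝒜.message (𝒜.run G ident t u) (ident v)).length ≤ b

/-- After at most `T` rounds every node `v` has terminated, with output `out v`. -/
def TerminatesWithin {V : Type*} [Fintype V] (G : SimpleGraph V) (ident : V ↪ ℕ) (T : ℕ)
    (out : V → O) : Prop :=
  ∀ v, 𝒜.output (𝒜.run G ident T v) = some (out v)

end DistributedAlgorithm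

/-- Each node reports a finite set of edge sets, with vertices named by their identifiers.
The reports are exactly the min-cuts of size `k`: every min-cut of size `k` is reported by some
node, and no node reports anything else. -/
def ReportsAllMinCutsOfSize {V : Type*} [Fintype V] (G : SimpleGraph V) (ident : V ↪ ℕ) (k : ℕ)
    (out : V → Finset (Finset (Sym2 ℕ))) : Prop :=
  ∀ S : Finset (Sym2 ℕ), (∃ v, S ∈ out v) ↔
    ∃ F : Finset (Sym2 V), IsMinCut G F ∧ F.card = k ∧ S = F.map ident.sym2Map

-- Fix the breadth-first search tree rooted at the node with the smallest identifier, and name a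
-- tree edge by its lower end. A cut is determined by the set `X` of tree edges that it contains,
-- every nonempty `X` occurs, and the other edges of the cut are the non-tree edges that cover an
-- odd number of members of `X` (`isCutSet_iff`, `cutOf_eq`). With `cov a` the set of non-tree edges
-- covering `a`, the size of the cut is the size of `X` plus that of the symmetric difference of the
-- sets `cov a`. A cut with three edges is therefore of one of three kinds: one tree edge with two
-- covering edges, two tree edges whose covering sets differ in one edge, or three tree edges whose
-- covering sets have empty symmetric difference. The sizes of the covering sets and of their
-- intersections decide which sets `X` qualify (`card_symmDiff_add`, `symmDiff_three_eq_empty_iff`),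
-- and sums of edge labels reveal the at most two non-tree edges.
--
-- For an ancestor and a descendant, the size of the intersection is a sum over the subtree of the
-- descendant, one sum for each level above it. For incomparable nodes there are too many pairs. The
-- remedy is that each node `v` selects three links leaving its subtree: one whose ends have the
-- deepest common ancestor, one whose inner end branches off from that of the first as early as
-- possible, and one with the same property for the outer end (`exists_selects`). Statistics are
-- gathered only along the root paths of these links. A case analysis on the relative position of
-- the three tree edges shows that in every cut with three edges the partners of a suitable member
-- lie on such paths, so that some node has all the numbers it needs
-- (`certified_of_not_hasSmallCut`).
--
-- Every phase is a pipelined aggregation towards the root followed by a broadcast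
-- (`Solvable.phase`): a linear number of rounds in the height, each with messages of linearly many
-- numbers of polynomial size. This costs a quadratic number of elementary rounds, and the height is
-- at most the diameter. Leader election ends at the same moment everywhere, since the nodes learn
-- the height in time (`eq_iff_known`), so the phases can be chained.
--
-- Since local computation is free, no program has to be written out: it suffices that old knowledge
-- and inbox determine the new knowledge, across all networks (`Solvable.loop`, `Solvable.det`). In
-- the end a node reports the edge sets that are min-cuts of size three in every network compatible
-- with what it knows. Soundness is then automatic, and completeness is the case analysis together
-- with a flag telling whether there is a cut with at most two edges (`hasSmallCut_congr`).

universe u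

section

open scoped Classical

/-! ### Networks and broadcast programs -/

/-- A connected network with at least two nodes. -/
structure Net where
  V : Type u
  [fin : Fintype V]
  G : SimpleGraph V
  ident : V ↪ ℕ
  conn : G.Connected
  nontriv : Nontrivial V

attribute [instance] Net.fin

/-- A value for each node of each network. -/
abbrev Lab (α : Type) := (N : Net.{u}) → N.V → α

namespace Net

variable (N : Net.{u})

/-- The neighbours of a node. -/
noncomputable def nbr (v : N.V) : Finset N.V := Finset.univ.filter fun w => N.G.Adj v w

/-- The identifiers of the neighbours of a node. -/
noncomputable def nbrIds (v : N.V) : Finset ℕ := (N.nbr v).map N.ident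

/-- A bound for the number of nodes and for all identifiers. -/
noncomputable def size : ℕ := Fintype.card N.V + Finset.univ.sup N.ident

/-- The values of `g` at the neighbours of `v`, indexed by identifiers. -/
noncomputable def inb {β : Type} (v : N.V) (g : N.V → β) : ℕ → Option β := fun i =>
  if h : ∃ w, N.G.Adj v w ∧ N.ident w = i then some (g h.choose) else none

variable {N}

theorem mem_nbr {v w : N.V} : w ∈ N.nbr v ↔ N.G.Adj v w := by simp [nbr]

theorem inb_of_adj {β : Type} {v w : N.V} (g : N.V → β) (h : N.G.Adj v w) :
    N.inb v g (N.ident w) = some (g w) := by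
  have hex : ∃ w', N.G.Adj v w' ∧ N.ident w' = N.ident w := ⟨w, h, rfl⟩
  have : hex.choose = w := N.ident.injective hex.choose_spec.2
  unfold inb
  rw [dif_pos hex, this]

theorem inb_eq_some {β : Type} {v : N.V} {g : N.V → β} {i : ℕ} {b : β} :
    N.inb v g i = some b ↔ ∃ w, N.G.Adj v w ∧ N.ident w = i ∧ g w = b := by
  constructor
  · intro h
    unfold inb at h
    split_ifs at h with hex
    exact ⟨_, hex.choose_spec.1, hex.choose_spec.2, by simpa using h⟩
  · rintro ⟨w, h, rfl, rfl⟩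
    exact inb_of_adj g h

theorem inb_map {β γ : Type} (v : N.V) (g : N.V → β) (f : β → γ) :
    N.inb v (fun w => f (g w)) = fun i => (N.inb v g i).map f := by
  funext i
  unfold inb
  split_ifs <;> simp

theorem inb_map_congr {β γ : Type} {N' : Net.{u}} {v : N.V} {v' : N'.V} {g : N.V → β}
    {g' : N'.V → β} (h : N.inb v g = N'.inb v' g') (f : β → γ) :
    N.inb v (fun w => f (g w)) = N'.inb v' (fun w => f (g' w)) := by
  rw [inb_map, inb_map, h]

theorem inb_prod_congr {β γ : Type} {N' : Net.{u}} {v : N.V} {v' : N'.V} {g : N.V → β}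
    {g' : N'.V → β} {k : N.V → γ} {k' : N'.V → γ} (h : N.inb v g = N'.inb v' g')
    (hk : N.inb v k = N'.inb v' k') :
    N.inb v (fun w => (g w, k w)) = N'.inb v' (fun w => (g' w, k' w)) := by
  funext i
  have h1 := congrFun h i
  have h2 := congrFun hk i
  unfold inb at *
  split_ifs at * <;> simp_all

theorem inb_pi_congr {γ : Type} {N' : Net.{u}} {v : N.V} {v' : N'.V} {g : N.V → ℕ → γ}
    {g' : N'.V → ℕ → γ}
    (h : ∀ s, N.inb v (fun w => g w s) = N'.inb v' (fun w => g' w s)) :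
    N.inb v g = N'.inb v' g' := by
  funext i
  have h1 := fun s => congrFun (h s) i
  unfold inb at *
  split_ifs at * with hx hy
  · simp only [Option.some.injEq] at h1 ⊢
    funext s
    exact h1 s
  · simp at h1
  · simp at h1
  · rfl

/-- The right-hand side depends on the inbox alone, so such a sum can be computed locally and agrees
across networks with equal inboxes. -/
theorem sum_nbr_eq {β M : Type} [AddCommMonoid M] (v : N.V) (g : N.V → β) (f : β → M) :
    ∑ w ∈ N.nbr v, f (g w) = ∑ᶠ i, (N.inb v g i).elim 0 f := by
  rw [finsum_eq_sum_of_support_subset (s := N.nbrIds v)]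
  · rw [nbrIds, Finset.sum_map]
    refine Finset.sum_congr rfl fun w hw => ?_
    rw [inb_of_adj g (mem_nbr.1 hw)]
    rfl
  · intro i hi
    rw [Function.mem_support] at hi
    cases h : N.inb v g i with
    | none => simp [h] at hi
    | some b =>
      obtain ⟨w, hw, rfl, -⟩ := inb_eq_some.1 h
      simpa [nbrIds, mem_nbr] using hw

theorem sum_nbr_congr {β M : Type} [AddCommMonoid M] {N' : Net.{u}} {v : N.V} {v' : N'.V}
    {g : N.V → β} {g' : N'.V → β} (h : N.inb v g = N'.inb v' g') (f : β → M) :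
    ∑ w ∈ N.nbr v, f (g w) = ∑ w ∈ N'.nbr v', f (g' w) := by
  rw [sum_nbr_eq, sum_nbr_eq, h]

theorem card_le_size : Fintype.card N.V ≤ N.size := Nat.le_add_right _ _

theorem ident_le_size (v : N.V) : N.ident v ≤ N.size :=
  (Finset.le_sup (f := N.ident) (Finset.mem_univ v)).trans (Nat.le_add_left _ _)

theorem two_le_card : 2 ≤ Fintype.card N.V :=
  have := N.nontriv
  Fintype.one_lt_card

theorem two_le_size : 2 ≤ N.size := two_le_card.trans card_le_size

theorem size_pow_mono {a b : ℕ} (h : a ≤ b) : N.size ^ a ≤ N.size ^ b :=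
  Nat.pow_le_pow_right (by have := N.two_le_size; omega) h

end Net

/-- A program in which every node sends in every round one number to all its neighbours. -/
structure Prog (α : Type) where
  S : Type
  init : ℕ → Finset ℕ → S
  msg : S → ℕ
  step : S → (ℕ → Option ℕ) → S
  out : S → Option α

/-- The state of a node after `t` rounds. -/
noncomputable def Prog.run {α : Type} (P : Prog α) (N : Net.{u}) : ℕ → N.V → P.S
  | 0, v => P.init (N.ident v) (N.nbrIds v)
  | t + 1, v => P.step (P.run N t v) (N.inb v fun w => P.msg (P.run N t w))

/-- Some program with messages of polynomial size makes every node `v` of every network `N` know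
`Q N v` at time `T N`, and no node finishes earlier. -/
def Solvable {α : Type} (T : Net.{u} → ℕ) (Q : Lab.{u} α) : Prop :=
  ∃ (P : Prog α) (K : ℕ), ∀ N : Net.{u},
    (∀ t < T N, ∀ v, P.out (P.run N t v) = none) ∧
    (∀ v, P.out (P.run N (T N) v) = some (Q N v)) ∧
    ∀ t < T N, ∀ v, P.msg (P.run N t v) ≤ N.size ^ K

/-- `Q'` is a function of `Q`. -/
def Det {α β : Type} (Q : Lab.{u} α) (Q' : Lab.{u} β) : Prop :=
  ∀ ⦃N : Net.{u}⦄ ⦃v : N.V⦄ ⦃N' : Net.{u}⦄ ⦃v' : N'.V⦄, Q N v = Q N' v' → Q' N v = Q' N' v'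

/-! ### Calculus of knowledge that programs can acquire -/

theorem exists_factor {ι : Type*} {α β : Type} [Nonempty β] (P : ι → Prop) (f : ι → α) (g : ι → β)
    (h : ∀ i j, P i → P j → f i = f j → g i = g j) : ∃ F : α → β, ∀ i, P i → F (f i) = g i := by
  refine ⟨fun a => if ha : ∃ i, P i ∧ f i = a then g ha.choose else Classical.arbitrary β, ?_⟩
  intro i hi
  have ha : ∃ j, P j ∧ f j = f i := ⟨i, hi, rfl⟩
  simp only [dif_pos ha]
  exact h _ _ ha.choose_spec.1 hi ha.choose_spec.2

theorem Solvable.start : Solvable (fun _ => 0) (fun N v => (N.ident v, N.nbrIds v)) := by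
  refine ⟨⟨ℕ × Finset ℕ, fun a b => (a, b), fun _ => 0, fun s _ => s, fun s => some s⟩, 0, ?_⟩
  intro N
  refine ⟨fun t ht => absurd ht (Nat.not_lt_zero _), fun v => rfl,
    fun t ht => absurd ht (Nat.not_lt_zero _)⟩

/-- Local computation is unrestricted, so whatever is determined by the knowledge can be computed:
the function is obtained from `exists_factor` by choice, and only the output map of the program
changes. -/
theorem Solvable.det {α β : Type} {T : Net.{u} → ℕ} {Q : Lab.{u} α} {Q' : Lab.{u} β}
    (h : Solvable T Q) (hd : Det Q Q') : Solvable T Q' := by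
  by_cases hb : Nonempty β
  · obtain ⟨F, hF⟩ := exists_factor (ι := (N : Net.{u}) × N.V) (fun _ => True)
      (fun i => Q i.1 i.2) (fun i => Q' i.1 i.2) (fun i j _ _ hij => hd hij)
    obtain ⟨P, K, hP⟩ := h
    refine ⟨⟨P.S, P.init, P.msg, P.step, fun s => (P.out s).map F⟩, K, fun N => ?_⟩
    obtain ⟨h1, h2, h3⟩ := hP N
    have hrun : ∀ t v, Prog.run ⟨P.S, P.init, P.msg, P.step, fun s => (P.out s).map F⟩ N t v
        = P.run N t v := by
      intro t
      induction t with
      | zero => intro v; rfl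
      | succ t ih => intro v; simp only [Prog.run, ih]
    refine ⟨fun t ht v => by simp [hrun, h1 t ht v], fun v => ?_,
      fun t ht v => by simpa [hrun] using h3 t ht v⟩
    simpa [hrun, h2 v] using hF ⟨N, v⟩ trivial
  · refine ⟨⟨Unit, fun _ _ => (), fun _ => 0, fun s _ => s, fun _ => none⟩, 0, fun N => ?_⟩
    have := N.nontriv
    exact absurd ⟨Q' N (Classical.arbitrary N.V)⟩ hb

/-- A loop: if a round turns the knowledge `Q i` into `Q (i + 1)`, and the nodes can tell when
`k N` rounds have passed, then they learn `Q (k N)`. -/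
theorem Solvable.loop {α : Type} {T : Net.{u} → ℕ} {Q : ℕ → Lab.{u} α} (k : Net.{u} → ℕ)
    (h : Solvable T (Q 0)) (msg : ℕ → α → ℕ) (K : ℕ)
    (hm : ∀ N i v, i < k N → msg i (Q i N v) ≤ N.size ^ K)
    (hstep : ∀ i (N : Net.{u}) (v : N.V) (N' : Net.{u}) (v' : N'.V), i < k N → i < k N' →
      Q i N v = Q i N' v' →
      N.inb v (fun w => msg i (Q i N w)) = N'.inb v' (fun w => msg i (Q i N' w)) →
      Q (i + 1) N v = Q (i + 1) N' v')
    (hfin : ∀ i (N : Net.{u}) (v : N.V) (N' : Net.{u}) (v' : N'.V), i ≤ k N → i ≤ k N' →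
      Q i N v = Q i N' v' → (i = k N ↔ i = k N')) :
    Solvable (fun N => T N + k N) (fun N => Q (k N) N) := by
  by_cases hα : Nonempty α
  swap
  · refine ⟨⟨Unit, fun _ _ => (), fun _ => 0, fun s _ => s, fun _ => none⟩, 0, fun N => ?_⟩
    have := N.nontriv
    exact absurd ⟨Q 0 N (Classical.arbitrary N.V)⟩ hα
  obtain ⟨P, K0, hP⟩ := h
  -- `F` is the local transition of the loop. It exists because `hstep` makes the new knowledge a
  -- function of round number, old knowledge and inbox.
  obtain ⟨F, hF⟩ := exists_factor (ι := ℕ × (N : Net.{u}) × N.V) (fun j => j.1 < k j.2.1)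
    (fun j => (j.1, Q j.1 j.2.1 j.2.2,
      j.2.1.inb j.2.2 (fun w => msg j.1 (Q j.1 j.2.1 w)))) (fun j => Q (j.1 + 1) j.2.1 j.2.2) (by
    rintro ⟨i, N, v⟩ ⟨j, N', v'⟩ hi hj hij
    simp only [Prod.mk.injEq] at hij
    obtain ⟨rfl, h1, h2⟩ := hij
    exact hstep _ _ _ _ _ hi hj h1 h2)
  -- `E` is the stopping test; by `hfin` it gives the same answer in all networks that the node
  -- cannot tell apart.
  obtain ⟨E, hE⟩ := exists_factor (ι := ℕ × (N : Net.{u}) × N.V) (fun j => j.1 ≤ k j.2.1)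
    (fun j => (j.1, Q j.1 j.2.1 j.2.2)) (fun j => decide (j.1 = k j.2.1)) (by
    rintro ⟨i, N, v⟩ ⟨j, N', v'⟩ hi hj hij
    simp only [Prod.mk.injEq] at hij
    obtain ⟨rfl, h1⟩ := hij
    simpa using hfin _ _ _ _ _ hi hj h1)
  -- A node that completes the first program enters the loop within the same state change, so the
  -- hand-over costs no round.
  let lift : P.S → P.S ⊕ ℕ × α := fun s => (P.out s).elim (Sum.inl s) fun a => Sum.inr (0, a)
  let P' : Prog α :=
    { S := P.S ⊕ ℕ × α
      init := fun a b => lift (P.init a b)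
      msg := Sum.elim P.msg fun q => msg q.1 q.2
      step := fun s b => Sum.elim (fun s => lift (P.step s b))
        (fun q => Sum.inr (q.1 + 1, F (q.1, q.2, b))) s
      out := Sum.elim (fun _ => none) fun q => if E q = true then some q.2 else none }
  refine ⟨P', max K0 K, fun N => ?_⟩
  obtain ⟨h1, h2, h3⟩ := hP N
  have hrun1 : ∀ t, t ≤ T N → ∀ v, P'.run N t v = lift (P.run N t v) := by
    intro t
    induction t with
    | zero => intro _ v; rfl
    | succ t ih =>
      intro ht v
      have hl : ∀ w, P'.run N t w = Sum.inl (P.run N t w) := fun w => by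
        rw [ih (by omega)]
        simp [lift, h1 t (by omega) w]
      simp only [Prog.run, hl]
      rfl
  have hrun2 : ∀ i, i ≤ k N → ∀ v, P'.run N (T N + i) v = Sum.inr (i, Q i N v) := by
    intro i
    induction i with
    | zero =>
      intro _ v
      rw [Nat.add_zero, hrun1 _ le_rfl]
      simp [lift, h2 v]
    | succ i ih =>
      intro hi v
      rw [← Nat.add_assoc]
      simp only [Prog.run, ih (by omega)]
      simp only [P', Sum.elim_inr]
      have := hF (i, ⟨N, v⟩) (by simp only; omega)
      simp only at this
      rw [this]
  have hl : ∀ t, t < T N → ∀ w, P'.run N t w = Sum.inl (P.run N t w) := fun t ht w => by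
    rw [hrun1 t ht.le]
    simp [lift, h1 t ht w]
  have hE' : ∀ i, i ≤ k N → ∀ v, E (i, Q i N v) = decide (i = k N) := fun i hi v =>
    hE (i, ⟨N, v⟩) hi
  refine ⟨fun t (ht : t < T N + k N) v => ?_, fun v => ?_, fun t (ht : t < T N + k N) v => ?_⟩
  · by_cases htT : t < T N
    · rw [hl t htT]; rfl
    · obtain ⟨i, rfl⟩ := Nat.exists_eq_add_of_le (Nat.le_of_not_lt htT)
      rw [hrun2 i (by omega)]
      simp only [P', Sum.elim_inr]
      rw [hE' i (by omega), if_neg]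
      simp; omega
  · rw [hrun2 _ le_rfl]
    simp only [P', Sum.elim_inr]
    rw [hE' _ le_rfl, if_pos (by simp)]
  · by_cases htT : t < T N
    · rw [hl t htT]
      exact (h3 t htT v).trans (Net.size_pow_mono (le_max_left _ _))
    · obtain ⟨i, rfl⟩ := Nat.exists_eq_add_of_le (Nat.le_of_not_lt htT)
      rw [hrun2 i (by omega)]
      exact (hm N i v (by omega)).trans (Net.size_pow_mono (le_max_right _ _))

/-- A loop in which every round consists of `l N` elementary rounds, so that the messages are
sequences of `l N` numbers. -/
theorem Solvable.bigLoop {α : Type} {T : Net.{u} → ℕ} {Q : ℕ → Lab.{u} α} (k l : Net.{u} → ℕ)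
    (h : Solvable T (Q 0)) (msg : ℕ → α → ℕ → ℕ) (K : ℕ) (hl : ∀ N, 0 < l N)
    (hm : ∀ N i v s, i < k N → msg i (Q i N v) s ≤ N.size ^ K)
    (hm0 : ∀ N i v s, i < k N → l N ≤ s → msg i (Q i N v) s = 0)
    (hkl : ∀ i i' (N : Net.{u}) (v : N.V) (N' : Net.{u}) (v' : N'.V), Q i N v = Q i' N' v' →
      k N = k N' ∧ l N = l N')
    (hstep : ∀ i (N : Net.{u}) (v : N.V) (N' : Net.{u}) (v' : N'.V), i < k N → i < k N' →
      Q i N v = Q i N' v' →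
      N.inb v (fun w => msg i (Q i N w)) = N'.inb v' (fun w => msg i (Q i N' w)) →
      Q (i + 1) N v = Q (i + 1) N' v') :
    Solvable (fun N => T N + k N * l N) (fun N => Q (k N) N) := by
  -- Elementary round `t` belongs to big round `t / l N`; the entries with index below `t % l N` of
  -- the current message sequences have already arrived.
  let Q' : ℕ → Lab.{u} ((α × ℕ × ℕ) × (ℕ → ℕ → Option ℕ)) := fun t N v =>
    ((Q (t / l N) N v, t / l N, t % l N), fun s i => if s < t % l N then
      N.inb v (fun w => msg (t / l N) (Q (t / l N) N w) s) i else none)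
  have h0 : Solvable T (Q' 0) := by
    refine h.det fun N v N' v' hQ => ?_
    simp [Q', hQ]
  have key := Solvable.loop (fun N => k N * l N) h0
    (fun _ a => msg a.1.2.1 a.1.1 a.1.2.2) K ?_ ?_ ?_
  · refine key.det fun N v N' v' hQ => ?_
    simp only [Q', Prod.mk.injEq] at hQ
    simpa only [Nat.mul_div_cancel _ (hl _)] using hQ.1.1
  · intro N i v hi
    exact hm _ _ _ _ ((Nat.div_lt_iff_lt_mul (hl N)).2 hi)
  · intro t N v N' v' ht ht' hQ hin
    simp only [Q', Prod.mk.injEq] at hQ hin ⊢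
    obtain ⟨⟨hQ1, hQ2, hQ3⟩, hQ4⟩ := hQ
    obtain ⟨hk, hll⟩ := hkl _ _ _ _ _ _ hQ1
    have hi : t / l N < k N := (Nat.div_lt_iff_lt_mul (hl N)).2 ht
    have hi' : t / l N' < k N' := (Nat.div_lt_iff_lt_mul (hl N')).2 ht'
    rw [← hll] at hQ1 hQ4 hin hi' ⊢
    set i := t / l N with hidef
    set s := t % l N with hsdef
    have hts : l N * i + s = t := Nat.div_add_mod t (l N)
    have hs : s < l N := Nat.mod_lt _ (hl N)
    have hin' : ∀ s' ≤ s, N.inb v (fun w => msg i (Q i N w) s')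
        = N'.inb v' (fun w => msg i (Q i N' w) s') := by
      intro s' hs'
      rcases Nat.lt_or_eq_of_le hs' with hlt | rfl
      · funext j
        have := congrFun (congrFun hQ4 s') j
        simpa [hlt] using this
      · exact hin
    by_cases hlast : s + 1 = l N
    · have e1 : (t + 1) / l N = i + 1 := by
        rw [← hts, Nat.add_assoc, hlast]
        rw [show l N * i + l N = (i + 1) * l N by ring, Nat.mul_div_cancel _ (hl N)]
      have e2 : (t + 1) % l N = 0 := by
        rw [← hts, Nat.add_assoc, hlast, show l N * i + l N = (i + 1) * l N by ring]
        exact Nat.mul_mod_left _ _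
      simp only [e1, e2]
      refine ⟨⟨?_, trivial, trivial⟩, by simp⟩
      refine hstep i N v N' v' hi hi' hQ1 (Net.inb_pi_congr fun s' => ?_)
      by_cases hs' : s' ≤ s
      · exact hin' s' hs'
      · have z : ∀ w, msg i (Q i N w) s' = 0 := fun w => hm0 _ _ _ _ hi (by omega)
        have z' : ∀ w, msg i (Q i N' w) s' = 0 := fun w => hm0 _ _ _ _ hi' (by omega)
        simp only [z, z']
        -- All these messages are `0`; that the neighbours have the same identifiers in both
        -- networks is read off an inbox already known to agree.
        have := Net.inb_map_congr (hin' s le_rfl) (fun _ => (0 : ℕ))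
        exact this
    · have e1 : (t + 1) / l N = i := by
        rw [← hts, Nat.add_assoc, Nat.mul_add_div (hl N), Nat.div_eq_of_lt (by omega)]
        simp
      have e2 : (t + 1) % l N = s + 1 := by
        rw [← hts, Nat.add_assoc, Nat.mul_add_mod]
        exact Nat.mod_eq_of_lt (by omega)
      simp only [e1, e2]
      refine ⟨⟨hQ1, trivial, trivial⟩, ?_⟩
      funext s' j
      by_cases hs' : s' < s + 1
      · simp only [hs', if_true]
        exact congrFun (hin' s' (by omega)) j
      · simp only [hs', if_false]
  · intro t N v N' v' ht ht' hQ
    simp only [Q', Prod.mk.injEq] at hQ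
    obtain ⟨hk, hll⟩ := hkl _ _ _ _ _ _ hQ.1.1
    rw [hk, hll]

/-! ### From broadcast programs to distributed algorithms -/

/-- The message-passing algorithm that runs a broadcast program, sending numbers in binary. A node
without neighbours stops at once. -/
noncomputable def Prog.toAlgorithm {O : Type} (P : Prog O) (o : O) : DistributedAlgorithm O where
  State := Finset ℕ × P.S
  init self nb := (nb, P.init self nb)
  send s _ := (P.msg s.2).bits
  step s inbox := (s.1, P.step s.2 fun i =>
    if i ∈ s.1 then some (Function.invFun Nat.bits (inbox i)) else none)
  output s := if s.1 = ∅ then some o else P.out s.2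

theorem Nat.bits_injective : Function.Injective Nat.bits := fun a b h => by
  have key : ∀ n, List.foldr Nat.bit 0 n.bits = n := fun n => by
    induction n using Nat.binaryRec' with
    | zero => simp
    | bit b n hb ih => rw [Nat.bits_append_bit _ _ hb, List.foldr_cons, ih]
  rw [← key a, h, key]

namespace Net

variable {N : Net.{u}}

theorem nbrIds_ne_empty (v : N.V) : N.nbrIds v ≠ ∅ := by
  have := N.nontriv
  obtain ⟨w, hw⟩ := N.conn.preconnected.exists_adj_of_nontrivial v
  exact Finset.ne_empty_of_mem (a := N.ident w) (by simpa [nbrIds, mem_nbr] using hw)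

/-- Turns bounds by powers of `size`, which does not involve `c`, into bounds by powers of the
number of nodes. -/
theorem size_le {c : ℕ} (h : ∀ v, N.ident v < Fintype.card N.V ^ c) :
    N.size ≤ Fintype.card N.V ^ (c + 2) := by
  have hn := N.two_le_card
  set n := Fintype.card N.V with hn'
  have h1 : Finset.univ.sup N.ident ≤ n ^ (c + 1) := Finset.sup_le fun v _ =>
    (h v).le.trans (Nat.pow_le_pow_right (by omega) (by omega))
  have h2 : n ≤ n ^ (c + 1) := Nat.le_self_pow (by omega) n
  calc N.size = n + Finset.univ.sup N.ident := rfl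
    _ ≤ n ^ (c + 1) + n ^ (c + 1) := Nat.add_le_add h2 h1
    _ = n ^ (c + 1) * 2 := by ring
    _ ≤ n ^ (c + 1) * n := Nat.mul_le_mul_left _ hn
    _ = n ^ (c + 2) := (pow_succ _ _).symm

end Net

/-- Since `n` is at least `2`, its logarithm is at least `1` and absorbs additive constants at the
price of the factor `2`. -/
theorem length_bits_le {m n E : ℕ} (hn : 2 ≤ n) (h : m ≤ n ^ E) :
    m.bits.length ≤ 2 * (E + 1) * Nat.log 2 n := by
  have hlog : 1 ≤ Nat.log 2 n := Nat.log_pos (by norm_num) hn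
  have h1 : m < 2 ^ ((Nat.log 2 n + 1) * (E + 1)) := by
    have h2 : n < 2 ^ (Nat.log 2 n + 1) := Nat.lt_pow_succ_log_self (by norm_num) n
    calc m ≤ n ^ E := h
      _ < n ^ (E + 1) := Nat.pow_lt_pow_right (by omega) (by omega)
      _ ≤ (2 ^ (Nat.log 2 n + 1)) ^ (E + 1) := Nat.pow_le_pow_left h2.le _
      _ = _ := (pow_mul _ _ _).symm
  rw [Nat.size_eq_bits_len]
  calc m.size ≤ (Nat.log 2 n + 1) * (E + 1) := Nat.size_le.2 h1
    _ ≤ (2 * Nat.log 2 n) * (E + 1) := Nat.mul_le_mul_right _ (by omega)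
    _ = _ := by ring

namespace Prog

variable {O : Type} (P : Prog O) (o : O)

/-- Before time `T` no node has an output, so nobody is silenced and the simulation is faithful. -/
theorem run_toAlgorithm (N : Net.{u}) (T : ℕ) (h : ∀ t < T, ∀ v, P.out (P.run N t v) = none) :
    ∀ t ≤ T, ∀ v, (P.toAlgorithm o).run N.G N.ident t v = (N.nbrIds v, P.run N t v) := by
  intro t
  induction t with
  | zero => intro _ v; rfl
  | succ t ih =>
    intro ht v
    have hout : ∀ w, ((P.toAlgorithm o).output (N.nbrIds w, P.run N t w)) = none := fun w => by
      simp only [toAlgorithm, if_neg (Net.nbrIds_ne_empty w)]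
      exact h t (by omega) w
    simp only [DistributedAlgorithm.run, ih (by omega), DistributedAlgorithm.next,
      DistributedAlgorithm.message, hout, Option.isSome_none, Bool.false_eq_true, if_false]
    simp only [toAlgorithm, Prog.run]
    rw [if_neg id]
    congr 2
    funext i
    -- The stored set of neighbours separates a neighbour sending `0`, whose code is the empty
    -- string, from a number that is no neighbour's identifier.
    split_ifs with hi
    · obtain ⟨w, hw, rfl⟩ : ∃ w, N.G.Adj v w ∧ N.ident w = i := by
        simpa [Net.nbrIds, Net.mem_nbr] using hi
      rw [Net.inb_of_adj _ hw]
      have hinj : Function.Injective (fun w : N.G.neighborSet v => N.ident w) := fun a b hab =>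
        Subtype.ext (N.ident.injective hab)
      have := hinj.extend_apply (fun w : N.G.neighborSet v => (P.msg (P.run N t w)).bits)
        (fun _ => []) ⟨w, hw⟩
      simp only at this
      rw [this, Function.leftInverse_invFun Nat.bits_injective]
    · symm
      unfold Net.inb
      rw [dif_neg]
      rintro ⟨w, hw, rfl⟩
      exact hi (by simpa [Net.nbrIds, Net.mem_nbr] using hw)

end Prog

theorem DistributedAlgorithm.run_eq_of_output {O : Type} (𝒜 : DistributedAlgorithm O)
    {V : Type*} [Fintype V] (G : SimpleGraph V) (ident : V ↪ ℕ) {T : ℕ} {v : V}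
    (h : (𝒜.output (𝒜.run G ident T v)).isSome) :
    ∀ t ≥ T, 𝒜.run G ident t v = 𝒜.run G ident T v := by
  intro t ht
  induction t, ht using Nat.le_induction with
  | base => rfl
  | succ t _ ih =>
    rw [DistributedAlgorithm.run, ih, DistributedAlgorithm.next, if_pos h]

/-- Knowledge that broadcast programs can acquire can be output by a distributed algorithm. -/
theorem Solvable.exists_algorithm {O : Type} (o : O) {T : Net.{u} → ℕ} {Q : Lab.{u} O}
    (h : Solvable T Q) : ∃ 𝒜 : DistributedAlgorithm O, ∀ c : ℕ, ∃ B : ℕ,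
      (∀ (V : Type u) [Fintype V] [Subsingleton V] (G : SimpleGraph V) (ident : V ↪ ℕ),
        𝒜.RespectsBandwidth G ident (B * Nat.log 2 (Fintype.card V)) ∧
        ∀ t, 𝒜.TerminatesWithin G ident t (fun _ => o)) ∧
      ∀ N : Net.{u}, (∀ v, N.ident v < Fintype.card N.V ^ c) →
        𝒜.RespectsBandwidth N.G N.ident (B * Nat.log 2 (Fintype.card N.V)) ∧
        ∀ t ≥ T N, 𝒜.TerminatesWithin N.G N.ident t (Q N) := by
  obtain ⟨P, K, hP⟩ := h
  refine ⟨P.toAlgorithm o, fun c => ⟨2 * ((c + 2) * K + 1), ?_, ?_⟩⟩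
  · intro V _ _ G ident
    refine ⟨fun t x y hxy => absurd (Subsingleton.elim x y) hxy.ne, fun t v => ?_⟩
    have h0 : (P.toAlgorithm o).output ((P.toAlgorithm o).run G ident 0 v) = some o := by
      simp only [Prog.toAlgorithm, DistributedAlgorithm.run]
      rw [if_pos]
      rw [Finset.map_eq_empty, Finset.filter_eq_empty_iff]
      exact fun w _ hw => absurd (Subsingleton.elim v w) hw.ne
    rw [DistributedAlgorithm.run_eq_of_output _ _ _ (by rw [h0]; rfl) t (Nat.zero_le _), h0]
  · intro N hid
    obtain ⟨h1, h2, h3⟩ := hP N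
    have hrun := P.run_toAlgorithm o N (T N) h1
    have hT : ∀ t ≥ T N, ∀ v, (P.toAlgorithm o).output ((P.toAlgorithm o).run N.G N.ident t v)
        = some (Q N v) := by
      intro t ht v
      have h0 : (P.toAlgorithm o).output ((P.toAlgorithm o).run N.G N.ident (T N) v)
          = some (Q N v) := by
        rw [hrun _ le_rfl]
        simp only [Prog.toAlgorithm, if_neg (Net.nbrIds_ne_empty v), h2]
      rw [DistributedAlgorithm.run_eq_of_output _ _ _ (by rw [h0]; rfl) t ht, h0]
    refine ⟨fun t x y hxy => ?_, fun t ht v => hT t ht v⟩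
    by_cases ht : t < T N
    · rw [DistributedAlgorithm.message, hrun t ht.le]
      split_ifs
      · simp
      · have hb : P.msg (P.run N t x) ≤ Fintype.card N.V ^ ((c + 2) * K) := by
          rw [pow_mul]
          exact (h3 t ht x).trans (Nat.pow_le_pow_left (Net.size_le hid) _)
        exact length_bits_le N.two_le_card hb
    · rw [DistributedAlgorithm.message, hT t (by omega)]
      simp

/-! ### The breadth-first search tree -/

namespace Net

variable {N : Net.{u}}

theorem exists_adj_dist {v w : N.V} {m : ℕ} (h : N.G.dist v w = m + 1) :
    ∃ x, N.G.Adj v x ∧ N.G.dist x w = m := by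
  obtain ⟨p, hp⟩ := N.conn.exists_walk_length_eq_dist v w
  cases p with
  | nil => rw [SimpleGraph.dist_self] at h; omega
  | cons ha q =>
    refine ⟨_, ha, ?_⟩
    have h1 := SimpleGraph.dist_le q
    rw [SimpleGraph.Walk.length_cons] at hp
    have h3 := N.conn.dist_triangle (u := v) (v := ‹_›) (w := w)
    rw [SimpleGraph.dist_eq_one_iff_adj.2 ha] at h3
    omega

theorem dist_le_succ_of_adj {v x w : N.V} (h : N.G.Adj v x) :
    N.G.dist v w ≤ N.G.dist x w + 1 := by
  have h3 := N.conn.dist_triangle (u := v) (v := x) (w := w)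
  rw [SimpleGraph.dist_eq_one_iff_adj.2 h] at h3
  omega

theorem dist_lt_card (v w : N.V) : N.G.dist v w < Fintype.card N.V := by
  obtain ⟨p, hp, h⟩ := N.conn.exists_path_of_dist v w
  rw [← h]
  exact hp.length_lt

variable (N) in
theorem exists_root : ∃ r : N.V, ∀ v, N.ident r ≤ N.ident v :=
  have := N.nontriv
  Finite.exists_min N.ident

variable (N) in
/-- The node with the smallest identifier. -/
noncomputable def root : N.V := N.exists_root.choose

theorem ident_root_le (v : N.V) : N.ident N.root ≤ N.ident v := N.exists_root.choose_spec v

/-- The distance to the root. -/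
noncomputable def dep (v : N.V) : ℕ := N.G.dist v N.root

theorem dep_eq_zero {v : N.V} : dep v = 0 ↔ v = N.root := N.conn.dist_eq_zero_iff

@[simp] theorem dep_root : dep N.root = 0 := dep_eq_zero.2 rfl

variable (N) in
/-- The height of the tree. -/
noncomputable def height : ℕ := Finset.univ.sup (dep (N := N))

theorem dep_le_height (v : N.V) : dep v ≤ N.height := Finset.le_sup (f := dep) (Finset.mem_univ v)

theorem dep_lt_card (v : N.V) : dep v < Fintype.card N.V := dist_lt_card _ _

theorem height_le_size : N.height ≤ N.size :=
  Finset.sup_le fun v _ => (dep_lt_card v).le.trans card_le_size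

theorem height_le_diam : N.height ≤ N.G.diam := by
  have := N.nontriv
  exact Finset.sup_le fun v _ =>
    SimpleGraph.dist_le_diam (SimpleGraph.connected_iff_ediam_ne_top.1 N.conn)

theorem exists_parent {v : N.V} (h : v ≠ N.root) : ∃ w, (N.G.Adj v w ∧ dep w + 1 = dep v) ∧
    ∀ x, N.G.Adj v x ∧ dep x + 1 = dep v → N.ident w ≤ N.ident x := by
  have h0 : dep v ≠ 0 := fun h' => h (dep_eq_zero.1 h')
  obtain ⟨m, hm⟩ := Nat.exists_eq_succ_of_ne_zero h0
  obtain ⟨x, hx, hd⟩ := exists_adj_dist hm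
  obtain ⟨w, hw, hmin⟩ := Finset.exists_min_image
    (Finset.univ.filter fun w => N.G.Adj v w ∧ dep w + 1 = dep v) N.ident
    ⟨x, by simp only [Finset.mem_filter, Finset.mem_univ, true_and]; exact ⟨hx, by rw [hm]; simp [dep, hd]⟩⟩
  exact ⟨w, by simpa using hw, fun y hy => hmin y (by simpa using hy)⟩

/-- The parent of a node in the breadth-first search tree; the root is its own parent. -/
noncomputable def par (v : N.V) : N.V := if h : v = N.root then N.root else (exists_parent h).choose

@[simp] theorem par_root : par N.root = N.root := by simp [par]

theorem par_spec {v : N.V} (h : v ≠ N.root) : (N.G.Adj v (par v) ∧ dep (par v) + 1 = dep v) ∧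
    ∀ x, N.G.Adj v x ∧ dep x + 1 = dep v → N.ident (par v) ≤ N.ident x := by
  rw [par, dif_neg h]
  exact (exists_parent h).choose_spec

theorem adj_par {v : N.V} (h : v ≠ N.root) : N.G.Adj v (par v) := (par_spec h).1.1

theorem dep_par {v : N.V} (h : v ≠ N.root) : dep (par v) + 1 = dep v := (par_spec h).1.2

theorem ne_root_of_dep_pos {v : N.V} (h : 0 < dep v) : v ≠ N.root := fun h' => by
  rw [dep_eq_zero.2 h'] at h; omega

/-! ### Leader election -/

/-- The smallest identifier within distance `k`. -/
noncomputable def nearMin : ℕ → N.V → ℕ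
  | 0, v => N.ident v
  | k + 1, v => sInf {m | m = nearMin k v ∨ ∃ i, N.inb v (nearMin k) i = some m}

theorem nearMin_spec (k : ℕ) : ∀ v : N.V,
    (∃ w, N.G.dist v w ≤ k ∧ nearMin k v = N.ident w) ∧
    ∀ w, N.G.dist v w ≤ k → nearMin k v ≤ N.ident w := by
  induction k with
  | zero =>
    refine fun v => ⟨⟨v, by simp, rfl⟩, fun w hw => ?_⟩
    rw [N.conn.dist_eq_zero_iff.1 (Nat.le_zero.1 hw)]
    rfl
  | succ k ih =>
    intro v
    constructor
    · have hmem : nearMin (k + 1) v ∈ {m | m = nearMin k v ∨ ∃ i, N.inb v (nearMin k) i = some m} :=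
        Nat.sInf_mem ⟨_, Or.inl rfl⟩
      rcases hmem with h | ⟨i, h⟩
      · obtain ⟨w, hw, he⟩ := (ih v).1
        exact ⟨w, by omega, h.trans he⟩
      · obtain ⟨x, hx, -, he⟩ := inb_eq_some.1 h
        obtain ⟨w, hw, he'⟩ := (ih x).1
        exact ⟨w, (dist_le_succ_of_adj hx).trans (by omega), he.symm.trans he'⟩
    · intro w hw
      rcases Nat.lt_or_ge k (N.G.dist v w) with hlt | hle
      · obtain ⟨x, hx, hd⟩ := exists_adj_dist (show N.G.dist v w = k + 1 by omega)
        exact (Nat.sInf_le (Or.inr ⟨_, inb_of_adj (nearMin k) hx⟩)).trans ((ih x).2 w hd.le)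
      · exact (Nat.sInf_le (Or.inl rfl)).trans ((ih v).2 w hle)

/-- Flooding the minimum thus measures the depth: the identifier of the root reaches a node exactly
after `dep v` rounds. -/
theorem nearMin_eq_iff {k : ℕ} {v : N.V} : nearMin k v = N.ident N.root ↔ dep v ≤ k := by
  constructor
  · intro h
    obtain ⟨w, hw, he⟩ := (nearMin_spec k v).1
    rwa [N.ident.injective (he.symm.trans h)] at hw
  · intro h
    obtain ⟨w, hw, he⟩ := (nearMin_spec k v).1
    exact le_antisymm ((nearMin_spec k v).2 _ h) (he ▸ ident_root_le w)

theorem nearMin_le_size (k : ℕ) (v : N.V) : nearMin k v ≤ N.size := by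
  obtain ⟨w, -, he⟩ := (nearMin_spec k v).1
  exact he ▸ ident_le_size w

/-- If some node is farther than `k` from the root, every node has a node within distance `2 * k`
that sees two different minima. -/
theorem exists_conflict {k : ℕ} (hk : k < N.height) (v : N.V) : ∃ w, N.G.dist v w ≤ 2 * k ∧
    ∃ x, N.G.Adj w x ∧ nearMin k x ≠ nearMin k w := by
  obtain ⟨r, hr, he⟩ := (nearMin_spec k v).1
  -- If all nodes saw the identifier of `r`, then `r` would be the root and every node would have
  -- depth at most `k`.
  have hex : ∃ y : N.V, nearMin k y ≠ N.ident r := by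
    by_contra! hall
    have h1 : ∀ y, N.G.dist y r ≤ k := fun y => by
      obtain ⟨z, hz, hez⟩ := (nearMin_spec k y).1
      rw [N.ident.injective ((hall y).symm.trans hez)]
      exact hz
    have h2 : N.ident r ≤ N.ident N.root :=
      (hall N.root).symm.trans_le ((nearMin_spec k N.root).2 _ (by simp))
    have h3 : r = N.root := N.ident.injective (le_antisymm h2 (ident_root_le r))
    have : N.height ≤ k := Finset.sup_le fun y _ => by rw [dep, ← h3]; exact h1 y
    omega
  obtain ⟨y, hy⟩ := hex
  -- Some link on a walk from `v` to `y` leaves the set of nodes that see `r`. Both `v` and `w` are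
  -- within distance `k` of `r`, which gives `2 * k`.
  obtain ⟨w, hw, x, hx, hwx⟩ : ∃ w, nearMin k w = N.ident r ∧ ∃ x, nearMin k x ≠ N.ident r ∧
      N.G.Adj w x := by
    by_contra! hno
    obtain ⟨p⟩ := N.conn.preconnected v y
    have key : ∀ {a b : N.V} (q : N.G.Walk a b), nearMin k a = N.ident r →
        nearMin k b = N.ident r := by
      intro a b q
      induction q with
      | nil => exact id
      | cons hadj q ih => exact fun ha => ih (by by_contra hb; exact hno _ ha _ hb hadj)
    exact hy (key p he)
  refine ⟨w, ?_, x, hwx, by rw [hw]; exact hx⟩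
  obtain ⟨z, hz, hez⟩ := (nearMin_spec k w).1
  rw [← N.ident.injective (hw.symm.trans hez)] at hz
  have := N.conn.dist_triangle (u := v) (v := r) (w := w)
  rw [N.G.dist_comm] at hz
  omega

/-- One more than the largest radius that `v` knows at time `t` to be too small. -/
noncomputable def known : ℕ → N.V → ℕ
  | 0, _ => 0
  | t + 1, v => sSup {g | g = known t v ∨ (∃ i, N.inb v (known t) i = some g) ∨
      (g = t + 1 ∧ ∃ i m, N.inb v (nearMin t) i = some m ∧ m ≠ nearMin t v)}

/-- From radius `N.height` on all nodes see the root, so conflicts occur only at smaller radii. -/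
theorem known_le (t : ℕ) : ∀ v : N.V, known t v ≤ t ∧ known t v ≤ N.height := by
  induction t with
  | zero => exact fun v => ⟨le_rfl, Nat.zero_le _⟩
  | succ t ih =>
    intro v
    have hb : ∀ g ∈ {g | g = known t v ∨ (∃ i, N.inb v (known t) i = some g) ∨
      (g = t + 1 ∧ ∃ i m, N.inb v (nearMin t) i = some m ∧ m ≠ nearMin t v)},
        g ≤ min (t + 1) N.height := by
      rintro g (rfl | ⟨i, h⟩ | ⟨rfl, i, m, h, hm⟩)
      · have := ih v
        omega
      · obtain ⟨w, -, -, rfl⟩ := inb_eq_some.1 h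
        have := ih w
        omega
      · refine le_min le_rfl (Nat.lt_of_not_le fun hle => hm ?_)
        obtain ⟨w, -, -, rfl⟩ := inb_eq_some.1 h
        rw [nearMin_eq_iff.2 ((dep_le_height w).trans hle),
          nearMin_eq_iff.2 ((dep_le_height v).trans hle)]
    have := csSup_le (s := {g | g = known t v ∨ (∃ i, N.inb v (known t) i = some g) ∨
      (g = t + 1 ∧ ∃ i m, N.inb v (nearMin t) i = some m ∧ m ≠ nearMin t v)})
      ⟨_, Or.inl rfl⟩ hb
    exact le_min_iff.1 this

theorem le_known_succ {t g : ℕ} {v : N.V} (h : g = known t v ∨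
    (∃ i, N.inb v (known t) i = some g) ∨
      (g = t + 1 ∧ ∃ i m, N.inb v (nearMin t) i = some m ∧ m ≠ nearMin t v)) :
    g ≤ known (t + 1) v := by
  refine le_csSup ⟨t + 1, ?_⟩ h
  rintro g (rfl | ⟨i, h⟩ | ⟨rfl, i, m, h, hm⟩)
  · have := known_le t v
    omega
  · obtain ⟨w, -, -, rfl⟩ := inb_eq_some.1 h
    have := known_le t w
    omega
  · rfl

/-- A conflict at radius `k` is noticed at time `k + 1` by a node within distance `2 * k`, and the
news travels one step per round. -/
theorem succ_le_known {k t : ℕ} (hk : k < N.height) (ht : 3 * k + 1 ≤ t) (v : N.V) :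
    k + 1 ≤ known t v := by
  obtain ⟨w, hw, x, hwx, hne⟩ := exists_conflict hk v
  have hflood : ∀ s, ∀ y : N.V, N.G.dist y w ≤ s → k + 1 ≤ known (k + 1 + s) y := by
    intro s
    induction s with
    | zero =>
      intro y hy
      rw [N.conn.dist_eq_zero_iff.1 (Nat.le_zero.1 hy)]
      exact le_known_succ (Or.inr (Or.inr ⟨rfl, _, _, inb_of_adj (nearMin k) hwx, hne⟩))
    | succ s ih =>
      intro y hy
      rcases Nat.lt_or_ge s (N.G.dist y w) with hlt | hle
      · obtain ⟨z, hz, hd⟩ := exists_adj_dist (show N.G.dist y w = s + 1 by omega)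
        exact (ih z hd.le).trans (le_known_succ (Or.inr (Or.inl ⟨_, inb_of_adj _ hz⟩)))
      · exact (ih y hle).trans (le_known_succ (Or.inl rfl))
  obtain ⟨s, rfl⟩ := Nat.exists_eq_add_of_le (show k + 1 ≤ t by omega)
  exact hflood s v (by omega)

theorem known_eq_height (v : N.V) : known (3 * N.height + 1) v = N.height := by
  refine le_antisymm (known_le _ v).2 ?_
  rcases Nat.eq_zero_or_pos N.height with h | h
  · rw [h]; exact Nat.zero_le _
  · have := succ_le_known (k := N.height - 1) (t := 3 * N.height + 1) (by omega) (by omega) v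
    omega

/-- Termination test without global information. If the known value `g` is still below the height,
then `t = 3 * g + 1` is impossible, because at that time `succ_le_known` already provides `g + 1`.
Hence all nodes stop in the same round. -/
theorem eq_iff_known {t : ℕ} {v : N.V} (ht : t ≤ 3 * N.height + 1) :
    t = 3 * N.height + 1 ↔ t = 3 * known t v + 1 := by
  constructor
  · rintro rfl
    rw [known_eq_height]
  · intro h
    rcases Nat.lt_or_ge (known t v) N.height with hlt | hge
    · have := succ_le_known (t := t) hlt (by omega) v
      omega
    · have := (known_le t v).2
      omega

/-- What a node knows about the tree when the leader is elected: the height, the identifiers of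
the neighbours, its own identifier, that of its parent, and its depth. -/
noncomputable def base : Lab.{u} (ℕ × Finset ℕ × ℕ × ℕ × ℕ) := fun N v =>
  (N.height, N.nbrIds v, N.ident v, N.ident (par v), dep v)

/-- The depth is the first time at which the minimum has its final value, so it can be read off the
recorded history. -/
theorem dep_eq_sInf (v : N.V) (f : ℕ → ℕ) (hf : ∀ s ≤ N.height, f s = nearMin s v) :
    dep v = sInf {s | f s = f N.height} := by
  have hH : f N.height = N.ident N.root := by
    rw [hf _ le_rfl, nearMin_eq_iff]
    exact dep_le_height v
  have hmem : dep v ∈ {s | f s = f N.height} := by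
    show f (dep v) = f N.height
    rw [hH, hf _ (dep_le_height v), nearMin_eq_iff]
  refine le_antisymm (le_csInf ⟨_, hmem⟩ fun s hs => ?_) (Nat.sInf_le hmem)
  by_contra! hlt
  have : f s = N.ident N.root := Eq.trans hs hH
  rw [hf s (hlt.le.trans (dep_le_height v)), nearMin_eq_iff] at this
  omega

/-- The neighbours that saw the root at time `dep v - 1` are those one level higher; ties are broken
by the smallest identifier, as in the definition of the parent. -/
theorem ident_par_eq (v : N.V) : N.ident (par v) = if dep v = 0 then N.ident v else
    sInf {i | N.inb v (nearMin (dep v - 1)) i = some (N.ident N.root)} := by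
  split_ifs with h
  · rw [dep_eq_zero.1 h, par_root]
  · have hv : v ≠ N.root := fun h' => h (dep_eq_zero.2 h')
    have hp := dep_par hv
    have hmem : N.ident (par v) ∈ {i | N.inb v (nearMin (dep v - 1)) i = some (N.ident N.root)} := by
      rw [Set.mem_ofPred_eq, inb_of_adj _ (adj_par hv), nearMin_eq_iff.2 (by omega)]
    refine le_antisymm (le_csInf ⟨_, hmem⟩ fun i hi => ?_) (Nat.sInf_le hmem)
    obtain ⟨w, hw, rfl, he⟩ := inb_eq_some.1 hi
    rw [nearMin_eq_iff] at he
    have := dist_le_succ_of_adj (w := N.root) hw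
    refine (par_spec hv).2 w ⟨hw, ?_⟩
    change dep v ≤ dep w + 1 at this
    omega

end Net

open Net in
/-- A leader and a breadth-first search tree can be found in a linear number of rounds. -/
theorem solvable_base : Solvable (fun N : Net.{u} => 3 * N.height + 1) base.{u} := by
  -- The full history of minima, at the node and at its neighbours, is kept because depth and parent
  -- are reconstructed from it at the end.
  let Q : ℕ → Lab.{u} ((ℕ × Finset ℕ) × (ℕ → ℕ) × (ℕ → ℕ → Option ℕ) × ℕ) := fun t N v =>
    ((N.ident v, N.nbrIds v), (fun s => if s ≤ t then nearMin s v else 0),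
      (fun s => if s < t then N.inb v (nearMin s) else fun _ => none), known t v)
  have h0 : Solvable (fun _ => 0) (Q 0) := by
    refine Solvable.start.det fun N v N' v' h => ?_
    simp only [Prod.mk.injEq] at h
    simp only [Q, h.1, h.2, Prod.mk.injEq, true_and, known, and_true, Nat.not_lt_zero, if_false,
      Nat.le_zero]
    funext s
    split_ifs with hs
    · subst hs; exact h.1
    · rfl
  have key := Solvable.loop (fun N => 3 * N.height + 1) h0
    (fun t q => Nat.pair (q.2.1 t) q.2.2.2) 4 ?_ ?_ ?_
  · have : (fun N : Net.{u} => 0 + (3 * N.height + 1)) = fun N => 3 * N.height + 1 := by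
      funext N; omega
    rw [this] at key
    refine key.det fun N v N' v' h => ?_
    simp only [Q, Prod.mk.injEq, known_eq_height] at h
    obtain ⟨⟨h1, h2⟩, h3, h4, h5⟩ := h
    have hd : dep v = dep v' := by
      have e1 := dep_eq_sInf v (fun s => if s ≤ 3 * N'.height + 1 then nearMin s v' else 0)
        fun s hs => (congrFun h3 s).symm.trans (if_pos (by omega))
      have e2 := dep_eq_sInf v' (fun s => if s ≤ 3 * N'.height + 1 then nearMin s v' else 0)
        fun s hs => if_pos (by omega)
      rw [h5] at e1
      exact e1.trans e2.symm
    have hr : N.ident N.root = N'.ident N'.root := by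
      have e := congrFun h3 N.height
      rw [if_pos (by omega), if_pos (by omega), nearMin_eq_iff.2 (dep_le_height v),
        nearMin_eq_iff.2 (h5 ▸ dep_le_height v')] at e
      exact e
    have hp : N.ident (par v) = N'.ident (par v') := by
      rw [ident_par_eq, ident_par_eq, hd, h1, hr]
      have e := congrFun h4 (dep v' - 1)
      have := dep_le_height v'
      rw [if_pos (by omega), if_pos (by omega)] at e
      rw [e]
    simp only [base, h1, h2, h5, hd, hp]
  · intro N t v ht
    simp only [Q, le_refl, if_true]
    have h1 := nearMin_le_size t v
    have h2 := (known_le t v).2.trans N.height_le_size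
    have h3 := N.two_le_size
    calc Nat.pair (nearMin t v) (known t v) ≤ (max (nearMin t v) (known t v) + 1) ^ 2 :=
          (Nat.pair_lt_max_add_one_sq _ _).le
      _ ≤ (N.size ^ 2) ^ 2 := Nat.pow_le_pow_left (by
          have := max_le h1 h2
          nlinarith) _
      _ = N.size ^ 4 := by rw [← pow_mul]
  · intro t N v N' v' ht ht' hQ hin
    simp only [Q, le_refl, if_true] at hin
    have hin1 := inb_map_congr hin (fun p => p.unpair.1)
    have hin2 := inb_map_congr hin (fun p => p.unpair.2)
    simp only [Nat.unpair_pair] at hin1 hin2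
    have hin1 : N.inb v (nearMin t) = N'.inb v' (nearMin t) := hin1
    have hin2 : N.inb v (known t) = N'.inb v' (known t) := hin2
    simp only [Q, Prod.mk.injEq] at hQ ⊢
    obtain ⟨⟨h1, h2⟩, h3, h4, h5⟩ := hQ
    have hm : nearMin t v = nearMin t v' := by simpa using congrFun h3 t
    refine ⟨⟨h1, h2⟩, ?_, ?_, ?_⟩
    · funext s
      have e := congrFun h3 s
      rcases Nat.lt_trichotomy s (t + 1) with hs | rfl | hs
      · rw [if_pos (by omega), if_pos (by omega)]
        rwa [if_pos (by omega), if_pos (by omega)] at e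
      · simp only [le_refl, if_true, nearMin, hm, hin1]
      · rw [if_neg (by omega), if_neg (by omega)]
    · funext s
      have e := congrFun h4 s
      rcases Nat.lt_trichotomy s t with hs | rfl | hs
      · rw [if_pos (by omega), if_pos (by omega)]
        rwa [if_pos (by omega), if_pos (by omega)] at e
      · simp only [Nat.lt_succ_self, if_true, hin1]
      · rw [if_neg (by omega), if_neg (by omega)]
    · simp only [known, h5, hin2, hin1, hm]
  · intro t N v N' v' ht ht' hQ
    simp only [Q, Prod.mk.injEq] at hQ
    rw [eq_iff_known (v := v) ht, eq_iff_known (v := v') ht', hQ.2.2.2]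

/-! ### Ancestors and subtrees -/

namespace Net

variable {N : Net.{u}}

theorem dep_par' (v : N.V) : dep (par v) = dep v - 1 := by
  by_cases h : v = N.root
  · subst h; simp
  · have := dep_par h
    omega

theorem dep_iterate (i : ℕ) (v : N.V) : dep (par^[i] v) = dep v - i := by
  induction i with
  | zero => rfl
  | succ i ih => rw [Function.iterate_succ_apply', dep_par', ih]; omega

/-- The ancestor at level `j`, or the node itself if it lies above that level. -/
noncomputable def ancAt (j : ℕ) (v : N.V) : N.V := par^[dep v - j] v

theorem dep_ancAt {j : ℕ} {v : N.V} (h : j ≤ dep v) : dep (ancAt j v) = j := by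
  rw [ancAt, dep_iterate]; omega

theorem ancAt_of_le {j : ℕ} {v : N.V} (h : dep v ≤ j) : ancAt j v = v := by
  rw [ancAt, Nat.sub_eq_zero_of_le h]; rfl

theorem ancAt_dep (v : N.V) : ancAt (dep v) v = v := ancAt_of_le le_rfl

theorem ancAt_par {j : ℕ} {v : N.V} (h : j < dep v) : ancAt j (par v) = ancAt j v := by
  have h1 := dep_par' v
  rw [ancAt, ancAt, ← Function.iterate_succ_apply, show (dep (par v) - j).succ = dep v - j by omega]

theorem ancAt_ancAt {i j : ℕ} (h : i ≤ j) (v : N.V) : ancAt i (ancAt j v) = ancAt i v := by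
  rcases Nat.le_total j (dep v) with hj | hj
  · rw [ancAt, dep_ancAt hj, ancAt, ← Function.iterate_add_apply, ancAt]
    congr 1
    omega
  · rw [ancAt_of_le hj]

theorem ancAt_zero (v : N.V) : ancAt 0 v = N.root := dep_eq_zero.1 (dep_ancAt (Nat.zero_le _))

theorem iterate_eq_ancAt (i : ℕ) (v : N.V) : par^[i] v = ancAt (dep v - i) v := by
  rcases Nat.le_total i (dep v) with hi | hi
  · rw [ancAt, Nat.sub_sub_self hi]
  · rw [Nat.sub_eq_zero_of_le hi, ancAt_zero, ← dep_eq_zero, dep_iterate]; omega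

theorem par_ancAt {j : ℕ} {v : N.V} (h : j < dep v) : par (ancAt (j + 1) v) = ancAt j v := by
  have h1 : dep (ancAt (j + 1) v) = j + 1 := dep_ancAt h
  rw [← ancAt_ancAt (Nat.le_succ j) v, ← ancAt_par (v := ancAt (j + 1) v) (by omega),
    ancAt_of_le (v := par _)]
  rw [dep_par', h1]; omega

/-- `x` lies in the subtree of `a`. -/
def Sub (a x : N.V) : Prop := ancAt (dep a) x = a

theorem Sub.dep_le {a x : N.V} (h : Sub a x) : dep a ≤ dep x := by
  by_contra! hlt
  rw [Sub, ancAt_of_le hlt.le] at h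
  rw [h] at hlt
  exact lt_irrefl _ hlt

theorem Sub.refl (a : N.V) : Sub a a := ancAt_dep a

theorem Sub.trans {a b x : N.V} (h : Sub a b) (h' : Sub b x) : Sub a x := by
  have h1 := ancAt_ancAt h.dep_le x
  rw [h', h] at h1
  exact h1.symm

theorem Sub.antisymm {a b : N.V} (h : Sub a b) (h' : Sub b a) : a = b := by
  rw [← h, ancAt_of_le h'.dep_le]

theorem Sub.sub_of_dep_le {a b x : N.V} (h : Sub a x) (h' : Sub b x) (hd : dep a ≤ dep b) :
    Sub a b := by
  have h1 := ancAt_ancAt hd x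
  rw [h', h] at h1
  exact h1

theorem Sub.total {a b x : N.V} (h : Sub a x) (h' : Sub b x) : Sub a b ∨ Sub b a :=
  (Nat.le_total (dep a) (dep b)).imp (h.sub_of_dep_le h') (h'.sub_of_dep_le h)

theorem sub_ancAt (j : ℕ) (x : N.V) : Sub (ancAt j x) x := by
  rcases Nat.le_total j (dep x) with h | h
  · rw [Sub, dep_ancAt h]
  · rw [ancAt_of_le h]; exact Sub.refl x

theorem sub_root (x : N.V) : Sub N.root x := by rw [Sub, dep_root, ancAt_zero]

theorem sub_par_iff {a x : N.V} (h : x ≠ a) : Sub a (par x) ↔ Sub a x := by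
  by_cases hr : x = N.root
  · subst hr; rw [par_root]
  have hd := dep_par hr
  constructor
  · intro hs
    have := hs.dep_le
    rw [Sub, ← hs, hs, ← ancAt_par (by omega)]
    exact hs
  · intro hs
    have h1 : dep a < dep x := by
      refine lt_of_le_of_ne hs.dep_le fun he => h ?_
      rw [← hs, he, ancAt_dep]
    rw [Sub, ancAt_par h1]
    exact hs

theorem not_sub_par {a : N.V} (h : a ≠ N.root) : ¬ Sub a (par a) := fun hs => by
  have := hs.dep_le
  have := dep_par h
  omega

/-- The nodes of a subtree. -/
noncomputable def subtree (v : N.V) : Finset N.V := Finset.univ.filter fun x => Sub v x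

theorem mem_subtree {v x : N.V} : x ∈ subtree v ↔ Sub v x := by simp [subtree]

theorem dep_child {v c : N.V} (h : N.G.Adj v c) (hp : par c = v) : c ≠ N.root ∧ dep c = dep v + 1 := by
  have hc : c ≠ N.root := by
    rintro rfl
    rw [par_root] at hp
    exact h.ne hp.symm
  exact ⟨hc, by rw [← hp, dep_par hc]⟩

/-- The proper descendants are sorted by their ancestor one level below `v`. This is the recursion
behind aggregation from the children. -/
theorem sum_subtree {M : Type*} [AddCommMonoid M] (v : N.V) (f : N.V → M) :
    ∑ x ∈ subtree v, f x
      = f v + ∑ c ∈ N.nbr v, if par c = v then ∑ x ∈ subtree c, f x else 0 := by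
  have h1 : subtree v = insert v ((subtree v).erase v) :=
    (Finset.insert_erase (mem_subtree.2 (Sub.refl v))).symm
  rw [h1, Finset.sum_insert (by simp), ← Finset.sum_filter]
  congr 1
  rw [← Finset.sum_fiberwise_of_maps_to (t := (N.nbr v).filter fun c => par c = v)
    (g := ancAt (dep v + 1))]
  · refine Finset.sum_congr rfl fun c hc => Finset.sum_congr ?_ fun _ _ => rfl
    rw [Finset.mem_filter, mem_nbr] at hc
    obtain ⟨hcr, hd⟩ := dep_child hc.1 hc.2
    ext x
    simp only [Finset.mem_filter, Finset.mem_erase, mem_subtree]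
    constructor
    · rintro ⟨-, h⟩
      rw [Sub, hd, h]
    · intro h
      have hvc : Sub v c := (sub_par_iff (by rintro rfl; exact hc.1.ne rfl)).1 (by
        rw [hc.2]; exact Sub.refl v)
      refine ⟨⟨?_, hvc.trans h⟩, by rw [← hd]; exact h⟩
      rintro rfl
      have := h.dep_le
      omega
  · intro x hx
    rw [Finset.mem_erase, mem_subtree] at hx
    have hlt : dep v < dep x := by
      refine lt_of_le_of_ne hx.2.dep_le fun he => hx.1 ?_
      rw [← hx.2, he, ancAt_dep]
    have hp := par_ancAt hlt
    rw [hx.2] at hp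
    rw [Finset.mem_filter, mem_nbr]
    refine ⟨?_, hp⟩
    have := adj_par (v := ancAt (dep v + 1) x) (ne_root_of_dep_pos (by
      rw [dep_ancAt hlt]; omega))
    rw [hp] at this
    exact this.symm

/-! ### Root paths as lists of identifiers -/

/-- The identifiers on the path from the root. -/
noncomputable def path (v : N.V) : List ℕ :=
  (List.range (dep v + 1)).map fun j => N.ident (ancAt j v)

@[simp] theorem length_path (v : N.V) : (path v).length = dep v + 1 := by simp [path]

theorem path_getElem? (v : N.V) (j : ℕ) :
    (path v)[j]? = if j ≤ dep v then some (N.ident (ancAt j v)) else none := by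
  rw [path, List.getElem?_map]
  split_ifs with h
  · rw [List.getElem?_range (by omega)]; rfl
  · rw [List.getElem?_eq_none (by simpa using h)]; rfl

end Net

/-- The number of positions at which the first list agrees with the second. -/
def agree (l l' : List ℕ) : ℕ := ((Finset.range l.length).filter fun j => l[j]? = l'[j]?).card

theorem agree_le (l l' : List ℕ) : agree l l' ≤ l.length :=
  (Finset.card_filter_le _ _).trans_eq (Finset.card_range _)

namespace Net

variable {N : Net.{u}}

/-! ### Common prefixes of root paths -/

theorem sub_iff_path {a x : N.V} : Sub a x ↔ (path x)[dep a]? = some (N.ident a) := by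
  rw [path_getElem?]
  constructor
  · intro h
    rw [if_pos h.dep_le, h]
  · intro h
    split_ifs at h
    exact N.ident.injective (by simpa using h)

theorem sub_iff_path_eq {a x y : N.V} (h : Sub a x) :
    Sub a y ↔ (path y)[dep a]? = (path x)[dep a]? := by
  rw [sub_iff_path.1 h, sub_iff_path]

theorem path_injective : Function.Injective (path (N := N)) := fun x y h => by
  have hd : dep x = dep y := by simpa using congrArg List.length h
  have h1 : Sub y x := sub_iff_path.2 (by rw [h]; exact sub_iff_path.1 (Sub.refl y))
  exact h1.symm.trans (by rw [← hd, ancAt_dep]) |>.symm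

/-- An entry of a root path names an ancestor and thereby fixes everything above it, so agreeing
positions form a prefix. -/
theorem agree_down {x y : N.V} {i j : ℕ} (hj : j ≤ dep x) (hij : i ≤ j)
    (h : (path x)[j]? = (path y)[j]?) : (path x)[i]? = (path y)[i]? := by
  have h1 := sub_ancAt j x
  have h2 : Sub (ancAt j x) y := (sub_iff_path_eq h1).2 (by rw [dep_ancAt hj, h])
  have h3 : Sub (ancAt i x) (ancAt j x) :=
    (sub_ancAt i x).sub_of_dep_le h1 (by rw [dep_ancAt hj, dep_ancAt (by omega)]; exact hij)
  have h4 := (sub_iff_path_eq (sub_ancAt i x)).1 (h3.trans h2)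
  rw [dep_ancAt (by omega)] at h4
  exact h4.symm

/-- By `agree_down` the number of agreements is the length of the common prefix. A single number
thus answers, for every ancestor `a` of `x`, whether `y` lies below `a`. -/
theorem lt_agree_iff {a x y : N.V} (h : Sub a x) :
    dep a < agree (path x) (path y) ↔ Sub a y := by
  rw [sub_iff_path_eq h, agree]
  have hd := h.dep_le
  constructor
  · intro hlt
    by_contra hne
    have hsub : ((Finset.range (path x).length).filter fun j => (path x)[j]? = (path y)[j]?)
        ⊆ Finset.range (dep a) := by
      intro j hj
      simp only [Finset.mem_filter, Finset.mem_range, length_path] at hj ⊢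
      by_contra! hle
      exact hne (agree_down (by omega) hle hj.2).symm
    have := Finset.card_le_card hsub
    rw [Finset.card_range] at this
    omega
  · intro he
    have hsub : Finset.range (dep a + 1) ⊆
        ((Finset.range (path x).length).filter fun j => (path x)[j]? = (path y)[j]?) := by
      intro j hj
      simp only [Finset.mem_filter, Finset.mem_range, length_path] at hj ⊢
      exact ⟨by omega, agree_down hd (by omega) he.symm⟩
    have := Finset.card_le_card hsub
    rw [Finset.card_range] at this
    omega

end Net

/-! ### Words -/

/-- Values that are transmitted as sequences of numbers. -/
class Wd (R : Type) where
  wd : R → ℕ → ℕ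
  inj : Function.Injective wd

/-- The sequence of `r` has entries at most `B` and vanishes from position `l` on. -/
def Fits {R : Type} [Wd R] (B l : ℕ) (r : R) : Prop := ∀ s, Wd.wd r s ≤ B ∧ (l ≤ s → Wd.wd r s = 0)

/-! ### Broadcasting to descendants and neighbours -/

namespace Net

variable {N : Net.{u}}

theorem inb_inj_congr {β γ : Type} {N' : Net.{u}} {v : N.V} {v' : N'.V} {g : N.V → β}
    {g' : N'.V → β} {f : β → γ} (hf : Function.Injective f)
    (h : N.inb v (fun w => f (g w)) = N'.inb v' (fun w => f (g' w))) :
    N.inb v g = N'.inb v' g' := by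
  rw [inb_map, inb_map] at h
  funext i
  exact Option.map_injective hf (congrFun h i)

/-- Beyond the height all iterates are the root, so finitely many rounds deliver the whole infinite
sequence of ancestors. -/
theorem iterate_min_height (i : ℕ) (v : N.V) : par^[min i N.height] v = par^[i] v := by
  rw [iterate_eq_ancAt, iterate_eq_ancAt]
  congr 1
  have := dep_le_height v
  omega

end Net

open Net

/-- The values of `R` at a node and at all its ancestors. -/
noncomputable def info {A : Type} (R : Lab.{u} A) : Lab.{u} (ℕ → A) := fun _ v i => R _ (par^[i] v)

/-- The values of `R` at the ancestors of a node and of its neighbours. -/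
noncomputable def knows {A : Type} (R : Lab.{u} A) :
    Lab.{u} ((ℕ × Finset ℕ × ℕ × ℕ × ℕ) × (ℕ → A) × (ℕ → Option (ℕ → A))) :=
  fun N v => (base N v, info R N v, N.inb v (info R N))

/-- In round `i` a node sends the value of its `i`-th ancestor; what the parent sends is then the
value of the ancestor number `i + 1`, and what any neighbour sends extends the record of that
neighbour's ancestors. -/
theorem Solvable.broadcast {α B : Type} [Wd B] {T : Net.{u} → ℕ} {Q : Lab.{u} α} {X : Lab.{u} B}
    (h : Solvable T Q) (hb : Det Q base) (hX : Det Q X) {K c : ℕ} (hc : 0 < c)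
    (hfit : ∀ N v, Fits (N.size ^ K) (c * (N.height + 2)) (X N v)) :
    Solvable (fun N => T N + (N.height + 1) * (c * (N.height + 2)))
      (fun N v => (Q N v, info X N v, N.inb v (info X N))) := by
  let Q' : ℕ → Lab.{u} (α × (ℕ → Option B) × (ℕ → Option (ℕ → Option B))) := fun i N v =>
    (Q N v, (fun a => if a ≤ i then some (X N (par^[a] v)) else none),
      fun a => if a < i then some (N.inb v fun w => X N (par^[a] w)) else none)
  have h0 : Solvable T (Q' 0) := by
    refine h.det fun N v N' v' e => ?_
    simp only [Q', e, Nat.not_lt_zero, if_false, Prod.mk.injEq, true_and, and_true]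
    funext a
    by_cases ha : a ≤ 0
    · rw [if_pos ha, if_pos ha, Nat.le_zero.1 ha]
      exact congrArg some (hX e)
    · rw [if_neg ha, if_neg ha]
  have key := Solvable.bigLoop (fun N => N.height + 1) (fun N => c * (N.height + 2)) h0
    (fun i q => (q.2.1 i).elim (fun _ => 0) Wd.wd) K (fun N => Nat.mul_pos hc (by omega)) ?_ ?_ ?_ ?_
  · refine key.det fun N v N' v' e => ?_
    simp only [Q', Prod.mk.injEq] at e ⊢
    obtain ⟨e1, e2, e3⟩ := e
    have hH : N.height = N'.height := congrArg Prod.fst (hb e1)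
    refine ⟨e1, ?_, inb_pi_congr fun a => ?_⟩
    · funext a
      have := congrFun e2 (min a N.height)
      rw [if_pos (by omega), if_pos (by omega), Option.some.injEq, iterate_min_height, hH,
        iterate_min_height] at this
      exact this
    · have := congrFun e3 (min a N.height)
      rw [if_pos (by omega), if_pos (by omega), Option.some.injEq] at this
      simp only [iterate_min_height] at this
      rw [hH] at this
      simp only [iterate_min_height] at this
      exact this
  · intro N i v s hi
    simp only [Q', le_refl, if_true, Option.elim_some]
    exact (hfit N _ s).1
  · intro N i v s hi hs
    simp only [Q', le_refl, if_true, Option.elim_some]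
    exact (hfit N _ s).2 hs
  · intro i i' N v N' v' e
    simp only [Q', Prod.mk.injEq] at e
    have hH : N.height = N'.height := congrArg Prod.fst (hb e.1)
    exact ⟨by rw [hH], by rw [hH]⟩
  · intro i N v N' v' hi hi' e hin
    simp only [Q', le_refl, if_true, Option.elim_some, Prod.mk.injEq] at e hin ⊢
    obtain ⟨e1, e2, e3⟩ := e
    have hin' : N.inb v (fun w => X N (par^[i] w)) = N'.inb v' (fun w => X N' (par^[i] w)) :=
      inb_inj_congr Wd.inj hin
    have hbb := hb e1
    simp only [base, Prod.mk.injEq] at hbb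
    obtain ⟨-, -, -, hp, hd⟩ := hbb
    refine ⟨e1, ?_, ?_⟩
    · funext a
      have ea := congrFun e2 a
      rcases Nat.lt_trichotomy a (i + 1) with ha | rfl | ha
      · rw [if_pos (by omega), if_pos (by omega)]
        rwa [if_pos (by omega), if_pos (by omega)] at ea
      · rw [if_pos le_rfl, if_pos le_rfl]
        -- The root is its own parent, so its next value is the one it already has.
        by_cases hv : v = N.root
        · have hv' : v' = N'.root := dep_eq_zero.1 (by rw [← hd, hv, dep_root])
          have hx := congrFun e2 i
          rw [if_pos le_rfl, if_pos le_rfl] at hx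
          have r1 : par^[i + 1] v = par^[i] v := by
            rw [Function.iterate_succ_apply, hv, par_root]
          have r2 : par^[i + 1] v' = par^[i] v' := by
            rw [Function.iterate_succ_apply, hv', par_root]
          rw [r1, r2]
          exact hx
        · have hv' : v' ≠ N'.root := fun h' => hv (dep_eq_zero.1 (by rw [hd, h', dep_root]))
          have hx := congrFun hin' (N.ident (par v))
          rw [inb_of_adj _ (adj_par hv), hp, inb_of_adj _ (adj_par hv')] at hx
          rw [Function.iterate_succ_apply, Function.iterate_succ_apply]
          exact hx
      · rw [if_neg (by omega), if_neg (by omega)]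
    · funext a
      have ea := congrFun e3 a
      rcases Nat.lt_trichotomy a i with ha | rfl | ha
      · rw [if_pos (by omega), if_pos (by omega)]
        rwa [if_pos (by omega), if_pos (by omega)] at ea
      · rw [if_pos (by omega), if_pos (by omega), hin']
      · rw [if_neg (by omega), if_neg (by omega)]

/-! ### Aggregation over subtrees -/

/-- The sum over all links `(x, y)` with `x` in the subtree of `v` of the values `F j` at `x` and
`y`. -/
noncomputable def total {A M : Type} [AddCommMonoid M] (R : Lab.{u} A)
    (F : ℕ → (ℕ → A) → (ℕ → A) → M) (j : ℕ) : Lab.{u} M := fun N v =>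
  ∑ x ∈ subtree v, ∑ y ∈ N.nbr x, F j (info R N x) (info R N y)

/-- The sums `total` for all levels above the node. -/
noncomputable def totals {A M : Type} [AddCommMonoid M] (R : Lab.{u} A)
    (F : ℕ → (ℕ → A) → (ℕ → A) → M) : Lab.{u} (ℕ → M) := fun N v j =>
  if j ≤ dep v then total R F j N v else 0

/-- The aggregate that a node of depth `d` sends in round `i`. -/
def slot {M : Type} (H d i : ℕ) (f : ℕ → Option M) : Option M :=
  if 1 + (H - d) ≤ i then f (i - 1 - (H - d)) else none

theorem slot_eq {M : Type} {H d i j : ℕ} (f : ℕ → Option M) (h : H - d + 1 + j = i) :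
    slot H d i f = f j := by
  rw [slot, if_pos (by omega), show i - 1 - (H - d) = j by omega]

/-- Pipelined convergecast: a node of depth `d` sends its sum for level `j` in round `H - d + 1 +
j`, where `H` is the height, one round after its children, so different levels never collide. The
map `pid` lets a node recognize its children among its neighbours. -/
theorem Solvable.aggregate {A M : Type} [AddCommMonoid M] [Wd M] {T : Net.{u} → ℕ} {R : Lab.{u} A}
    (h : Solvable T (knows R)) (pid : A → ℕ) (hpid : ∀ N v, pid (R N v) = N.ident (par v))
    (F : ℕ → (ℕ → A) → (ℕ → A) → M) {K c : ℕ} (hc : 0 < c)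
    (hfit : ∀ N v j, j ≤ dep v → Fits (N.size ^ K) (c * (N.height + 2)) (total R F j N v)) :
    Solvable (fun N => T N + (2 * N.height + 1) * (c * (N.height + 2)))
      (fun N v => (knows R N v, totals R F N v)) := by
  let Q' : ℕ → Lab.{u} (_ × (ℕ → Option M)) := fun i N v =>
    (knows R N v, fun j => if j ≤ dep v ∧ N.height - dep v + j < i then some (total R F j N v)
      else none)
  have h0 : Solvable T (Q' 0) := by
    refine h.det fun N v N' v' e => ?_
    simp [Q', e]
  have hmsg : ∀ i (N : Net.{u}) (v : N.V), ∃ r : Option M,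
      slot (Q' i N v).1.1.1 (Q' i N v).1.1.2.2.2.2 i (Q' i N v).2 = r ∧
      ∀ m, r = some m → Fits (N.size ^ K) (c * (N.height + 2)) m := by
    intro i N v
    refine ⟨_, rfl, fun m hm => ?_⟩
    unfold slot at hm
    split_ifs at hm with h1
    simp only [Q'] at hm
    split_ifs at hm with h2
    rw [← Option.some.inj hm]
    exact hfit _ _ _ h2.1
  have key := Solvable.bigLoop (fun N => 2 * N.height + 1) (fun N => c * (N.height + 2)) h0
    (fun i q => (slot q.1.1.1 q.1.1.2.2.2.2 i q.2).elim (fun _ => 0) Wd.wd) K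
    (fun N => Nat.mul_pos hc (by omega)) ?_ ?_ ?_ ?_
  · refine key.det fun N v N' v' e => ?_
    simp only [Q', Prod.mk.injEq] at e ⊢
    obtain ⟨e1, e2⟩ := e
    refine ⟨e1, ?_⟩
    have hbb := congrArg Prod.fst e1
    simp only [knows, base, Prod.mk.injEq] at hbb
    funext j
    have ej := congrFun e2 j
    have := dep_le_height v
    have := dep_le_height v'
    simp only [totals]
    by_cases hj : j ≤ dep v
    · rw [if_pos (by omega), if_pos (by omega)] at ej
      rw [if_pos hj, if_pos (by omega)]
      exact Option.some.inj ej
    · rw [if_neg hj, if_neg (by omega)]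
  · intro N i v s hi
    obtain ⟨r, hr, hr'⟩ := hmsg i N v
    rw [hr]
    cases r with
    | none => exact Nat.zero_le _
    | some m => exact (hr' m rfl s).1
  · intro N i v s hi hs
    obtain ⟨r, hr, hr'⟩ := hmsg i N v
    rw [hr]
    cases r with
    | none => rfl
    | some m => exact (hr' m rfl s).2 hs
  · intro i i' N v N' v' e
    simp only [Q', Prod.mk.injEq] at e
    have hH : N.height = N'.height := congrArg (fun q => q.1.1) e.1
    exact ⟨by rw [hH], by rw [hH]⟩
  · intro i N v N' v' hi hi' e hin
    simp only [Q', Prod.mk.injEq] at e ⊢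
    obtain ⟨e1, e2⟩ := e
    refine ⟨e1, ?_⟩
    have hbb := e1
    simp only [knows, base, Prod.mk.injEq] at hbb
    obtain ⟨⟨hH, hnb, hid, hp, hd⟩, hI, hIn⟩ := hbb
    funext j
    have ej := congrFun e2 j
    have hle := dep_le_height v
    have hle' := dep_le_height v'
    rcases Nat.lt_trichotomy (N.height - dep v + j) i with hj | hj | hj
    · by_cases hjd : j ≤ dep v
      · rw [if_pos (by omega), if_pos (by omega)]
        rwa [if_pos (by omega), if_pos (by omega)] at ej
      · rw [if_neg (by omega), if_neg (by omega)]
    · by_cases hjd : j ≤ dep v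
      · rw [if_pos (by omega), if_pos (by omega), Option.some.injEq]
        have hin2 := inb_prod_congr hIn hin
        -- The new sum is the node's own contribution plus the sums just received from those
        -- neighbours that name it as their parent.
        have hs : ∀ (N : Net.{u}) (v : N.V), j ≤ dep v → N.height - dep v + j = i →
            total R F j N v = (∑ y ∈ N.nbr v, F j (info R N v) (info R N y)) + ∑ y ∈ N.nbr v,
              if pid (info R N y 0) = N.ident v then Function.invFun Wd.wd
                ((slot (Q' i N y).1.1.1 (Q' i N y).1.1.2.2.2.2 i (Q' i N y).2).elim
                  (fun _ => 0) (Wd.wd (R := M))) else 0 := by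
          intro N v hjd hj
          have hle := dep_le_height v
          rw [total, sum_subtree]
          congr 1
          refine Finset.sum_congr rfl fun y hy => ?_
          rw [mem_nbr] at hy
          simp only [info, Function.iterate_zero, id, hpid]
          by_cases hpy : par y = v
          · rw [if_pos hpy, if_pos (by rw [hpy])]
            obtain ⟨-, hdy⟩ := dep_child hy hpy
            have hley := dep_le_height y
            simp only [Q', knows, base]
            rw [slot_eq (j := j) _ (by omega), if_pos (by omega), Option.elim_some,
              Function.leftInverse_invFun Wd.inj]
            rfl
          · rw [if_neg hpy, if_neg fun he => hpy (N.ident.injective he)]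
        rw [hs N v hjd hj, hs N' v' (by omega) (by omega), hI, hid]
        congr 1
        · exact sum_nbr_congr hIn (fun y => F j (info R N' v') y)
        · exact sum_nbr_congr hin2 (fun y => if pid (y.1 0) = N'.ident v' then
            Function.invFun Wd.wd y.2 else 0)
      · rw [if_neg (by omega), if_neg (by omega)]
    · rw [if_neg (by omega), if_neg (by omega)]

/-- Aggregation over subtrees, followed by a broadcast of a value computed from the aggregates. -/
theorem Solvable.phase {A M B : Type} [AddCommMonoid M] [Wd M] [Wd B] {T : Net.{u} → ℕ}
    {R : Lab.{u} A} (h : Solvable T (knows R)) (pid : A → ℕ)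
    (hpid : ∀ N v, pid (R N v) = N.ident (par v)) (F : ℕ → (ℕ → A) → (ℕ → A) → M)
    (φ : A → (ℕ → M) → B) {K c : ℕ} (hc : 0 < c)
    (hfit : ∀ N v j, j ≤ dep v → Fits (N.size ^ K) (c * (N.height + 2)) (total R F j N v))
    (hfit' : ∀ N v, Fits (N.size ^ K) (c * (N.height + 2)) (φ (R N v) (totals R F N v))) :
    Solvable (fun N => T N + (3 * N.height + 2) * (c * (N.height + 2)))
      (knows fun N v => (R N v, φ (R N v) (totals R F N v))) := by
  have h1 := (h.aggregate pid hpid F hc hfit).broadcast (X := fun N v => φ (R N v) (totals R F N v))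
    (fun N v N' v' e => by
      simp only [knows, Prod.mk.injEq] at e
      exact e.1.1)
    (fun N v N' v' e => by
      simp only [knows, Prod.mk.injEq] at e
      have : R N v = R N' v' := congrFun e.1.2.1 0
      simp only [this, e.2]) hc hfit'
  have h2 : (fun N : Net.{u} => T N + (2 * N.height + 1) * (c * (N.height + 2)) +
      (N.height + 1) * (c * (N.height + 2)))
      = fun N => T N + (3 * N.height + 2) * (c * (N.height + 2)) := by
    funext N; ring
  rw [h2] at h1
  refine h1.det fun N v N' v' e => ?_
  simp only [knows, Prod.mk.injEq] at e ⊢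
  obtain ⟨⟨⟨e1, e2, e3⟩, -⟩, e4, e5⟩ := e
  refine ⟨e1, ?_, ?_⟩
  · funext i
    exact Prod.ext (congrFun e2 i) (congrFun e4 i)
  · exact inb_map_congr (inb_prod_congr e3 e5) (fun q i => (q.1 i, q.2 i))

/-! ### Cuts in terms of tree edges -/

namespace Net

variable {N : Net.{u}}

/-- `x` and `y` are joined by an edge that is not in the tree. -/
def NonTree (x y : N.V) : Prop := N.G.Adj x y ∧ par x ≠ y ∧ par y ≠ x

theorem NonTree.symm {x y : N.V} (h : NonTree x y) : NonTree y x := ⟨h.1.symm, h.2.2, h.2.1⟩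

/-- The edges outside the tree whose endpoints are, in some order, related by `p`. -/
noncomputable def edgesOf (p : N.V → N.V → Prop) : Finset (Sym2 N.V) :=
  Finset.univ.filter fun e => ∃ x y, NonTree x y ∧ p x y ∧ e = s(x, y)

theorem mem_edgesOf {p : N.V → N.V → Prop} {x y : N.V} :
    s(x, y) ∈ edgesOf p ↔ NonTree x y ∧ (p x y ∨ p y x) := by
  simp only [edgesOf, Finset.mem_filter, Finset.mem_univ, true_and, Sym2.eq_iff]
  constructor
  · rintro ⟨a, b, hn, hp, (⟨rfl, rfl⟩ | ⟨rfl, rfl⟩)⟩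
    · exact ⟨hn, Or.inl hp⟩
    · exact ⟨hn.symm, Or.inr hp⟩
  · rintro ⟨hn, hp | hp⟩
    · exact ⟨x, y, hn, hp, Or.inl ⟨rfl, rfl⟩⟩
    · exact ⟨y, x, hn.symm, hp, Or.inr ⟨rfl, rfl⟩⟩

/-- The edges outside the tree that cover the tree edge above `a`. -/
noncomputable def cov (a : N.V) : Finset (Sym2 N.V) := edgesOf fun x y => Sub a x ∧ ¬ Sub a y

theorem mem_cov {a x y : N.V} : s(x, y) ∈ cov a ↔ NonTree x y ∧ ¬ (Sub a x ↔ Sub a y) := by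
  rw [cov, mem_edgesOf]
  tauto

/-- `x` is separated from the root by an odd number of the tree edges above nodes of `X`. -/
def side (X : Finset N.V) (x : N.V) : Prop := Odd (X.filter fun a => Sub a x).card

theorem side_par_of_mem {X : Finset N.V} (hX : N.root ∉ X) {x : N.V} (hx : x ∈ X) :
    side X x ↔ ¬ side X (par x) := by
  have hr : x ≠ N.root := fun h => hX (h ▸ hx)
  have : (X.filter fun a => Sub a x) = insert x (X.filter fun a => Sub a (par x)) := by
    ext a
    simp only [Finset.mem_filter, Finset.mem_insert]
    by_cases ha : a = x
    · subst ha; simp [hx, Sub.refl]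
    · rw [sub_par_iff (Ne.symm ha)]; simp [ha]
  rw [side, this, Finset.card_insert_of_notMem (by simp [not_sub_par hr]), Nat.odd_add_one, side]

theorem side_par_of_notMem {X : Finset N.V} {x : N.V} (hx : x ∉ X) :
    side X x ↔ side X (par x) := by
  have : (X.filter fun a => Sub a x) = X.filter fun a => Sub a (par x) := by
    ext a
    simp only [Finset.mem_filter]
    by_cases ha : a = x
    · subst ha; simp [hx]
    · rw [sub_par_iff (Ne.symm ha)]
  rw [side, this, side]

theorem not_side_root {X : Finset N.V} (hX : N.root ∉ X) : ¬ side X N.root := by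
  have : (X.filter fun a => Sub a N.root) = ∅ := by
    rw [Finset.filter_eq_empty_iff]
    intro a ha hs
    exact hX ((hs.antisymm (sub_root a)) ▸ ha)
  rw [side, this]
  simp

/-- The cut that separates along the tree edges above the nodes of `X`. -/
noncomputable def cutOf (X : Finset N.V) : Finset (Sym2 N.V) :=
  cutSet N.G (Finset.univ.filter fun x => side X x)

/-- The edges outside the tree in that cut. -/
noncomputable def oddEdges (X : Finset N.V) : Finset (Sym2 N.V) :=
  edgesOf fun x y => side X x ∧ ¬ side X y

/-- The tree edge above a node. -/
noncomputable def up (a : N.V) : Sym2 N.V := s(a, par a)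

theorem up_injOn : Set.InjOn (up (N := N)) {a | a ≠ N.root} := by
  intro a ha b hb h
  simp only [up, Sym2.eq_iff] at h
  rcases h with ⟨h, -⟩ | ⟨h1, h2⟩
  · exact h
  · have e1 := dep_par ha
    have e2 := dep_par hb
    rw [h2] at e1
    rw [← h1] at e2
    omega

theorem mem_cutSet {A : Finset N.V} {x y : N.V} :
    s(x, y) ∈ cutSet N.G A ↔ N.G.Adj x y ∧ ¬ (x ∈ A ↔ y ∈ A) := by
  simp only [cutSet, Finset.mem_filter, Finset.mem_univ, true_and, Sym2.eq_iff]
  constructor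
  · rintro ⟨a, b, hn, ha, hb, (⟨rfl, rfl⟩ | ⟨rfl, rfl⟩)⟩
    · exact ⟨hn, by tauto⟩
    · exact ⟨hn.symm, by tauto⟩
  · rintro ⟨hn, hp⟩
    by_cases hx : x ∈ A
    · exact ⟨x, y, hn, hx, by tauto, Or.inl ⟨rfl, rfl⟩⟩
    · exact ⟨y, x, hn.symm, by tauto, by tauto, Or.inr ⟨rfl, rfl⟩⟩

/-- The side changes along a tree edge exactly when the edge belongs to `X`; the crossing edges
outside the tree are those of `oddEdges` by definition. -/
theorem cutOf_eq {X : Finset N.V} (hX : N.root ∉ X) : cutOf X = X.image up ∪ oddEdges X := by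
  ext e
  induction e using Sym2.ind with
  | h x y =>
    simp only [cutOf, mem_cutSet, Finset.mem_union, Finset.mem_image, oddEdges, mem_edgesOf,
      Finset.mem_filter, Finset.mem_univ, true_and]
    have tree : ∀ a b : N.V, N.G.Adj a b → par a = b →
        (¬ (side X a ↔ side X b) ↔ ∃ c ∈ X, up c = s(a, b)) := by
      rintro a b hab rfl
      have ha : a ≠ N.root := by rintro rfl; rw [par_root] at hab; exact hab.ne rfl
      by_cases hm : a ∈ X
      · have := side_par_of_mem hX hm
        exact ⟨fun _ => ⟨a, hm, rfl⟩, fun _ => by tauto⟩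
      · have := side_par_of_notMem hm
        refine ⟨fun h => absurd this h, ?_⟩
        rintro ⟨c, hc, he⟩
        have := up_injOn (show c ∈ {a | a ≠ N.root} from fun h => hX (h ▸ hc)) ha he
        exact absurd (this ▸ hc) hm
    constructor
    · rintro ⟨hadj, hs⟩
      by_cases h1 : par x = y
      · exact Or.inl ((tree x y hadj h1).1 hs)
      by_cases h2 : par y = x
      · rw [Sym2.eq_swap]
        exact Or.inl ((tree y x hadj.symm h2).1 (by tauto))
      · exact Or.inr ⟨⟨hadj, h1, h2⟩, by tauto⟩
    · rintro (⟨c, hc, he⟩ | ⟨hn, h⟩)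
      · have hcr : c ≠ N.root := fun h => hX (h ▸ hc)
        have hs := (tree c (par c) (adj_par hcr) rfl).2 ⟨c, hc, rfl⟩
        simp only [up, Sym2.eq_iff] at he
        rcases he with ⟨rfl, rfl⟩ | ⟨rfl, rfl⟩
        · exact ⟨adj_par hcr, hs⟩
        · exact ⟨(adj_par hcr).symm, by tauto⟩
      · exact ⟨hn.1, by tauto⟩

theorem disjoint_up_edgesOf (X : Finset N.V) (p : N.V → N.V → Prop) :
    Disjoint (X.image up) (edgesOf p) := by
  rw [Finset.disjoint_left]
  intro e he he'
  rw [Finset.mem_image] at he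
  obtain ⟨c, -, rfl⟩ := he
  exact (mem_edgesOf.1 he').1.2.1 rfl

theorem card_cutOf {X : Finset N.V} (hX : N.root ∉ X) :
    (cutOf X).card = X.card + (oddEdges X).card := by
  rw [cutOf_eq hX, oddEdges,
    Finset.card_union_of_disjoint (disjoint_up_edgesOf _ _), Finset.card_image_of_injOn]
  exact up_injOn.mono fun a ha (h : a = N.root) => hX (h ▸ ha)

theorem isCutSet_iff {F : Finset (Sym2 N.V)} :
    IsCutSet N.G F ↔ ∃ X : Finset N.V, N.root ∉ X ∧ X.Nonempty ∧ F = cutOf X := by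
  constructor
  · rintro ⟨A, hA, hA', rfl⟩
    -- `X` collects the tree edges crossed by the given cut. Induction on the depth shows that `side
    -- X` tells whether a node is separated from the root.
    set X : Finset N.V := Finset.univ.filter fun v => v ≠ N.root ∧ ¬ (v ∈ A ↔ par v ∈ A) with hXdef
    have hX : N.root ∉ X := by simp [X]
    have hside : ∀ n, ∀ x : N.V, dep x = n → (side X x ↔ ¬ (x ∈ A ↔ N.root ∈ A)) := by
      intro n
      induction n with
      | zero =>
        intro x hx
        rw [dep_eq_zero.1 hx]
        simp [not_side_root hX]
      | succ n ih =>
        intro x hx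
        have hr : x ≠ N.root := ne_root_of_dep_pos (by omega)
        have ihp := ih (par x) (by rw [dep_par', hx]; omega)
        by_cases hm : x ∈ X
        · rw [side_par_of_mem hX hm, ihp]
          have : ¬ (x ∈ A ↔ par x ∈ A) := (Finset.mem_filter.1 hm).2.2
          tauto
        · rw [side_par_of_notMem hm, ihp]
          have : x ∈ A ↔ par x ∈ A := by
            by_contra h
            exact hm (Finset.mem_filter.2 ⟨Finset.mem_univ _, hr, h⟩)
          tauto
    refine ⟨X, hX, ?_, ?_⟩
    · rw [Finset.nonempty_iff_ne_empty]
      intro he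
      have h1 : ∀ x, x ∈ A ↔ N.root ∈ A := fun x => by
        have := hside _ x rfl
        rw [he] at this
        simp only [side, Finset.filter_empty, Finset.card_empty] at this
        simpa using this
      obtain ⟨a, ha⟩ := hA
      exact hA' (Finset.eq_univ_iff_forall.2 fun x => (h1 x).2 ((h1 a).1 ha))
    · ext e
      induction e using Sym2.ind with
      | h x y =>
        rw [cutOf, mem_cutSet, mem_cutSet]
        simp only [Finset.mem_filter, Finset.mem_univ, true_and, hside _ _ rfl]
        tauto
  · rintro ⟨X, hX, ⟨a, ha⟩, rfl⟩
    have h1 := side_par_of_mem hX ha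
    refine ⟨_, ?_, ?_, rfl⟩
    · by_cases hs : side X a
      · exact ⟨a, by simpa using hs⟩
      · exact ⟨par a, by simp only [Finset.mem_filter, Finset.mem_univ, true_and]; tauto⟩
    · intro he
      have := (Finset.eq_univ_iff_forall.1 he) N.root
      simp only [Finset.mem_filter, Finset.mem_univ, true_and] at this
      exact not_side_root hX this

/-! ### Odd coverage as a symmetric difference of covering sets -/

theorem oddEdges_empty : oddEdges (∅ : Finset N.V) = ∅ := by
  ext e
  induction e using Sym2.ind with
  | h x y => simp [oddEdges, mem_edgesOf, side]

/-- Inserting `a` flips the side of exactly the nodes below `a`, hence the status of exactly the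
edges with one end below `a`. -/
theorem oddEdges_insert {X : Finset N.V} {a : N.V} (ha : a ∉ X) :
    oddEdges (insert a X) = symmDiff (cov a) (oddEdges X) := by
  have hs : ∀ x, side (insert a X) x ↔ ¬ (Sub a x ↔ side X x) := by
    intro x
    rw [side, Finset.filter_insert]
    split_ifs with h
    · rw [Finset.card_insert_of_notMem (by simp [ha]), Nat.odd_add_one, side]
      tauto
    · rw [side]
      tauto
  ext e
  induction e using Sym2.ind with
  | h x y =>
    rw [Finset.mem_symmDiff, mem_cov, oddEdges, oddEdges, mem_edgesOf, mem_edgesOf, hs, hs]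
    tauto

theorem oddEdges_one (a : N.V) : oddEdges {a} = cov a := by
  have := oddEdges_insert (X := ∅) (a := a) (by simp)
  rw [oddEdges_empty, insert_empty_eq] at this
  exact this.trans (symmDiff_bot _)

theorem oddEdges_two {a b : N.V} (h : a ≠ b) : oddEdges {a, b} = symmDiff (cov a) (cov b) := by
  rw [oddEdges_insert (by simpa using h), oddEdges_one]

theorem oddEdges_three {a b c : N.V} (h : a ≠ b) (h' : a ≠ c) (h'' : b ≠ c) :
    oddEdges {a, b, c} = symmDiff (cov a) (symmDiff (cov b) (cov c)) := by
  rw [oddEdges_insert (by simp [h, h']), oddEdges_two h'']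

/-! ### Intersections of covering sets -/

/-- Neither node lies in the subtree of the other. -/
def Apart (a b : N.V) : Prop := ¬ Sub a b ∧ ¬ Sub b a

theorem Apart.symm {a b : N.V} (h : Apart a b) : Apart b a := ⟨h.2, h.1⟩

theorem Apart.not_sub {a b x : N.V} (h : Apart a b) (ha : Sub a x) : ¬ Sub b x := fun hb =>
  (ha.total hb).elim h.1 h.2

theorem Apart.ne {a b : N.V} (h : Apart a b) : a ≠ b := fun e => h.1 (e ▸ Sub.refl a)

theorem cov_inter_of_sub {u v : N.V} (h : Sub v u) :
    cov u ∩ cov v = edgesOf fun x y => Sub u x ∧ ¬ Sub v y := by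
  ext e
  induction e using Sym2.ind with
  | h x y =>
    rw [Finset.mem_inter, mem_cov, mem_cov, mem_edgesOf]
    have h1 : Sub u x → Sub v x := h.trans
    have h2 : Sub u y → Sub v y := h.trans
    tauto

/-- An edge leaving two disjoint subtrees must join them. -/
theorem cov_inter_of_apart {u v : N.V} (h : Apart u v) :
    cov u ∩ cov v = edgesOf fun x y => Sub u x ∧ Sub v y := by
  ext e
  induction e using Sym2.ind with
  | h x y =>
    rw [Finset.mem_inter, mem_cov, mem_cov, mem_edgesOf]
    have h1 : Sub u x → ¬ Sub v x := h.not_sub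
    have h2 : Sub u y → ¬ Sub v y := h.not_sub
    tauto

theorem cov_inter_three_of_chain {u v w : N.V} (h : Sub v u) (h' : Sub w v) :
    cov u ∩ cov v ∩ cov w = cov u ∩ cov w := by
  ext e
  induction e using Sym2.ind with
  | h x y =>
    simp only [Finset.mem_inter, mem_cov]
    have h1 : Sub u x → Sub v x := h.trans
    have h2 : Sub u y → Sub v y := h.trans
    have h3 : Sub v x → Sub w x := h'.trans
    have h4 : Sub v y → Sub w y := h'.trans
    grind

theorem cov_inter_three_of_apart {u v w : N.V} (h : Apart u v) (h1 : Apart u w) (h2 : Apart v w) :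
    cov u ∩ cov v ∩ cov w = ∅ := by
  ext e
  induction e using Sym2.ind with
  | h x y =>
    simp only [Finset.mem_inter, mem_cov, Finset.notMem_empty, iff_false]
    have a1 : Sub u x → ¬ Sub v x := h.not_sub
    have a2 : Sub u y → ¬ Sub v y := h.not_sub
    have a3 : Sub u x → ¬ Sub w x := h1.not_sub
    have a4 : Sub u y → ¬ Sub w y := h1.not_sub
    have a5 : Sub v x → ¬ Sub w x := h2.not_sub
    have a6 : Sub v y → ¬ Sub w y := h2.not_sub
    grind

/-- An edge covering both `u` and `v` joins their subtrees and so stays inside that of `w`. -/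
theorem cov_inter_three_of_fork {u v w : N.V} (h : Apart u v) (h1 : Sub w u) (h2 : Sub w v) :
    cov u ∩ cov v ∩ cov w = ∅ := by
  ext e
  induction e using Sym2.ind with
  | h x y =>
    simp only [Finset.mem_inter, mem_cov, Finset.notMem_empty, iff_false]
    have a1 : Sub u x → ¬ Sub v x := h.not_sub
    have a2 : Sub u y → ¬ Sub v y := h.not_sub
    have a3 : Sub u x → Sub w x := h1.trans
    have a4 : Sub u y → Sub w y := h1.trans
    have a5 : Sub v x → Sub w x := h2.trans
    have a6 : Sub v y → Sub w y := h2.trans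
    grind

/-- An edge between the subtrees of `u` and `w` leaves the larger subtree of `v` as well, which is
disjoint from that of `w`. -/
theorem cov_inter_three_of_side {u v w : N.V} (h : Sub v u) (h1 : Apart v w) :
    cov u ∩ cov v ∩ cov w = cov u ∩ cov w := by
  ext e
  induction e using Sym2.ind with
  | h x y =>
    simp only [Finset.mem_inter, mem_cov]
    have a1 : Sub u x → Sub v x := h.trans
    have a2 : Sub u y → Sub v y := h.trans
    have a3 : Sub v x → ¬ Sub w x := h1.not_sub
    have a4 : Sub v y → ¬ Sub w y := h1.not_sub
    grind

end Net

/-! ### Symmetric differences of finite sets -/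

section FinsetCount

variable {ι : Type*} [DecidableEq ι] {A B C : Finset ι}

theorem sum_symmDiff_add (A B : Finset ι) (f : ι → ℕ) :
    ∑ i ∈ symmDiff A B, f i + 2 * ∑ i ∈ A ∩ B, f i = ∑ i ∈ A, f i + ∑ i ∈ B, f i := by
  have h1 : ∑ i ∈ A, f i = ∑ i ∈ A \ B, f i + ∑ i ∈ A ∩ B, f i := by
    rw [← Finset.sum_union (Finset.disjoint_sdiff_inter _ _), Finset.sdiff_union_inter]
  have h2 : ∑ i ∈ B, f i = ∑ i ∈ B \ A, f i + ∑ i ∈ A ∩ B, f i := by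
    rw [Finset.inter_comm, ← Finset.sum_union (Finset.disjoint_sdiff_inter _ _),
      Finset.sdiff_union_inter]
  have h3 : ∑ i ∈ symmDiff A B, f i = ∑ i ∈ A \ B, f i + ∑ i ∈ B \ A, f i := by
    rw [symmDiff_def, Finset.sup_eq_union, Finset.sum_union disjoint_sdiff_sdiff]
  omega

theorem card_symmDiff_add (A B : Finset ι) :
    (symmDiff A B).card + 2 * (A ∩ B).card = A.card + B.card := by
  simpa using sum_symmDiff_add A B fun _ => 1

/-- Three sets have empty symmetric difference if and only if no element is in all three and each
set is the union of its intersections with the other two. -/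
theorem symmDiff_three_eq_empty_iff : symmDiff A (symmDiff B C) = ∅ ↔
    A ∩ B ∩ C = ∅ ∧ A.card = (A ∩ B).card + (A ∩ C).card ∧
      B.card = (A ∩ B).card + (B ∩ C).card ∧ C.card = (A ∩ C).card + (B ∩ C).card := by
  -- If no element is in all three sets, `A ∩ B` and `A ∩ C` are disjoint, so the inclusion of `A`
  -- in the union becomes an equality of cardinalities.
  have aux : ∀ A B C : Finset ι, A ∩ B ∩ C = ∅ → ((A ⊆ B ∪ C) ↔
      A.card = (A ∩ B).card + (A ∩ C).card) := by
    intro A B C h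
    have hd : Disjoint (A ∩ B) (A ∩ C) := by
      rw [Finset.disjoint_iff_inter_eq_empty, ← h]
      ext; simp; tauto
    rw [← Finset.card_union_of_disjoint hd, ← Finset.inter_union_distrib_left]
    constructor
    · intro hs
      rw [Finset.inter_eq_left.2 hs]
    · intro hc
      exact Finset.inter_eq_left.1 (Finset.eq_of_subset_of_card_le Finset.inter_subset_left hc.le)
  have h1 : symmDiff A (symmDiff B C) = ∅ ↔
      A ∩ B ∩ C = ∅ ∧ A ⊆ B ∪ C ∧ B ⊆ A ∪ C ∧ C ⊆ A ∪ B := by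
    simp only [Finset.ext_iff, Finset.subset_iff, Finset.mem_symmDiff, Finset.mem_inter,
      Finset.mem_union, Finset.notMem_empty, iff_false]
    constructor
    · intro h
      refine ⟨fun a => ?_, fun a => ?_, fun a => ?_, fun a => ?_⟩ <;> have := h a <;> tauto
    · rintro ⟨h1, h2, h3, h4⟩ a
      have := h1 a
      have := @h2 a
      have := @h3 a
      have := @h4 a
      tauto
  rw [h1]
  refine and_congr_right fun h => ?_
  rw [aux A B C h, aux B A C (by rw [← h]; ext; simp; tauto),
    aux C A B (by rw [← h]; ext; simp; tauto), Finset.inter_comm B A, Finset.inter_comm C A,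
    Finset.inter_comm C B]

end FinsetCount

/-! ### Maxima as sums -/

/-- A linear order with the maximum as addition. -/
@[ext] structure Mx (α : Type) where
  val : α

namespace Mx

variable {α : Type} [LinearOrder α]

instance : Add (Mx α) := ⟨fun a b => ⟨max a.val b.val⟩⟩

theorem val_add (a b : Mx α) : (a + b).val = max a.val b.val := rfl

variable [OrderBot α]

instance : Zero (Mx α) := ⟨⟨⊥⟩⟩

instance : AddCommMonoid (Mx α) where
  add_assoc a b c := Mx.ext (max_assoc _ _ _)
  zero_add a := Mx.ext (bot_sup_eq a.val)
  add_zero a := Mx.ext (sup_bot_eq a.val)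
  add_comm a b := Mx.ext (max_comm _ _)
  nsmul := nsmulRec

variable {ι : Type*} {s : Finset ι} {f : ι → Mx α}

theorem le_sum {i : ι} (hi : i ∈ s) : (f i).val ≤ (∑ i ∈ s, f i).val := by
  rw [← Finset.add_sum_erase s f hi, val_add]
  exact le_max_left _ _

theorem sum_mem (s : Finset ι) (f : ι → Mx α) :
    ∑ i ∈ s, f i = 0 ∨ ∃ i ∈ s, ∑ i ∈ s, f i = f i := by
  induction s using Finset.induction_on with
  | empty => exact Or.inl rfl
  | insert a s ha ih =>
    right
    rw [Finset.sum_insert ha]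
    rcases le_total (f a).val (∑ i ∈ s, f i).val with h | h
    · rcases ih with h0 | ⟨i, hi, he⟩
      · exact ⟨a, by simp, by rw [h0, add_zero]⟩
      · refine ⟨i, by simp [hi], ?_⟩
        rw [← he]
        exact Mx.ext (max_eq_right h)
    · exact ⟨a, by simp, Mx.ext (max_eq_left h)⟩

end Mx

/-! ### Encodings -/

/-- A link, given by the root paths of its ends and chosen by the size of a key. -/
abbrev Pick := WithBot (ℕ ×ₗ (List ℕ ×ₗ List ℕ))

namespace Pick

/-- The link with the given key and root paths. -/
def mk (k : ℕ) (l l' : List ℕ) : Pick := ((toLex (k, toLex (l, l')) : ℕ ×ₗ (List ℕ ×ₗ List ℕ)) : Pick)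

/-- The key, increased by one, and the two paths. -/
def parts : Pick → ℕ × List ℕ × List ℕ
  | none => (0, [], [])
  | some p => ((ofLex p).1 + 1, (ofLex (ofLex p).2).1, (ofLex (ofLex p).2).2)

/-- The first path. -/
def fst (p : Pick) : List ℕ := p.parts.2.1

/-- The second path. -/
def snd (p : Pick) : List ℕ := p.parts.2.2

@[simp] theorem fst_mk (k : ℕ) (l l' : List ℕ) : (mk k l l').fst = l := rfl
@[simp] theorem snd_mk (k : ℕ) (l l' : List ℕ) : (mk k l l').snd = l' := rfl

theorem parts_injective : Function.Injective parts := by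
  rintro (_ | p) (_ | q) h
  · rfl
  · simp [parts] at h
  · simp [parts] at h
  · have h1 := congrArg Prod.fst h
    have h2 := congrArg (fun x => x.2.1) h
    have h3 := congrArg (fun x => x.2.2) h
    simp only [parts, Nat.add_right_cancel_iff] at h1 h2 h3
    exact congrArg some (Prod.ext h1 (Prod.ext h2 h3))

theorem key_le_of_mk_le {k k' : ℕ} {l l' m m' : List ℕ} (h : mk k l l' ≤ mk k' m m') : k ≤ k' := by
  rw [mk, mk, WithBot.coe_le_coe, Prod.Lex.toLex_le_toLex] at h
  rcases h with h | h
  · exact h.le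
  · exact h.1.le

end Pick

namespace Wd

/-- Transmission through an injective map. -/
abbrev ofInjective {A R : Type} [Wd R] (f : A → R) (hf : Function.Injective f) : Wd A :=
  ⟨fun a => wd (f a), inj.comp hf⟩

instance : Wd (ℕ → ℕ) := ⟨id, Function.injective_id⟩

instance : Wd ℕ := ofInjective (fun n s => if s = 0 then n else 0) fun a b h => by
  simpa using congrFun h 0

instance : Wd (List ℕ) := ofInjective (fun l s => (l[s]?).elim 0 (· + 1)) fun a b h => by
  refine List.ext_getElem? fun s => ?_
  have := congrFun h s
  cases h1 : a[s]? <;> cases h2 : b[s]? <;> rw [h1, h2] at this <;>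
    first | rfl | exact congrArg some (Nat.succ_injective this) | exact absurd this (by simp)

instance {R R' : Type} [Wd R] [Wd R'] : Wd (R × R') where
  wd a s := if s % 2 = 0 then wd a.1 (s / 2) else wd a.2 (s / 2)
  inj a b h := by
    refine Prod.ext (inj ?_) (inj ?_) <;> funext s
    · have := congrFun h (2 * s)
      simp only at this
      rwa [if_pos (by omega), if_pos (by omega), show 2 * s / 2 = s by omega] at this
    · have := congrFun h (2 * s + 1)
      simp only at this
      rwa [if_neg (by omega), if_neg (by omega), show (2 * s + 1) / 2 = s by omega] at this

instance {m : ℕ} [NeZero m] {R : Type} [Wd R] : Wd (Fin m → R) where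
  wd a s := wd (a (Fin.ofNat m s)) (s / m)
  inj a b h := by
    refine funext fun i => inj (funext fun s => ?_)
    have := congrFun h (m * s + i)
    have e1 : Fin.ofNat m (m * s + i) = i := by
      apply Fin.ext
      simp [Fin.ofNat, Nat.mod_eq_of_lt i.2]
    have e2 : (m * s + i) / m = s := by
      rw [Nat.mul_add_div (NeZero.pos m), Nat.div_eq_of_lt i.2, Nat.add_zero]
    simp only [e1, e2] at this
    exact this

instance {R : Type} [Wd R] : Wd (Mx R) := ofInjective Mx.val fun _ _ => Mx.ext

instance : Wd (ℕ → Mx ℕ) := ofInjective (fun f s => (f s).val) fun _ _ h =>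
  funext fun s => Mx.ext (congrFun h s)

instance : Wd Pick := ofInjective Pick.parts Pick.parts_injective

end Wd

section Fits

variable {B l l' : ℕ}

theorem Fits.mono {R : Type} [Wd R] {r : R} (h : Fits B l r) (hl : l ≤ l') : Fits B l' r :=
  fun s => ⟨(h s).1, fun hs => (h s).2 (hl.trans hs)⟩

theorem Fits.mono_bound {R : Type} [Wd R] {r : R} {B' : ℕ} (h : Fits B l r) (hB : B ≤ B') :
    Fits B' l r := fun s => ⟨(h s).1.trans hB, (h s).2⟩

theorem fits_fun {f : ℕ → ℕ} (h : ∀ s, f s ≤ B) (h0 : ∀ s, l ≤ s → f s = 0) : Fits B l f :=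
  fun s => ⟨h s, h0 s⟩

theorem fits_funMx {f : ℕ → Mx ℕ} (h : ∀ s, (f s).val ≤ B) (h0 : ∀ s, l ≤ s → (f s).val = 0) :
    Fits B l f := fun s => ⟨h s, h0 s⟩

theorem fits_nat {n : ℕ} (h : n ≤ B) (hl : 0 < l) : Fits B l n := by
  intro s
  change (if s = 0 then n else 0) ≤ B ∧ (l ≤ s → (if s = 0 then n else 0) = 0)
  split_ifs with hs
  · exact ⟨h, fun h' => by omega⟩
  · exact ⟨Nat.zero_le _, fun _ => rfl⟩

theorem fits_list {a : List ℕ} (h : ∀ i ∈ a, i + 1 ≤ B) (hl : a.length ≤ l) : Fits B l a := by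
  intro s
  change (a[s]?).elim 0 (· + 1) ≤ B ∧ (l ≤ s → (a[s]?).elim 0 (· + 1) = 0)
  constructor
  · cases h1 : a[s]? with
    | none => exact Nat.zero_le _
    | some i => exact h i (List.mem_of_getElem? h1)
  · intro hs
    rw [List.getElem?_eq_none (by omega)]
    rfl

theorem Fits.prod {R R' : Type} [Wd R] [Wd R'] {a : R × R'} (h : Fits B l a.1) (h' : Fits B l a.2) :
    Fits B (2 * l) a := by
  intro s
  change (if s % 2 = 0 then Wd.wd a.1 (s / 2) else Wd.wd a.2 (s / 2)) ≤ B ∧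
    (2 * l ≤ s → (if s % 2 = 0 then Wd.wd a.1 (s / 2) else Wd.wd a.2 (s / 2)) = 0)
  split_ifs
  · exact ⟨(h _).1, fun hs => (h _).2 (by omega)⟩
  · exact ⟨(h' _).1, fun hs => (h' _).2 (by omega)⟩

theorem Fits.pi {m : ℕ} [NeZero m] {R : Type} [Wd R] {a : Fin m → R} (h : ∀ i, Fits B l (a i)) :
    Fits B (m * l) a := fun s => ⟨(h _ _).1, fun hs => (h _ _).2 ((Nat.le_div_iff_mul_le
      (NeZero.pos m)).2 (by rw [Nat.mul_comm]; exact hs))⟩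

theorem fits_pick {k : ℕ} {a b : List ℕ} (hl : 0 < l) (hk : k + 1 ≤ B) (ha : Fits B l a)
    (hb : Fits B l b) : Fits B (4 * l) (⟨Pick.mk k a b⟩ : Mx Pick) := by
  have : Fits B (2 * (2 * l)) (k + 1, a, b) :=
    Fits.prod ((fits_nat hk hl).mono (by omega)) (Fits.prod ha hb)
  exact fun s => ⟨(this s).1, fun hs => (this s).2 (by omega)⟩

theorem fits_zero_pick : Fits B l (0 : Mx Pick) := by
  have : Fits B 0 ((0, [], []) : ℕ × List ℕ × List ℕ) := by
    have h1 : Fits B 0 (0 : ℕ) := fun s => by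
      have : Wd.wd (0 : ℕ) s = 0 := by
        change (if s = 0 then 0 else 0) = 0
        simp
      simp [this]
    have h2 : Fits B 0 ([] : List ℕ) := fits_list (by simp) (by simp)
    exact (Fits.prod h1 ((Fits.prod h2 h2).mono (by omega))).mono (by omega)
  exact fun s => ⟨(this s).1, fun hs => (this s).2 (by omega)⟩

end Fits

/-! ### Sums over links -/

namespace Net

variable {N : Net.{u}}

/-- The links, in direction from `x` to `y`, with `x` in the subtree of `v`. -/
noncomputable def links (v : N.V) : Finset (N.V × N.V) :=
  Finset.univ.filter fun z => Sub v z.1 ∧ N.G.Adj z.1 z.2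

theorem mem_links {v : N.V} {z : N.V × N.V} : z ∈ links v ↔ Sub v z.1 ∧ N.G.Adj z.1 z.2 := by
  simp [links]

theorem card_links_le (v : N.V) : (links v).card ≤ N.size ^ 2 := by
  calc (links v).card ≤ (Finset.univ : Finset (N.V × N.V)).card := Finset.card_le_card (by simp)
    _ = Fintype.card N.V ^ 2 := by rw [Finset.card_univ, Fintype.card_prod, sq]
    _ ≤ N.size ^ 2 := Nat.pow_le_pow_left card_le_size _

theorem total_eq {A M : Type} [AddCommMonoid M] (R : Lab.{u} A) (F : ℕ → (ℕ → A) → (ℕ → A) → M)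
    (j : ℕ) (v : N.V) :
    total R F j N v = ∑ z ∈ links v, F j (info R N z.1) (info R N z.2) := by
  refine (Finset.sum_finset_product' (links v) (subtree v) N.nbr (fun z => ?_)
    (f := fun x y => F j (info R N x) (info R N y))).symm
  rw [mem_links, mem_subtree, mem_nbr]

theorem sum_links_le {v : N.V} {f : N.V × N.V → ℕ} {b : ℕ} (h : ∀ z ∈ links v, f z ≤ b) :
    ∑ z ∈ links v, f z ≤ N.size ^ 2 * b :=
  (Finset.sum_le_card_nsmul _ _ _ h).trans (by
    rw [smul_eq_mul]
    exact Nat.mul_le_mul_right _ (card_links_le v))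

/-- The condition `hq` prevents both directions of an edge from contributing, so sums over links
count each edge once. -/
theorem sum_links_edgesOf {v : N.V} (q : N.V → N.V → Prop)
    (hq : ∀ x y, Sub v x → q x y → ¬ (Sub v y ∧ q y x)) (W : Sym2 N.V → ℕ) :
    ∑ z ∈ links v, (if NonTree z.1 z.2 ∧ q z.1 z.2 then W s(z.1, z.2) else 0)
      = ∑ e ∈ edgesOf (fun x y => Sub v x ∧ q x y), W e := by
  rw [← Finset.sum_filter]
  have himg : edgesOf (fun x y => Sub v x ∧ q x y)
      = ((links v).filter fun z => NonTree z.1 z.2 ∧ q z.1 z.2).image fun z => s(z.1, z.2) := by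
    ext e
    simp only [edgesOf, Finset.mem_filter, Finset.mem_univ, true_and, Finset.mem_image, mem_links]
    constructor
    · rintro ⟨x, y, hn, ⟨hs, hqq⟩, rfl⟩
      exact ⟨(x, y), ⟨⟨hs, hn.1⟩, hn, hqq⟩, rfl⟩
    · rintro ⟨⟨x, y⟩, ⟨⟨hs, -⟩, hn, hqq⟩, rfl⟩
      exact ⟨x, y, hn, ⟨hs, hqq⟩, rfl⟩
  rw [himg, Finset.sum_image]
  rintro ⟨x, y⟩ hz ⟨x', y'⟩ hz' he
  simp only [Finset.coe_filter, Set.mem_ofPred_eq, mem_links] at hz hz'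
  simp only [Sym2.eq_iff] at he
  rcases he with ⟨rfl, rfl⟩ | ⟨rfl, rfl⟩
  · rfl
  · exact absurd ⟨hz'.1.1, hz'.2.2⟩ (hq _ _ hz.1.1 hz.2.2)

/-- A maximum over links is attained. -/
theorem sum_links_pick {v : N.V} (q : N.V → N.V → Prop) (key : N.V → N.V → ℕ)
    (h : ∃ x y, Sub v x ∧ NonTree x y ∧ q x y) :
    ∃ x y, (Sub v x ∧ NonTree x y ∧ q x y) ∧
      (∑ z ∈ links v, (if NonTree z.1 z.2 ∧ q z.1 z.2 then
        (⟨Pick.mk (key z.1 z.2) (path z.1) (path z.2)⟩ : Mx Pick) else 0)).val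
          = Pick.mk (key x y) (path x) (path y) ∧
      ∀ x' y', Sub v x' → NonTree x' y' → q x' y' → key x' y' ≤ key x y := by
  set f : N.V × N.V → Mx Pick := fun z => if NonTree z.1 z.2 ∧ q z.1 z.2 then
    ⟨Pick.mk (key z.1 z.2) (path z.1) (path z.2)⟩ else 0 with hf
  have hle : ∀ x y, Sub v x → NonTree x y → q x y →
      Pick.mk (key x y) (path x) (path y) ≤ (∑ z ∈ links v, f z).val := by
    intro x y hs hn hqq
    have := Mx.le_sum (f := f) (s := links v) (i := (x, y)) (mem_links.2 ⟨hs, hn.1⟩)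
    simpa [hf, hn, hqq] using this
  have hpos : ∀ k l l', ¬ Pick.mk k l l' ≤ (0 : Mx Pick).val := by
    intro k l l' h'
    exact absurd (le_bot_iff.1 h') (WithBot.coe_ne_bot)
  rcases Mx.sum_mem (links v) f with h0 | ⟨⟨x, y⟩, hz, he⟩
  · obtain ⟨x, y, hs, hn, hqq⟩ := h
    have := hle x y hs hn hqq
    rw [h0] at this
    exact absurd this (hpos _ _ _)
  · by_cases hc : NonTree x y ∧ q x y
    · have hfz : f (x, y) = ⟨Pick.mk (key x y) (path x) (path y)⟩ := if_pos hc
      refine ⟨x, y, ⟨(mem_links.1 hz).1, hc⟩, by rw [he, hfz], fun x' y' hs hn hqq => ?_⟩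
      have := hle x' y' hs hn hqq
      rw [he, hfz] at this
      exact Pick.key_le_of_mk_le this
    · have hfz : f (x, y) = 0 := if_neg hc
      obtain ⟨x, y, hs, hn, hqq⟩ := h
      have := hle x y hs hn hqq
      rw [he, hfz] at this
      exact absurd this (hpos _ _ _)

theorem size_succ_le : N.size + 1 ≤ N.size ^ 2 := by
  have := N.two_le_size
  nlinarith

theorem fits_path (x : N.V) : Fits (N.size ^ 2) (N.height + 2) (path x) := by
  refine fits_list (fun i hi => ?_) (by rw [length_path]; have := dep_le_height x; omega)
  simp only [path, List.mem_map] at hi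
  obtain ⟨j, -, rfl⟩ := hi
  exact (Nat.succ_le_succ (ident_le_size _)).trans size_succ_le

theorem fits_sum_pick {v : N.V} {f : N.V × N.V → Mx Pick}
    (h : ∀ z ∈ links v, f z = 0 ∨
      ∃ k ≤ N.size, f z = ⟨Pick.mk k (path z.1) (path z.2)⟩) :
    Fits (N.size ^ 2) (4 * (N.height + 2)) (∑ z ∈ links v, f z) := by
  rcases Mx.sum_mem (links v) f with h0 | ⟨z, hz, he⟩
  · rw [h0]; exact fits_zero_pick
  · rw [he]
    rcases h z hz with h0 | ⟨k, hk, h1⟩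
    · rw [h0]; exact fits_zero_pick
    · rw [h1]
      exact fits_pick (by omega) ((Nat.succ_le_succ hk).trans size_succ_le) (fits_path _)
        (fits_path _)

end Net

/-! ### First records: identifiers and depths -/

/-- The root path in terms of the records of the ancestors. -/
def pathOf (I : ℕ → ℕ × ℕ × ℕ) : List ℕ :=
  (List.range ((I 0).2.2 + 1)).map fun j => (I ((I 0).2.2 - j)).1

/-- The identifier, the identifier of the parent, and the depth. -/
noncomputable def place : Lab.{u} (ℕ × ℕ × ℕ) := fun N v => (N.ident v, N.ident (par v), dep v)

theorem pathOf_info {N : Net.{u}} (x : N.V) : pathOf (info place N x) = path x := rfl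

theorem Net.dep_lt_size {N : Net.{u}} (v : N.V) : dep v < N.size :=
  (dep_lt_card v).trans_le card_le_size

theorem solvable_place : Solvable
    (fun N : Net.{u} => 3 * N.height + 1 + (N.height + 1) * (4 * (N.height + 2)))
    (knows place.{u}) := by
  have h := solvable_base.{u}.broadcast (X := place) (K := 1) (c := 4) (fun _ _ _ _ e => e)
    (fun N v N' v' e => by
      simp only [base, Prod.mk.injEq] at e
      simp only [place, e]) (by norm_num) (fun N v => by
      rw [pow_one, show 4 * (N.height + 2) = 2 * (2 * (N.height + 2)) by ring]
      exact Fits.prod (fits_nat (ident_le_size v) (by omega))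
        (Fits.prod (fits_nat (ident_le_size _) (Nat.succ_pos _))
          (fits_nat (dep_lt_size v).le (Nat.succ_pos _))))
  exact h.det fun N v N' v' e => e

/-! ### Labels of edges -/

/-- A number that names the edge with the given end identifiers. -/
def label (a b : ℕ) : ℕ := Nat.pair (min a b) (max a b)

/-- The edge with the given label. -/
def unlabel (m : ℕ) : Sym2 ℕ := s(m.unpair.1, m.unpair.2)

theorem unlabel_label (a b : ℕ) : unlabel (label a b) = s(a, b) := by
  rw [unlabel, label, Nat.unpair_pair]
  rcases le_total a b with h | h
  · rw [min_eq_left h, max_eq_right h]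
  · rw [min_eq_right h, max_eq_left h, Sym2.eq_swap]

theorem label_comm (a b : ℕ) : label a b = label b a := by rw [label, label, min_comm, max_comm]

theorem ite_iff {α : Type*} {p q : Prop} {hp : Decidable p} {hq : Decidable q} (h : p ↔ q)
    (a b : α) : @ite α p hp a b = @ite α q hq a b := by
  by_cases hc : p
  · rw [if_pos hc, if_pos (h.1 hc)]
  · rw [if_neg hc, if_neg fun h' => hc (h.2 h')]

namespace Net

variable {N : Net.{u}}

/-- The label of an edge. -/
def weight : Sym2 N.V → ℕ :=
  Sym2.lift ⟨fun x y => label (N.ident x) (N.ident y), fun _ _ => label_comm _ _⟩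

theorem weight_mk (x y : N.V) : weight s(x, y) = label (N.ident x) (N.ident y) := rfl

theorem unlabel_weight (e : Sym2 N.V) : unlabel (weight e) = e.map N.ident := by
  induction e using Sym2.ind with
  | h x y => rw [weight_mk, unlabel_label, Sym2.map_mk]

theorem label_le (x y : N.V) : label (N.ident x) (N.ident y) ≤ N.size ^ 4 := by
  have h : max (min (N.ident x) (N.ident y)) (max (N.ident x) (N.ident y)) ≤ N.size := by
    have := ident_le_size x
    have := ident_le_size y
    omega
  calc label (N.ident x) (N.ident y)
      ≤ (max (min (N.ident x) (N.ident y)) (max (N.ident x) (N.ident y)) + 1) ^ 2 :=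
        (Nat.pair_lt_max_add_one_sq _ _).le
    _ ≤ (N.size ^ 2) ^ 2 := Nat.pow_le_pow_left ((Nat.succ_le_succ h).trans size_succ_le) _
    _ = N.size ^ 4 := by rw [← pow_mul]

end Net

/-! ### Second records: sizes of intersections of covering sets, and the first selected link -/

/-- The link between the nodes with the given records is not in the tree. -/
def nonTreeI (a b : ℕ × ℕ × ℕ) : Prop := a.2.1 ≠ b.1 ∧ b.2.1 ≠ a.1

theorem nonTreeI_iff {N : Net.{u}} {x y : N.V} (h : N.G.Adj x y) :
    nonTreeI (place N x) (place N y) ↔ NonTree x y := by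
  simp only [nonTreeI, place, NonTree, h, true_and, ne_eq, N.ident.injective.eq_iff]

/-- The contribution of a link to the counts and labels of the links that leave the subtree of the
ancestor at level `j`, and to the selection of such a link. -/
noncomputable def countF (j : ℕ) (I J : ℕ → ℕ × ℕ × ℕ) : ℕ × ℕ × Mx Pick :=
  if nonTreeI (I 0) (J 0) ∧ (pathOf J)[j]? ≠ (pathOf I)[j]? then
    (1, label (I 0).1 (J 0).1,
      ⟨Pick.mk (agree (pathOf I) (pathOf J)) (pathOf I) (pathOf J)⟩) else 0

/-- The new part of the second record. -/
noncomputable def countP (a : ℕ × ℕ × ℕ) (U : ℕ → ℕ × ℕ × Mx Pick) :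
    (ℕ → ℕ) × (ℕ → ℕ) × Mx Pick :=
  (fun j => (U j).1, fun j => (U j).2.1, (U a.2.2).2.2)

/-- The second record. -/
noncomputable def counts : Lab.{u} ((ℕ × ℕ × ℕ) × (ℕ → ℕ) × (ℕ → ℕ) × Mx Pick) := fun N v =>
  (place N v, countP (place N v) (totals place countF N v))

namespace Net

variable {N : Net.{u}}

theorem countF_info {x y : N.V} (j : ℕ) (h : N.G.Adj x y) :
    countF j (info place N x) (info place N y)
      = if NonTree x y ∧ (path y)[j]? ≠ (path x)[j]? then
        (1, weight s(x, y), ⟨Pick.mk (agree (path x) (path y)) (path x) (path y)⟩) else 0 := by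
  rw [countF, pathOf_info, pathOf_info]
  have : nonTreeI (info place N x 0) (info place N y 0) ↔ NonTree x y := nonTreeI_iff h
  simp only [this]
  rfl

theorem total_countF (j : ℕ) (v : N.V) : total place countF j N v =
    (∑ z ∈ links v, (if NonTree z.1 z.2 ∧ (path z.2)[j]? ≠ (path z.1)[j]? then 1 else 0),
     ∑ z ∈ links v, (if NonTree z.1 z.2 ∧ (path z.2)[j]? ≠ (path z.1)[j]? then
       weight s(z.1, z.2) else 0),
     ∑ z ∈ links v, (if NonTree z.1 z.2 ∧ (path z.2)[j]? ≠ (path z.1)[j]? then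
       ⟨Pick.mk (agree (path z.1) (path z.2)) (path z.1) (path z.2)⟩ else 0)) := by
  rw [total_eq, Finset.sum_congr rfl fun z hz => countF_info j (mem_links.1 hz).2]
  refine Prod.ext ?_ (Prod.ext ?_ ?_)
  · rw [Prod.fst_sum]
    exact Finset.sum_congr rfl fun z _ => by split_ifs <;> rfl
  · rw [Prod.snd_sum, Prod.fst_sum]
    exact Finset.sum_congr rfl fun z _ => by split_ifs <;> rfl
  · rw [Prod.snd_sum, Prod.snd_sum]
    exact Finset.sum_congr rfl fun z _ => by split_ifs <;> rfl

theorem leaves_iff {v x y : N.V} {j : ℕ} (hj : j ≤ dep v) (hx : Sub v x) :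
    (path y)[j]? ≠ (path x)[j]? ↔ ¬ Sub (ancAt j v) y := by
  have h1 : Sub (ancAt j v) x := (sub_ancAt j v).trans hx
  rw [sub_iff_path_eq h1, dep_ancAt hj]

theorem sum_links_leaving (W : Sym2 N.V → ℕ) {v : N.V} {j : ℕ} (hj : j ≤ dep v) :
    ∑ z ∈ links v, (if NonTree z.1 z.2 ∧ (path z.2)[j]? ≠ (path z.1)[j]? then
      W s(z.1, z.2) else 0) = ∑ e ∈ cov v ∩ cov (ancAt j v), W e := by
  rw [cov_inter_of_sub (sub_ancAt j v), ← sum_links_edgesOf]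
  · exact Finset.sum_congr rfl fun z hz =>
      ite_iff (and_congr_right fun _ => leaves_iff hj (mem_links.1 hz).1) _ _
  · rintro x y hx hy ⟨h, -⟩
    exact hy ((sub_ancAt j v).trans h)

/-- The number of edges that cover `v` and its ancestor at level `j`. -/
theorem counts_card {v : N.V} {j : ℕ} (hj : j ≤ dep v) :
    (counts N v).2.1 j = (cov v ∩ cov (ancAt j v)).card := by
  simp only [counts, countP, totals, if_pos hj, total_countF]
  rw [sum_links_leaving (fun _ => 1) hj]
  simp

/-- The sum of their labels. -/
theorem counts_weight {v : N.V} {j : ℕ} (hj : j ≤ dep v) :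
    (counts N v).2.2.1 j = ∑ e ∈ cov v ∩ cov (ancAt j v), weight e := by
  simp only [counts, countP, totals, if_pos hj, total_countF]
  exact sum_links_leaving weight hj

theorem counts_card_self (v : N.V) : (counts N v).2.1 (dep v) = (cov v).card := by
  rw [counts_card le_rfl, ancAt_dep, Finset.inter_self]

theorem counts_weight_self (v : N.V) : (counts N v).2.2.1 (dep v) = ∑ e ∈ cov v, weight e := by
  rw [counts_weight le_rfl, ancAt_dep, Finset.inter_self]

theorem counts_card_le (v : N.V) (j : ℕ) : (counts N v).2.1 j ≤ N.size ^ 2 := by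
  simp only [counts, countP, totals]
  split_ifs
  · rw [total_countF]
    refine (sum_links_le (b := 1) fun z _ => ?_).trans (by simp)
    split_ifs <;> omega
  · exact Nat.zero_le _

theorem counts_weight_le (v : N.V) (j : ℕ) : (counts N v).2.2.1 j ≤ N.size ^ 6 := by
  simp only [counts, countP, totals]
  split_ifs
  · rw [total_countF]
    refine (sum_links_le (b := N.size ^ 4) fun z _ => ?_).trans (by rw [← pow_add])
    split_ifs
    · exact label_le _ _
    · exact Nat.zero_le _
  · exact Nat.zero_le _

theorem exists_leaving {v : N.V} (h : (cov v).Nonempty) :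
    ∃ x y, Sub v x ∧ NonTree x y ∧ ¬ Sub v y := by
  obtain ⟨e, he⟩ := h
  simp only [cov, edgesOf, Finset.mem_filter, Finset.mem_univ, true_and] at he
  obtain ⟨x, y, hn, ⟨h1, h2⟩, -⟩ := he
  exact ⟨x, y, h1, hn, h2⟩

/-- The link from `x` to `y` leaves the subtree of `v`. -/
def Leaves (v x y : N.V) : Prop := Sub v x ∧ NonTree x y ∧ ¬ Sub v y

theorem Leaves.mem_cov {v x y : N.V} (h : Leaves v x y) : s(x, y) ∈ cov v :=
  Net.mem_cov.2 ⟨h.2.1, fun h' => h.2.2 (h'.1 h.1)⟩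

theorem sum_links_pick_leaving {v : N.V} (key : N.V → N.V → ℕ) (h : (cov v).Nonempty) :
    ∃ x y, Leaves v x y ∧
      (∑ z ∈ links v, (if NonTree z.1 z.2 ∧ (path z.2)[dep v]? ≠ (path z.1)[dep v]? then
        (⟨Pick.mk (key z.1 z.2) (path z.1) (path z.2)⟩ : Mx Pick) else 0)).val
          = Pick.mk (key x y) (path x) (path y) ∧
      ∀ x' y', Leaves v x' y' → key x' y' ≤ key x y := by
  obtain ⟨x, y, h1, h2, h3⟩ := sum_links_pick (v := v) (fun _ y => ¬ Sub v y) key (exists_leaving h)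
  refine ⟨x, y, h1, ?_, fun x' y' h' => h3 x' y' h'.1 h'.2.1 h'.2.2⟩
  rw [← h2]
  congr 1
  refine Finset.sum_congr rfl fun z hz => ite_iff (and_congr_right fun _ => ?_) _ _
  rw [leaves_iff le_rfl (mem_links.1 hz).1, ancAt_dep]

/-- The first selected link: it leaves the subtree, and its ends have a common ancestor as deep as
possible. -/
theorem counts_pick {v : N.V} (h : (cov v).Nonempty) : ∃ x y, Leaves v x y ∧
    (counts N v).2.2.2.val.fst = path x ∧ (counts N v).2.2.2.val.snd = path y ∧
    ∀ x' y', Leaves v x' y' → agree (path x') (path y') ≤ agree (path x) (path y) := by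
  obtain ⟨x, y, h1, h2, h3⟩ := sum_links_pick_leaving (fun x y => agree (path x) (path y)) h
  refine ⟨x, y, h1, ?_, ?_, h3⟩ <;>
    simp only [counts, countP, totals, place, le_refl, if_true, total_countF, h2, Pick.fst_mk,
      Pick.snd_mk]

theorem length_path_le (x : N.V) : (path x).length ≤ N.size := by
  rw [length_path]; exact dep_lt_size x

theorem agree_path_le (x : N.V) (l : List ℕ) : agree (path x) l ≤ N.size :=
  (agree_le _ _).trans (length_path_le x)

theorem counts_pick_length_le (v : N.V) : (counts N v).2.2.2.val.fst.length ≤ N.size ∧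
    (counts N v).2.2.2.val.snd.length ≤ N.size := by
  simp only [counts, countP, totals, place, le_refl, if_true, total_countF]
  rcases Mx.sum_mem (links v) (fun z => if NonTree z.1 z.2 ∧ (path z.2)[dep v]? ≠
    (path z.1)[dep v]? then (⟨Pick.mk (agree (path z.1) (path z.2)) (path z.1) (path z.2)⟩ : Mx Pick)
      else 0) with h | ⟨z, hz, h⟩
  · rw [h]
    exact ⟨Nat.zero_le _, Nat.zero_le _⟩
  · rw [h]
    split_ifs
    · exact ⟨length_path_le _, length_path_le _⟩
    · exact ⟨Nat.zero_le _, Nat.zero_le _⟩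

end Net

theorem solvable_counts : Solvable
    (fun N : Net.{u} => 3 * N.height + 1 + (N.height + 1) * (4 * (N.height + 2)) +
      (3 * N.height + 2) * (16 * (N.height + 2))) (knows counts.{u}) := by
  refine solvable_place.phase (fun a => a.2.1) (fun _ _ => rfl) countF countP (K := 6) (c := 16)
    (by norm_num) ?_ ?_
  · intro N v j hj
    -- A selected link needs four blocks, for the key and two paths; each of the two outer pairings
    -- doubles the length by interleaving.
    rw [total_countF, show 16 * (N.height + 2) = 2 * (2 * (4 * (N.height + 2))) by ring]
    refine Fits.prod (fits_nat ?_ (by omega)) (Fits.prod (fits_nat ?_ (by omega))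
      ((fits_sum_pick fun z _ => ?_).mono_bound (size_pow_mono (by omega))))
    · have := counts_card_le v j
      simp only [counts, countP, totals, if_pos hj, total_countF] at this
      exact this.trans (size_pow_mono (by omega))
    · have := counts_weight_le v j
      simpa only [counts, countP, totals, if_pos hj, total_countF] using this
    · split_ifs
      · exact Or.inr ⟨_, agree_path_le _ _, rfl⟩
      · exact Or.inl rfl
  · intro N v
    rw [show 16 * (N.height + 2) = 2 * (2 * (4 * (N.height + 2))) by ring]
    have hz : ∀ s, 4 * (N.height + 2) ≤ s → ¬ s ≤ dep v := fun s hs h => by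
      have := dep_le_height v
      omega
    refine Fits.prod ((fits_fun (l := 4 * (N.height + 2)) (fun s => ?_) fun s hs => ?_).mono
      (by omega)) (Fits.prod (fits_fun (fun s => ?_) fun s hs => ?_) ?_)
    · exact (counts_card_le v s).trans (size_pow_mono (by omega))
    · simp only [countP, totals, if_neg (hz s hs)]; rfl
    · exact counts_weight_le v s
    · simp only [countP, totals, if_neg (hz s hs)]; rfl
    · simp only [countP, totals, place, le_refl, if_true, total_countF]
      refine (fits_sum_pick fun z _ => ?_).mono_bound (size_pow_mono (by omega))
      split_ifs
      · exact Or.inr ⟨_, agree_path_le _ _, rfl⟩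
      · exact Or.inl rfl

/-! ### Third records: the other selected links -/

/-- The contribution of a link to the selection of the links that leave the subtree of the ancestor
at level `j` as far as possible from the first selected link, at the inner and at the outer end. -/
noncomputable def farF (j : ℕ) (I J : ℕ → (ℕ × ℕ × ℕ) × (ℕ → ℕ) × (ℕ → ℕ) × Mx Pick) :
    Mx Pick × Mx Pick :=
  if nonTreeI (I 0).1 (J 0).1 ∧
      (pathOf fun i => (J i).1)[j]? ≠ (pathOf fun i => (I i).1)[j]? then
    (⟨Pick.mk ((I ((I 0).1.2.2 - j)).2.2.2.val.fst.length -
        agree (I ((I 0).1.2.2 - j)).2.2.2.val.fst (pathOf fun i => (I i).1))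
        (pathOf fun i => (I i).1) (pathOf fun i => (J i).1)⟩,
      ⟨Pick.mk ((I ((I 0).1.2.2 - j)).2.2.2.val.snd.length -
        agree (I ((I 0).1.2.2 - j)).2.2.2.val.snd (pathOf fun i => (J i).1))
        (pathOf fun i => (I i).1) (pathOf fun i => (J i).1)⟩) else 0

/-- The third record. -/
noncomputable def fars : Lab.{u} (((ℕ × ℕ × ℕ) × (ℕ → ℕ) × (ℕ → ℕ) × Mx Pick) ×
    Mx Pick × Mx Pick) := fun N v =>
  (counts N v, totals counts farF N v (counts N v).1.2.2)

/-- The three selected links. -/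
noncomputable def sel (a : ((ℕ × ℕ × ℕ) × (ℕ → ℕ) × (ℕ → ℕ) × Mx Pick) × Mx Pick × Mx Pick) :
    Fin 3 → Pick :=
  ![a.1.2.2.2.val, a.2.1.val, a.2.2.val]

namespace Net

variable {N : Net.{u}}

theorem farF_info {x y : N.V} (j : ℕ) (h : N.G.Adj x y) :
    farF j (info counts N x) (info counts N y)
      = if NonTree x y ∧ (path y)[j]? ≠ (path x)[j]? then
        (⟨Pick.mk ((counts N (ancAt j x)).2.2.2.val.fst.length -
            agree (counts N (ancAt j x)).2.2.2.val.fst (path x)) (path x) (path y)⟩,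
          ⟨Pick.mk ((counts N (ancAt j x)).2.2.2.val.snd.length -
            agree (counts N (ancAt j x)).2.2.2.val.snd (path y)) (path x) (path y)⟩) else 0 := by
  unfold farF
  exact ite_iff (and_congr (nonTreeI_iff h) Iff.rfl) _ _

theorem total_farF {j : ℕ} {v : N.V} (hj : j ≤ dep v) : total counts farF j N v =
    (∑ z ∈ links v, (if NonTree z.1 z.2 ∧ (path z.2)[j]? ≠ (path z.1)[j]? then
       ⟨Pick.mk ((counts N (ancAt j v)).2.2.2.val.fst.length -
         agree (counts N (ancAt j v)).2.2.2.val.fst (path z.1)) (path z.1) (path z.2)⟩ else 0),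
     ∑ z ∈ links v, (if NonTree z.1 z.2 ∧ (path z.2)[j]? ≠ (path z.1)[j]? then
       ⟨Pick.mk ((counts N (ancAt j v)).2.2.2.val.snd.length -
         agree (counts N (ancAt j v)).2.2.2.val.snd (path z.2)) (path z.1) (path z.2)⟩ else 0)) := by
  rw [total_eq, Finset.sum_congr rfl fun z hz => farF_info j (mem_links.1 hz).2]
  -- All links out of the subtree of `v` have the same ancestor at level `j`, so their keys refer to
  -- one and the same first selected link.
  have he : ∀ z ∈ links v, ancAt j z.1 = ancAt j v := fun z hz => by
    rw [← ancAt_ancAt hj z.1, (mem_links.1 hz).1]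
  refine Prod.ext ?_ ?_
  · rw [Prod.fst_sum]
    exact Finset.sum_congr rfl fun z hz => by rw [he z hz]; split_ifs <;> rfl
  · rw [Prod.snd_sum]
    exact Finset.sum_congr rfl fun z hz => by rw [he z hz]; split_ifs <;> rfl

theorem fits_total_farF {j : ℕ} {v : N.V} (hj : j ≤ dep v) :
    Fits (N.size ^ 2) (8 * (N.height + 2)) (total counts farF j N v) := by
  rw [total_farF hj, show 8 * (N.height + 2) = 2 * (4 * (N.height + 2)) by ring]
  have h := counts_pick_length_le (ancAt j v)
  refine Fits.prod (fits_sum_pick fun z _ => ?_) (fits_sum_pick fun z _ => ?_)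
  · split_ifs
    · exact Or.inr ⟨_, (Nat.sub_le _ _).trans h.1, rfl⟩
    · exact Or.inl rfl
  · split_ifs
    · exact Or.inr ⟨_, (Nat.sub_le _ _).trans h.2, rfl⟩
    · exact Or.inl rfl

theorem fars_eq (v : N.V) : fars N v = (counts N v, total counts farF (dep v) N v) := by
  simp only [fars, counts, place, totals, le_refl, if_true]

/-- The link from `x` to `y` is the selected link number `σ` of `v`. -/
def Selects (σ : Fin 3) (v x y : N.V) : Prop :=
  Leaves v x y ∧ (sel (fars N v) σ).fst = path x ∧ (sel (fars N v) σ).snd = path y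

/-- The last three clauses are the extremal properties of the selected links: maximal common prefix
of the two ends, and minimal common prefix with the inner, respectively outer, end of the first
link. -/
theorem exists_selects {v : N.V} (h : (cov v).Nonempty) : ∃ x y x₁ y₁ x₂ y₂,
    Selects 0 v x y ∧ Selects 1 v x₁ y₁ ∧ Selects 2 v x₂ y₂ ∧
    (∀ x' y', Leaves v x' y' → agree (path x') (path y') ≤ agree (path x) (path y)) ∧
    (∀ x' y', Leaves v x' y' → agree (path x) (path x₁) ≤ agree (path x) (path x')) ∧
    (∀ x' y', Leaves v x' y' → agree (path y) (path y₂) ≤ agree (path y) (path y')) := by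
  obtain ⟨x, y, h1, h2, h3, h4⟩ := counts_pick h
  obtain ⟨x₁, y₁, a1, a2, a3⟩ := sum_links_pick_leaving
    (fun x' _ => (path x).length - agree (path x) (path x')) h
  obtain ⟨x₂, y₂, b1, b2, b3⟩ := sum_links_pick_leaving
    (fun _ y' => (path y).length - agree (path y) (path y')) h
  have ht := total_farF (le_refl (dep v))
  rw [ancAt_dep, h2, h3] at ht
  have s0 : sel (fars N v) 0 = (counts N v).2.2.2.val := rfl
  have s1 : sel (fars N v) 1 = Pick.mk ((path x).length - agree (path x) (path x₁)) (path x₁)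
      (path y₁) := by
    rw [fars_eq, ht]
    exact a2
  have s2 : sel (fars N v) 2 = Pick.mk ((path y).length - agree (path y) (path y₂)) (path x₂)
      (path y₂) := by
    rw [fars_eq, ht]
    exact b2
  refine ⟨x, y, x₁, y₁, x₂, y₂, ⟨h1, by rw [s0]; exact h2, by rw [s0]; exact h3⟩,
    ⟨a1, by rw [s1]; rfl, by rw [s1]; rfl⟩, ⟨b1, by rw [s2]; rfl, by rw [s2]; rfl⟩, h4,
    fun x' y' h' => ?_, fun x' y' h' => ?_⟩
  · have := a3 x' y' h'
    have := agree_le (path x) (path x₁)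
    have := agree_le (path x) (path x')
    omega
  · have := b3 x' y' h'
    have := agree_le (path y) (path y₂)
    have := agree_le (path y) (path y')
    omega

theorem length_sum_pick_le {v : N.V} {f : N.V × N.V → Mx Pick}
    (h : ∀ z ∈ links v, f z = 0 ∨ ∃ k, f z = ⟨Pick.mk k (path z.1) (path z.2)⟩) :
    (∑ z ∈ links v, f z).val.fst.length ≤ N.size := by
  rcases Mx.sum_mem (links v) f with h0 | ⟨z, hz, he⟩
  · rw [h0]; exact Nat.zero_le _
  · rw [he]
    rcases h z hz with h0 | ⟨k, h1⟩
    · rw [h0]; exact Nat.zero_le _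
    · rw [h1]; exact length_path_le _

theorem length_sel_le (v : N.V) (σ : Fin 3) : (sel (fars N v) σ).fst.length ≤ N.size := by
  rw [fars_eq, total_farF le_rfl]
  fin_cases σ
  · exact (counts_pick_length_le v).1
  · refine length_sum_pick_le fun z _ => ?_
    split_ifs
    · exact Or.inr ⟨_, rfl⟩
    · exact Or.inl rfl
  · refine length_sum_pick_le fun z _ => ?_
    split_ifs
    · exact Or.inr ⟨_, rfl⟩
    · exact Or.inl rfl

end Net

theorem solvable_fars {T : Net.{u} → ℕ} (h : Solvable T (knows counts.{u})) : Solvable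
    (fun N : Net.{u} => T N + (3 * N.height + 2) * (8 * (N.height + 2))) (knows fars.{u}) := by
  refine h.phase (fun a => a.1.2.1) (fun _ _ => rfl) farF (fun a U => U a.1.2.2)
    (K := 2) (c := 8) (by norm_num) (fun N v j hj => fits_total_farF hj) (fun N v => ?_)
  have := fits_total_farF (le_refl (dep v))
  simpa only [counts, place, totals, le_refl, if_true] using this

/-! ### Fourth records: statistics along the selected links -/

/-- The type of the third record. -/
abbrev FarRec := ((ℕ × ℕ × ℕ) × (ℕ → ℕ) × (ℕ → ℕ) × Mx Pick) × Mx Pick × Mx Pick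

/-- The type of the statistics. -/
abbrev Stats := Fin 3 → (Fin 6 → ℕ → ℕ) × (Fin 3 → ℕ → Mx ℕ)

/-- The link is the selected link. -/
def IsSel (p : Pick) (I J : ℕ → FarRec) : Prop :=
  (pathOf fun i => (I i).1.1) = p.fst ∧ (pathOf fun i => (J i).1.1) = p.snd

/-- The link is not in the tree and its outer end agrees at level `i` with that of the selected
link. -/
def Hits (p : Pick) (i : ℕ) (I J : ℕ → FarRec) : Prop :=
  nonTreeI (I 0).1.1 (J 0).1.1 ∧ i < p.snd.length ∧ (pathOf fun i => (J i).1.1)[i]? = p.snd[i]?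

/-- The contribution of a link to the statistics of the ancestor with record `a` at level `j`. -/
noncomputable def statT (a : FarRec) (j : ℕ) (I J : ℕ → FarRec) : Stats := fun σ =>
  (![fun i => if IsSel (sel a σ) I J ∧ i ≤ (I 0).1.1.2.2 then
        (I ((I 0).1.1.2.2 - i)).1.2.1 i else 0,
     fun i => if IsSel (sel a σ) I J ∧ i ≤ (I 0).1.1.2.2 then
        (I ((I 0).1.1.2.2 - i)).1.2.1 j else 0,
     fun i => if IsSel (sel a σ) I J ∧ i ≤ (J 0).1.1.2.2 then
        (J ((J 0).1.1.2.2 - i)).1.2.1 i else 0,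
     fun i => if IsSel (sel a σ) I J ∧ i ≤ (J 0).1.1.2.2 then
        (J ((J 0).1.1.2.2 - i)).1.2.2.1 i else 0,
     fun i => if Hits (sel a σ) i I J then 1 else 0,
     fun i => if Hits (sel a σ) i I J then label (I 0).1.1.1 (J 0).1.1.1 else 0],
   fun τ i => if Hits (sel a σ) i I J then ⟨agree (sel a τ).fst (pathOf fun i => (I i).1.1)⟩ else 0)

/-- The contribution of a link to the statistics of the ancestor at level `j`. -/
noncomputable def statF (j : ℕ) (I J : ℕ → FarRec) : Stats := statT (I ((I 0).1.1.2.2 - j)) j I J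

/-- The fourth record. -/
noncomputable def stats : Lab.{u} (FarRec × Stats) := fun N v =>
  (fars N v, totals fars statF N v (fars N v).1.1.2.2)

namespace Net

variable {N : Net.{u}}

theorem isSel_iff {p : Pick} {x y : N.V} :
    IsSel p (info fars N x) (info fars N y) ↔ path x = p.fst ∧ path y = p.snd := Iff.rfl

theorem hits_iff {p : Pick} {i : ℕ} {x y : N.V} (h : N.G.Adj x y) :
    Hits p i (info fars N x) (info fars N y) ↔
      NonTree x y ∧ i < p.snd.length ∧ (path y)[i]? = p.snd[i]? :=
  and_congr (nonTreeI_iff h) Iff.rfl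

theorem total_statF {j : ℕ} {v : N.V} (hj : j ≤ dep v) : total fars statF j N v
    = ∑ z ∈ links v, statT (fars N (ancAt j v)) j (info fars N z.1) (info fars N z.2) := by
  rw [total_eq]
  refine Finset.sum_congr rfl fun z hz => ?_
  have : ancAt j v = ancAt j z.1 := by rw [← ancAt_ancAt hj z.1, (mem_links.1 hz).1]
  rw [this]
  rfl

theorem total_statF_fst {j : ℕ} {v : N.V} (hj : j ≤ dep v) (σ : Fin 3) (k : Fin 6) (i : ℕ) :
    (total fars statF j N v σ).1 k i = ∑ z ∈ links v,
      (statT (fars N (ancAt j v)) j (info fars N z.1) (info fars N z.2) σ).1 k i := by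
  rw [total_statF hj, Finset.sum_apply, Prod.fst_sum, Finset.sum_apply, Finset.sum_apply]

theorem total_statF_snd {j : ℕ} {v : N.V} (hj : j ≤ dep v) (σ τ : Fin 3) (i : ℕ) :
    (total fars statF j N v σ).2 τ i = ∑ z ∈ links v,
      (statT (fars N (ancAt j v)) j (info fars N z.1) (info fars N z.2) σ).2 τ i := by
  rw [total_statF hj, Finset.sum_apply, Prod.snd_sum, Finset.sum_apply, Finset.sum_apply]

theorem not_hits {p : Pick} {i : ℕ} (hi : N.height + 2 ≤ i) {x y : N.V} :
    ¬ Hits p i (info fars N x) (info fars N y) := by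
  rintro ⟨-, h1, h2⟩
  have h3 : (path y)[i]? = p.snd[i]? := h2
  rw [path_getElem?, if_neg (by have := dep_le_height y; omega), List.getElem?_eq_getElem h1] at h3
  simp at h3

theorem statT_le (a : FarRec) (j : ℕ) (x y : N.V) (σ : Fin 3) (k : Fin 6) (i : ℕ) :
    (statT a j (info fars N x) (info fars N y) σ).1 k i ≤ N.size ^ 6 ∧
      (N.height + 2 ≤ i → (statT a j (info fars N x) (info fars N y) σ).1 k i = 0) := by
  have hx : N.height + 2 ≤ i → ¬ i ≤ dep x := fun h => by
    have := dep_le_height x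
    omega
  have hy : N.height + 2 ≤ i → ¬ i ≤ dep y := fun h => by
    have := dep_le_height y
    omega
  have c26 : N.size ^ 2 ≤ N.size ^ 6 := size_pow_mono (by omega)
  have c46 : N.size ^ 4 ≤ N.size ^ 6 := size_pow_mono (by omega)
  have c1 : 1 ≤ N.size ^ 6 := Nat.one_le_pow _ _ (by have := N.two_le_size; omega)
  fin_cases k
  · refine ⟨?_, fun h => if_neg fun h' => hx h h'.2⟩
    change (if _ then _ else _) ≤ _
    split_ifs
    · exact (counts_card_le _ _).trans c26
    · exact Nat.zero_le _
  · refine ⟨?_, fun h => if_neg fun h' => hx h h'.2⟩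
    change (if _ then _ else _) ≤ _
    split_ifs
    · exact (counts_card_le _ _).trans c26
    · exact Nat.zero_le _
  · refine ⟨?_, fun h => if_neg fun h' => hy h h'.2⟩
    change (if _ then _ else _) ≤ _
    split_ifs
    · exact (counts_card_le _ _).trans c26
    · exact Nat.zero_le _
  · refine ⟨?_, fun h => if_neg fun h' => hy h h'.2⟩
    change (if _ then _ else _) ≤ _
    split_ifs
    · exact counts_weight_le _ _
    · exact Nat.zero_le _
  · refine ⟨?_, fun h => if_neg fun h' => not_hits h h'⟩
    change (if _ then _ else _) ≤ _
    split_ifs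
    · exact c1
    · exact Nat.zero_le _
  · refine ⟨?_, fun h => if_neg fun h' => not_hits h h'⟩
    change (if _ then _ else _) ≤ _
    split_ifs
    · exact (label_le _ _).trans c46
    · exact Nat.zero_le _

theorem fits_total_statF {j : ℕ} {v : N.V} (hj : j ≤ dep v) :
    Fits (N.size ^ 8) (36 * (N.height + 2)) (total fars statF j N v) := by
  -- Three selected links, each with a pair of families of sequences; the pair costs twice the
  -- longer family, which has six members.
  rw [show 36 * (N.height + 2) = 3 * (2 * (6 * (N.height + 2))) by ring]
  refine Fits.pi fun σ => Fits.prod (Fits.pi fun k => fits_fun (fun i => ?_) fun i hi => ?_)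
    ((Fits.pi (l := N.height + 2) fun τ => fits_funMx (fun i => ?_) fun i hi => ?_).mono (by omega))
  · rw [total_statF_fst hj]
    refine (sum_links_le fun z _ => (statT_le _ _ _ _ _ _ _).1).trans ?_
    rw [← pow_add]
  · rw [total_statF_fst hj]
    exact Finset.sum_eq_zero fun z _ => (statT_le _ _ _ _ _ _ _).2 hi
  · rw [total_statF_snd hj]
    rcases Mx.sum_mem (links v) (fun z => (statT (fars N (ancAt j v)) j (info fars N z.1)
      (info fars N z.2) σ).2 τ i) with h | ⟨z, hz, h⟩
    · rw [h]; exact Nat.zero_le _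
    · rw [h]
      simp only [statT]
      split_ifs
      · exact ((agree_le _ _).trans (length_sel_le _ _)).trans (Nat.le_self_pow (by norm_num) _)
      · exact Nat.zero_le _
  · have : ∀ z ∈ links v, (statT (fars N (ancAt j v)) j (info fars N z.1)
        (info fars N z.2) σ).2 τ i = 0 := fun z _ => if_neg (not_hits hi)
    rw [total_statF_snd hj, Finset.sum_eq_zero this]
    rfl

theorem stats_eq (v : N.V) : stats N v = (fars N v, total fars statF (dep v) N v) := by
  have : (fars N v).1.1.2.2 = dep v := rfl
  simp only [stats, totals, this, le_refl, if_true]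

theorem stats_fst (v : N.V) (σ : Fin 3) (k : Fin 6) (i : ℕ) :
    ((stats N v).2 σ).1 k i = ∑ z ∈ links v,
      (statT (fars N v) (dep v) (info fars N z.1) (info fars N z.2) σ).1 k i := by
  rw [stats_eq, total_statF_fst le_rfl, ancAt_dep]

theorem stats_snd (v : N.V) (σ τ : Fin 3) (i : ℕ) :
    ((stats N v).2 σ).2 τ i = ∑ z ∈ links v,
      (statT (fars N v) (dep v) (info fars N z.1) (info fars N z.2) σ).2 τ i := by
  rw [stats_eq, total_statF_snd le_rfl, ancAt_dep]

/-- The sum of a term that only the selected link contributes. -/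
theorem sum_isSel {σ : Fin 3} {v x y : N.V} (h : Selects σ v x y) (c : N.V × N.V → Prop)
    [DecidablePred c] (hc : c (x, y)) (f : N.V × N.V → ℕ) :
    ∑ z ∈ links v, (if IsSel (sel (fars N v) σ) (info fars N z.1) (info fars N z.2) ∧ c z then f z
      else 0) = f (x, y) := by
  rw [Finset.sum_eq_single_of_mem (x, y) (mem_links.2 ⟨h.1.1, h.1.2.1.1⟩)]
  · exact if_pos ⟨⟨h.2.1.symm, h.2.2.symm⟩, hc⟩
  · rintro ⟨x', y'⟩ - hne
    refine if_neg fun hs => hne ?_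
    obtain ⟨h1, h2⟩ := isSel_iff.1 hs.1
    exact Prod.ext (path_injective (h1.trans h.2.1)) (path_injective (h2.trans h.2.2))

variable {σ : Fin 3} {v x y : N.V} {i : ℕ}

/-! ### Meaning of the statistics -/

theorem stats_inner_card (h : Selects σ v x y) (hi : i ≤ dep x) :
    ((stats N v).2 σ).1 0 i = (cov (ancAt i x)).card := by
  rw [stats_fst]
  have := sum_isSel h (fun z => i ≤ dep z.1) hi (fun z => (counts N (ancAt i z.1)).2.1 i)
  refine Eq.trans this ?_
  have h1 := counts_card_self (ancAt i x)
  rwa [dep_ancAt hi] at h1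

theorem stats_inner_inter (h : Selects σ v x y) (hi : i ≤ dep x) (hv : dep v ≤ i) :
    ((stats N v).2 σ).1 1 i = (cov (ancAt i x) ∩ cov v).card := by
  rw [stats_fst]
  have := sum_isSel h (fun z => i ≤ dep z.1) hi (fun z => (counts N (ancAt i z.1)).2.1 (dep v))
  refine Eq.trans this ?_
  rw [counts_card (by rw [dep_ancAt hi]; exact hv), ancAt_ancAt hv, h.1.1]

theorem stats_outer_card (h : Selects σ v x y) (hi : i ≤ dep y) :
    ((stats N v).2 σ).1 2 i = (cov (ancAt i y)).card := by
  rw [stats_fst]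
  have := sum_isSel h (fun z => i ≤ dep z.2) hi (fun z => (counts N (ancAt i z.2)).2.1 i)
  refine Eq.trans this ?_
  have h1 := counts_card_self (ancAt i y)
  rwa [dep_ancAt hi] at h1

theorem stats_outer_weight (h : Selects σ v x y) (hi : i ≤ dep y) :
    ((stats N v).2 σ).1 3 i = ∑ e ∈ cov (ancAt i y), weight e := by
  rw [stats_fst]
  have := sum_isSel h (fun z => i ≤ dep z.2) hi (fun z => (counts N (ancAt i z.2)).2.2.1 i)
  refine Eq.trans this ?_
  have h1 := counts_weight_self (ancAt i y)
  rwa [dep_ancAt hi] at h1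

theorem hits_iff_sub (h : Selects σ v x y) (hi : i ≤ dep y) {x' y' : N.V} (hadj : N.G.Adj x' y') :
    Hits (sel (fars N v) σ) i (info fars N x') (info fars N y') ↔
      NonTree x' y' ∧ Sub (ancAt i y) y' := by
  have h1 := sub_iff_path_eq (y := y') (sub_ancAt i y)
  rw [dep_ancAt hi] at h1
  rw [hits_iff hadj, h.2.2, length_path, h1]
  constructor
  · rintro ⟨a, -, b⟩; exact ⟨a, b⟩
  · rintro ⟨a, b⟩; exact ⟨a, by omega, b⟩

/-- A link out of the subtree of `v` counts when its outer end has the same ancestor at level `i` as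
the outer end `y` of the selected link, that is, when it runs into the subtree of that ancestor. -/
theorem sum_hits (W : Sym2 N.V → ℕ) (h : Selects σ v x y) (hi : i ≤ dep y)
    (ha : Apart v (ancAt i y)) :
    ∑ z ∈ links v, (if Hits (sel (fars N v) σ) i (info fars N z.1) (info fars N z.2) then
      W s(z.1, z.2) else 0) = ∑ e ∈ cov v ∩ cov (ancAt i y), W e := by
  rw [cov_inter_of_apart ha, ← sum_links_edgesOf]
  · exact Finset.sum_congr rfl fun z hz => ite_iff (hits_iff_sub h hi (mem_links.1 hz).2) _ _
  · rintro a b - hb ⟨h', -⟩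
    exact ha.not_sub h' hb

theorem stats_outer_inter (h : Selects σ v x y) (hi : i ≤ dep y) (ha : Apart v (ancAt i y)) :
    ((stats N v).2 σ).1 4 i = (cov v ∩ cov (ancAt i y)).card := by
  rw [stats_fst, Finset.card_eq_sum_ones]
  exact sum_hits (fun _ => 1) h hi ha

theorem stats_outer_inter_weight (h : Selects σ v x y) (hi : i ≤ dep y)
    (ha : Apart v (ancAt i y)) :
    ((stats N v).2 σ).1 5 i = ∑ e ∈ cov v ∩ cov (ancAt i y), weight e := by
  rw [stats_fst]
  exact sum_hits weight h hi ha

/-- No link from the subtree of `u` to that of an outer node, in terms of the statistics. -/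
theorem stats_disjoint_iff (h : Selects σ v x y) (hi : i ≤ dep y) (ha : Apart v (ancAt i y))
    {τ : Fin 3} {x₁ y₁ u : N.V} (h₁ : Selects τ v x₁ y₁) (hu : Sub u x₁) (huv : Sub v u) :
    (((stats N v).2 σ).2 τ i).val ≤ dep u ↔ cov u ∩ cov (ancAt i y) = ∅ := by
  have hau : Apart u (ancAt i y) :=
    ⟨fun h' => ha.1 (huv.trans h'), fun h' => ha.not_sub (Sub.refl v) (by
      rcases h'.total huv with h2 | h2
      · exact h2
      · exact absurd h2 ha.1)⟩
  rw [cov_inter_of_apart hau, stats_snd]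
  constructor
  · intro hle
    rw [Finset.eq_empty_iff_forall_notMem]
    intro e he
    simp only [edgesOf, Finset.mem_filter, Finset.mem_univ, true_and] at he
    obtain ⟨a, b, hn, ⟨hs, hb⟩, -⟩ := he
    have h2 := Mx.le_sum (s := links v) (i := (a, b)) (f := fun z =>
      (statT (fars N v) (dep v) (info fars N z.1) (info fars N z.2) σ).2 τ i)
      (mem_links.2 ⟨huv.trans hs, hn.1⟩)
    have h3 : (statT (fars N v) (dep v) (info fars N a) (info fars N b) σ).2 τ i
        = ⟨agree (path x₁) (path a)⟩ := by
      rw [← h₁.2.1]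
      exact if_pos ((hits_iff_sub h hi hn.1).2 ⟨hn, hb⟩)
    have h4 : agree (path x₁) (path a) ≤ dep u := by
      simp only [h3] at h2
      exact h2.trans hle
    exact absurd ((lt_agree_iff hu).2 hs) (by omega)
  · intro he
    rcases Mx.sum_mem (links v) (fun z =>
      (statT (fars N v) (dep v) (info fars N z.1) (info fars N z.2) σ).2 τ i)
      with h0 | ⟨⟨a, b⟩, hz, h0⟩
    · rw [h0]; exact Nat.zero_le _
    · rw [h0]
      by_cases hh : Hits (sel (fars N v) σ) i (info fars N a) (info fars N b)
      · have h3 : (statT (fars N v) (dep v) (info fars N a) (info fars N b) σ).2 τ i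
            = ⟨agree (path x₁) (path a)⟩ := by
          rw [← h₁.2.1]
          exact if_pos hh
        rw [h3]
        by_contra! hlt
        have hs := (lt_agree_iff hu).1 hlt
        obtain ⟨hn, hb⟩ := (hits_iff_sub h hi (mem_links.1 hz).2).1 hh
        have : s(a, b) ∈ (∅ : Finset (Sym2 N.V)) := he ▸ mem_edgesOf.2 ⟨hn, Or.inl ⟨hs, hb⟩⟩
        simp at this
      · have h3 : (statT (fars N v) (dep v) (info fars N a) (info fars N b) σ).2 τ i = 0 :=
          if_neg hh
        rw [h3]
        exact Nat.zero_le _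

end Net

theorem solvable_stats {T : Net.{u} → ℕ} (h : Solvable T (knows fars.{u})) : Solvable
    (fun N : Net.{u} => T N + (3 * N.height + 2) * (36 * (N.height + 2))) (knows stats.{u}) := by
  refine h.phase (fun a => a.1.1.2.1) (fun _ _ => rfl) statF (fun a U => U a.1.1.2.2)
    (K := 8) (c := 36) (by norm_num) (fun N v j hj => fits_total_statF hj) (fun N v => ?_)
  have := fits_total_statF (le_refl (dep v))
  have e : (fars N v).1.1.2.2 = dep v := rfl
  simpa only [totals, e, le_refl, if_true] using this

/-! ### Nodes of two networks with the same root path -/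

namespace Net

variable {N N' : Net.{u}}

theorem path_ancAt {j : ℕ} {x : N.V} (hj : j ≤ dep x) :
    path (ancAt j x) = (path x).take (j + 1) := by
  refine List.ext_getElem? fun i => ?_
  rw [path_getElem?, List.getElem?_take, path_getElem?, dep_ancAt hj]
  by_cases hi : i ≤ j
  · rw [if_pos hi, if_pos (by omega), if_pos (by omega), ancAt_ancAt hi]
  · rw [if_neg hi, if_neg (by omega)]

/-- The two nodes have the same root path. -/
def Twin (a : N.V) (a' : N'.V) : Prop := path a = path a'

section Twin

variable {a b x : N.V} {a' b' x' : N'.V}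

theorem Twin.dep_eq (h : Twin a a') : dep a = dep a' := by
  simpa using congrArg List.length h

theorem Twin.ident_eq (h : Twin a a') : N.ident a = N'.ident a' := by
  have h1 := sub_iff_path.1 (Sub.refl a)
  have h2 := sub_iff_path.1 (Sub.refl a')
  rw [h, h.dep_eq, h2] at h1
  exact (Option.some.inj h1).symm

theorem Twin.ancAt (h : Twin x x') (j : ℕ) : Twin (ancAt j x) (ancAt j x') := by
  rcases Nat.le_total j (dep x) with hj | hj
  · rw [Twin, path_ancAt hj, path_ancAt (h.dep_eq ▸ hj), h]
  · rwa [ancAt_of_le hj, ancAt_of_le (h.dep_eq ▸ hj)]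

theorem Twin.par (h : Twin x x') : Twin (par x) (par x') := by
  have h1 := iterate_eq_ancAt 1 x
  have h2 := iterate_eq_ancAt 1 x'
  rw [Function.iterate_one] at h1 h2
  rw [h1, h2, h.dep_eq]
  exact h.ancAt _

theorem Twin.sub_iff (h : Twin a a') (h' : Twin b b') : Sub a b ↔ Sub a' b' := by
  rw [sub_iff_path, sub_iff_path, h.dep_eq, h.ident_eq, h']

theorem Twin.apart_iff (h : Twin a a') (h' : Twin b b') : Apart a b ↔ Apart a' b' := by
  rw [Apart, Apart, h.sub_iff h', h'.sub_iff h]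

theorem Twin.eq_iff (h : Twin a a') (h' : Twin b b') : a = b ↔ a' = b' := by
  rw [← path_injective.eq_iff, ← path_injective.eq_iff (a := a'), h, h']

theorem Twin.eq_root_iff (h : Twin a a') : a = N.root ↔ a' = N'.root := by
  rw [← dep_eq_zero, ← dep_eq_zero, h.dep_eq]

theorem Twin.map_up (h : Twin a a') : (up a).map N.ident = (up a').map N'.ident := by
  rw [up, up, Sym2.map_mk, Sym2.map_mk, h.ident_eq, h.par.ident_eq]

theorem Twin.exists_ancestor (h : Twin x x') (ha : Sub a x) : ∃ a', Twin a a' ∧ Sub a' x' := by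
  refine ⟨Net.ancAt (dep a) x', ?_, sub_ancAt _ _⟩
  have := h.ancAt (dep a)
  rwa [ha] at this

end Twin

/-! ### Names of edge sets -/

/-- An edge set with its nodes replaced by their identifiers. -/
noncomputable def names (F : Finset (Sym2 N.V)) : Finset (Sym2 ℕ) := F.map N.ident.sym2Map

theorem names_eq_of_card_eq_one {E : Finset (Sym2 N.V)} {E' : Finset (Sym2 N'.V)}
    (h : E.card = 1) (h' : E'.card = 1) (hw : ∑ e ∈ E, weight e = ∑ e ∈ E', weight e) :
    names E = names E' := by
  obtain ⟨e, rfl⟩ := Finset.card_eq_one.1 h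
  obtain ⟨e', rfl⟩ := Finset.card_eq_one.1 h'
  rw [Finset.sum_singleton, Finset.sum_singleton] at hw
  rw [names, names, Finset.map_singleton, Finset.map_singleton]
  congr 1
  exact (unlabel_weight e).symm.trans ((congrArg unlabel hw).trans (unlabel_weight e'))

/-- One known edge and the sum of the labels reveal the second edge. -/
theorem names_eq_of_card_eq_two {E : Finset (Sym2 N.V)} {E' : Finset (Sym2 N'.V)} {e : Sym2 N.V}
    {e' : Sym2 N'.V} (h : E.card = 2) (h' : E'.card = 2) (he : e ∈ E) (he' : e' ∈ E')
    (hn : weight e = weight e') (hw : ∑ e ∈ E, weight e = ∑ e ∈ E', weight e) :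
    names E = names E' := by
  have h1 : names (E.erase e) = names (E'.erase e') := by
    refine names_eq_of_card_eq_one (by rw [Finset.card_erase_of_mem he, h])
      (by rw [Finset.card_erase_of_mem he', h']) ?_
    have a1 := Finset.add_sum_erase E weight he
    have a2 := Finset.add_sum_erase E' weight he'
    omega
  have h2 : N.ident.sym2Map e = N'.ident.sym2Map e' :=
    (unlabel_weight e).symm.trans ((congrArg unlabel hn).trans (unlabel_weight e'))
  rw [← Finset.insert_erase he, ← Finset.insert_erase he', names, names, Finset.map_insert,
    Finset.map_insert, h2]
  exact congrArg _ h1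

theorem names_cutOf {X : Finset N.V} (hX : N.root ∉ X) :
    names (cutOf X) = (X.image fun a => (up a).map N.ident) ∪ names (oddEdges X) := by
  rw [cutOf_eq hX, names, Finset.map_union, names, Finset.map_eq_image, Finset.image_image]
  rfl

/-! ### Nodes with the same statistics -/

/-- The two nodes and their ancestors have the same records. -/
def Same (x : N.V) (x' : N'.V) : Prop := info stats N x = info stats N' x'

section Same

variable {u v w x y x₁ y₁ : N.V} {u' v' w' x' y' x₁' y₁' : N'.V} {σ τ : Fin 3}

theorem Same.twin (h : Same x x') : Twin x x' :=
  congrArg (fun I : ℕ → FarRec × Stats => pathOf fun i => (I i).1.1.1) h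

theorem Same.stats_eq (h : Same x x') : stats N x = stats N' x' := congrFun h 0

theorem Same.counts_eq (h : Same x x') : counts N x = counts N' x' :=
  congrArg (fun a => a.1.1) h.stats_eq

theorem Same.ancAt (h : Same x x') (j : ℕ) : Same (ancAt j x) (ancAt j x') := by
  funext i
  have h1 := congrFun h (i + (dep x - j))
  simp only [info, Net.ancAt, ← h.twin.dep_eq, ← Function.iterate_add_apply] at h1 ⊢
  exact h1

theorem Same.ancestor (h : Same x x') (hu : Sub u x) (ht : Twin u u') : Same u u' := by
  have h1 : Sub u' x' := (ht.sub_iff h.twin).1 hu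
  rw [← hu, ← h1, ← ht.dep_eq]
  exact h.ancAt _

theorem Same.inter (h : Same u u') (hv : Sub v u) (ht : Twin v v') :
    (cov u ∩ cov v).card = (cov u' ∩ cov v').card := by
  have hv' : Sub v' u' := (ht.sub_iff h.twin).1 hv
  have h1 := counts_card hv.dep_le
  have h2 := counts_card hv'.dep_le
  rw [hv] at h1
  rw [hv'] at h2
  rw [← h1, ← h2, h.counts_eq, ht.dep_eq]

theorem Same.inter_weight (h : Same u u') (hv : Sub v u) (ht : Twin v v') :
    ∑ e ∈ cov u ∩ cov v, weight e = ∑ e ∈ cov u' ∩ cov v', weight e := by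
  have hv' : Sub v' u' := (ht.sub_iff h.twin).1 hv
  have h1 := counts_weight hv.dep_le
  have h2 := counts_weight hv'.dep_le
  rw [hv] at h1
  rw [hv'] at h2
  rw [← h1, ← h2, h.counts_eq, ht.dep_eq]

theorem Same.card (h : Same u u') : (cov u).card = (cov u').card := by
  simpa using h.inter (Sub.refl u) h.twin

theorem Same.weight (h : Same u u') : ∑ e ∈ cov u, weight e = ∑ e ∈ cov u', weight e := by
  simpa using h.inter_weight (Sub.refl u) h.twin

/-- The equal sizes of the covering sets guarantee that a selected link exists on the other side;
the records contain its root paths, and these identify its ends up to twins. -/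
theorem Same.selects (h : Same v v') (hs : Selects σ v x y) :
    ∃ x' y', Selects σ v' x' y' ∧ Twin x x' ∧ Twin y y' := by
  have hne : (cov v').Nonempty := by
    rw [← Finset.card_pos, ← h.card, Finset.card_pos]
    exact ⟨_, hs.1.mem_cov⟩
  have hf : fars N v = fars N' v' := congrArg Prod.fst h.stats_eq
  have key : ∀ {x' y'}, Selects σ v' x' y' → Selects σ v' x' y' ∧ Twin x x' ∧ Twin y y' :=
    fun {x' y'} h' => ⟨h', by rw [Twin, ← hs.2.1, ← h'.2.1, hf], by
      rw [Twin, ← hs.2.2, ← h'.2.2, hf]⟩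
  obtain ⟨x₀, y₀, x₁, y₁, x₂, y₂, h0, h1, h2, -⟩ := exists_selects hne
  fin_cases σ
  · exact ⟨x₀, y₀, key h0⟩
  · exact ⟨x₁, y₁, key h1⟩
  · exact ⟨x₂, y₂, key h2⟩

theorem Same.inner (h : Same v v') (hs : Selects σ v x y) (hu : Sub u x) (huv : Sub v u)
    (ht : Twin u u') :
    (cov u).card = (cov u').card ∧ (cov u ∩ cov v).card = (cov u' ∩ cov v').card := by
  obtain ⟨x', y', hs', hx, hy⟩ := h.selects hs
  have hu' := (ht.sub_iff hx).1 hu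
  have huv' := (h.twin.sub_iff ht).1 huv
  have a1 := stats_inner_card hs hu.dep_le
  have a2 := stats_inner_card hs' hu'.dep_le
  have b1 := stats_inner_inter hs hu.dep_le huv.dep_le
  have b2 := stats_inner_inter hs' hu'.dep_le huv'.dep_le
  rw [hu] at a1 b1
  rw [hu'] at a2 b2
  rw [← a1, ← a2, ← b1, ← b2, h.stats_eq, ht.dep_eq]
  exact ⟨rfl, rfl⟩

theorem Same.outer (h : Same v v') (hs : Selects σ v x y) (hw : Sub w y) (ht : Twin w w') :
    (cov w).card = (cov w').card ∧ ∑ e ∈ cov w, Net.weight e = ∑ e ∈ cov w', Net.weight e := by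
  obtain ⟨x', y', hs', hx, hy⟩ := h.selects hs
  have hw' := (ht.sub_iff hy).1 hw
  have a1 := stats_outer_card hs hw.dep_le
  have a2 := stats_outer_card hs' hw'.dep_le
  have b1 := stats_outer_weight hs hw.dep_le
  have b2 := stats_outer_weight hs' hw'.dep_le
  rw [hw] at a1 b1
  rw [hw'] at a2 b2
  rw [← a1, ← a2, ← b1, ← b2, h.stats_eq, ht.dep_eq]
  exact ⟨rfl, rfl⟩

theorem Same.outer_inter (h : Same v v') (hs : Selects σ v x y) (hw : Sub w y) (ha : Apart v w)
    (ht : Twin w w') : (cov v ∩ cov w).card = (cov v' ∩ cov w').card ∧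
      ∑ e ∈ cov v ∩ cov w, Net.weight e = ∑ e ∈ cov v' ∩ cov w', Net.weight e := by
  obtain ⟨x', y', hs', hx, hy⟩ := h.selects hs
  have hw' := (ht.sub_iff hy).1 hw
  have ha' := (h.twin.apart_iff ht).1 ha
  have a1 := stats_outer_inter (i := dep w) hs hw.dep_le (by rwa [hw])
  have a2 := stats_outer_inter (i := dep w') hs' hw'.dep_le (by rwa [hw'])
  have b1 := stats_outer_inter_weight (i := dep w) hs hw.dep_le (by rwa [hw])
  have b2 := stats_outer_inter_weight (i := dep w') hs' hw'.dep_le (by rwa [hw'])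
  rw [hw] at a1 b1
  rw [hw'] at a2 b2
  rw [← a1, ← a2, ← b1, ← b2, h.stats_eq, ht.dep_eq]
  exact ⟨rfl, rfl⟩

theorem Same.inter_eq_empty (h : Same v v') (hs : Selects σ v x y) (hw : Sub w y) (ha : Apart v w)
    (htw : Twin w w') (hs₁ : Selects τ v x₁ y₁) (hu : Sub u x₁) (huv : Sub v u)
    (htu : Twin u u') (he : cov u ∩ cov w = ∅) : cov u' ∩ cov w' = ∅ := by
  obtain ⟨x', y', hs', hx, hy⟩ := h.selects hs
  obtain ⟨x₁', y₁', hs₁', hx₁, hy₁⟩ := h.selects hs₁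
  have hw' := (htw.sub_iff hy).1 hw
  have ha' := (h.twin.apart_iff htw).1 ha
  have a1 := stats_disjoint_iff (i := dep w) hs hw.dep_le (by rwa [hw]) hs₁ hu huv
  have a2 := stats_disjoint_iff (i := dep w') hs' hw'.dep_le (by rwa [hw']) hs₁'
    ((htu.sub_iff hx₁).1 hu) ((h.twin.sub_iff htu).1 huv)
  rw [hw] at a1
  rw [hw'] at a2
  rw [← a2, ← h.stats_eq, ← htw.dep_eq, ← htu.dep_eq]
  exact a1.2 he

end Same

end Net

/-! ### Fifth records: networks with a cut of at most two edges -/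

namespace Net

/-- The network has a cut with at most two edges. -/
def HasSmallCut (N : Net.{u}) : Prop :=
  ∃ X : Finset N.V, N.root ∉ X ∧ X.Nonempty ∧ X.card + (oddEdges X).card ≤ 2

end Net

/-- The records of the ancestors of a node prove that the network has a cut with at most two
edges. -/
def ShowsSmallCut (I : ℕ → FarRec × Stats) : Prop :=
  ∀ (N : Net.{u}) (x : N.V), info stats N x = I → HasSmallCut N

/-- The contribution of a node to the number of proofs of a small cut. -/
noncomputable def flagF (_ : ℕ) (I _ : ℕ → FarRec × Stats) : ℕ :=
  if ShowsSmallCut.{u} I then 1 else 0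

/-- The fifth record. -/
noncomputable def flags : Lab.{u} ((FarRec × Stats) × ℕ) := fun N v =>
  (stats N v, totals stats flagF.{u} N v 0)

namespace Net

variable {N : Net.{u}}

/-- A cut with at most two edges has either one tree edge with at most one covering edge, or two
tree edges with equal covering sets. In the second case the deeper node knows the intersection if
the two are nested; otherwise every link leaving the subtree of `a` ends below `b`, so the first
selected link of `a` serves. -/
theorem exists_showsSmallCut (h : HasSmallCut N) :
    ∃ x : N.V, ShowsSmallCut.{u} (info stats N x) := by
  obtain ⟨X, hX, hne, hcard⟩ := h
  by_cases h1 : ∃ a : N.V, a ≠ N.root ∧ (cov a).card ≤ 1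
  · obtain ⟨a, ha, hc⟩ := h1
    refine ⟨a, fun N' a' h' => ?_⟩
    have hs : Same a a' := h'.symm
    refine ⟨{a'}, ?_, ⟨a', by simp⟩, ?_⟩
    · rw [Finset.mem_singleton]
      exact fun e => ha (hs.twin.eq_root_iff.2 e.symm)
    · rw [oddEdges_one, ← hs.card, Finset.card_singleton]
      omega
  push Not at h1
  have hpos := Finset.card_pos.2 hne
  have hX2 : X.card = 2 := by
    by_contra hn
    obtain ⟨a, rfl⟩ := Finset.card_eq_one.1 (show X.card = 1 by omega)
    have := h1 a (by simpa [eq_comm] using hX)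
    rw [oddEdges_one, Finset.card_singleton] at hcard
    omega
  obtain ⟨a, b, hab, rfl⟩ := Finset.card_eq_two.1 hX2
  have hro : a ≠ N.root ∧ b ≠ N.root := by
    simp only [Finset.mem_insert, Finset.mem_singleton, not_or] at hX
    exact ⟨Ne.symm hX.1, Ne.symm hX.2⟩
  have hcov : cov a = cov b := by
    have : (oddEdges {a, b}).card = 0 := by omega
    rw [oddEdges_two hab, Finset.card_eq_zero] at this
    exact symmDiff_eq_bot.1 this
  -- equality of the two covering sets carries over to another network
  have key : ∀ {a b : N.V} {N' : Net.{u}} {a' b' : N'.V}, a ≠ b → a ≠ N.root → b ≠ N.root →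
      cov a = cov b → Twin a a' → Twin b b' → (cov a).card = (cov a').card →
      (cov b).card = (cov b').card → (cov a ∩ cov b).card = (cov a' ∩ cov b').card →
      HasSmallCut N' := by
    intro a b N' a' b' hab ha hb hcov ta tb c1 c2 c3
    have hab' : a' ≠ b' := fun e => hab ((ta.eq_iff tb).2 e)
    refine ⟨{a', b'}, ?_, ⟨a', by simp⟩, ?_⟩
    · simp only [Finset.mem_insert, Finset.mem_singleton, not_or]
      exact ⟨fun e => ha (ta.eq_root_iff.2 e.symm), fun e => hb (tb.eq_root_iff.2 e.symm)⟩
    · rw [oddEdges_two hab', Finset.card_pair hab']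
      have := card_symmDiff_add (cov a') (cov b')
      rw [hcov, Finset.inter_self] at c3
      rw [hcov] at c1
      omega
  have nested : ∀ {a b : N.V}, a ≠ b → a ≠ N.root → b ≠ N.root → cov a = cov b → Sub b a →
      ShowsSmallCut.{u} (info stats N a) := by
    intro a b hab ha hb hcov hs N' a' h'
    have hsame : Same a a' := h'.symm
    obtain ⟨b', tb, -⟩ := hsame.twin.exists_ancestor hs
    exact key hab ha hb hcov hsame.twin tb hsame.card (hsame.ancestor hs tb).card
      (hsame.inter hs tb)
  by_cases h2 : Sub b a
  · exact ⟨a, nested hab hro.1 hro.2 hcov h2⟩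
  by_cases h3 : Sub a b
  · exact ⟨b, nested hab.symm hro.2 hro.1 hcov.symm h3⟩
  have hap : Apart a b := ⟨h3, h2⟩
  have hcne : (cov a).Nonempty := Finset.card_pos.1 (by have := h1 a hro.1; omega)
  obtain ⟨x, y, -, -, -, -, hsel, -⟩ := exists_selects hcne
  have hby : Sub b y := by
    have h4 := hsel.1.mem_cov
    rw [hcov, mem_cov] at h4
    have := hap.not_sub hsel.1.1
    tauto
  refine ⟨a, fun N' a' h' => ?_⟩
  have hsame : Same a a' := h'.symm
  obtain ⟨x', y', hsel', tx, ty⟩ := hsame.selects hsel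
  obtain ⟨b', tb, -⟩ := ty.exists_ancestor hby
  exact key hab hro.1 hro.2 hcov hsame.twin tb hsame.card (hsame.outer hsel hby tb).1
    (hsame.outer_inter hsel hby hap tb).1

theorem total_flagF_le (v : N.V) (j : ℕ) : total stats flagF.{u} j N v ≤ N.size ^ 2 := by
  rw [total_eq]
  refine (sum_links_le (b := 1) fun z _ => ?_).trans (by simp)
  unfold flagF
  split_ifs <;> omega

/-- No false alarm is possible, since a node that shows a small cut does so for its own network;
`exists_showsSmallCut` gives the converse. Every node has a neighbour, so summing over links misses
no node. -/
theorem flags_root : (flags N N.root).2 = 0 ↔ ¬ HasSmallCut N := by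
  have h0 : (flags N N.root).2 = ∑ z ∈ links N.root, flagF.{u} 0 (info stats N z.1)
      (info stats N z.2) := by
    rw [flags, totals, if_pos (Nat.zero_le _), total_eq]
  rw [h0, Finset.sum_eq_zero_iff]
  constructor
  · intro h hs
    obtain ⟨x, hx⟩ := exists_showsSmallCut hs
    have := N.nontriv
    obtain ⟨y, hy⟩ := N.conn.preconnected.exists_adj_of_nontrivial x
    have h1 := h (x, y) (mem_links.2 ⟨sub_root x, hy⟩)
    rw [flagF, if_pos hx] at h1
    exact one_ne_zero h1
  · intro h z _
    exact if_neg fun h' => h (h' N z.1 rfl)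

theorem hasSmallCut_congr {N' : Net.{u}} {x : N.V} {x' : N'.V}
    (h : info flags N x = info flags N' x') : HasSmallCut N ↔ HasSmallCut N' := by
  have hs : Same x x' := funext fun i => congrArg Prod.fst (congrFun h i)
  have h1 := congrArg Prod.snd (congrFun h (dep x))
  have e : info flags N x (dep x) = flags N N.root := by
    rw [info, iterate_eq_ancAt, Nat.sub_self, ancAt_zero]
  have e' : info flags N' x' (dep x) = flags N' N'.root := by
    rw [info, iterate_eq_ancAt, hs.twin.dep_eq, Nat.sub_self, ancAt_zero]
  rw [e, e'] at h1
  rw [← not_iff_not, ← flags_root, ← flags_root, h1]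

end Net

theorem solvable_flags {T : Net.{u} → ℕ} (h : Solvable T (knows stats.{u})) : Solvable
    (fun N : Net.{u} => T N + (3 * N.height + 2) * (1 * (N.height + 2))) (knows flags.{u}) := by
  refine h.phase (fun a => a.1.1.1.2.1) (fun _ _ => rfl) flagF.{u} (fun _ U => U 0)
    (K := 2) (c := 1) (by norm_num) (fun N v j hj => fits_nat (total_flagF_le v j) (by omega))
    (fun N v => fits_nat ?_ (by omega))
  rw [totals, if_pos (Nat.zero_le _)]
  exact total_flagF_le v 0

/-! ### Certificates for cuts with three edges -/

/-- Deduces that an intersection is empty in the other network when no node counts it directly: the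
cardinality forces `A` into `C`. -/
theorem inter_eq_empty_of_card {ι : Type*} [DecidableEq ι] {A B C : Finset ι}
    (h : (A ∩ C).card = A.card) (h' : A ∩ B ∩ C = ∅) : A ∩ B = ∅ := by
  have h1 : A ⊆ C := Finset.inter_eq_left.1
    (Finset.eq_of_subset_of_card_le Finset.inter_subset_left h.ge)
  rw [← h', eq_comm, Finset.inter_eq_left]
  exact Finset.inter_subset_left.trans h1

namespace Net

variable {N N' : Net.{u}}

/-- The two nodes have the same knowledge of the statistics. -/
def View (v : N.V) (v' : N'.V) : Prop :=
  Same v v' ∧ N.inb v (info stats N) = N'.inb v' (info stats N')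

theorem View.exists_adj {x y : N.V} {x' : N'.V} (h : View x x') (hxy : N.G.Adj x y) :
    ∃ y', N'.G.Adj x' y' ∧ Same y y' := by
  have h1 := congrFun h.2 (N.ident y)
  rw [inb_of_adj _ hxy, eq_comm, inb_eq_some] at h1
  obtain ⟨y', hy, -, he⟩ := h1
  exact ⟨y', hy, he.symm⟩

/-- The other network has a cut with three edges that have the names of those in the cut of `X`. -/
def Matched (X : Finset N.V) (N' : Net.{u}) : Prop :=
  ∃ X' : Finset N'.V, N'.root ∉ X' ∧ X'.card + (oddEdges X').card = 3 ∧
    names (cutOf X) = names (cutOf X')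

/-- The knowledge of some node suffices to find the cut of `X`. -/
def Certified (X : Finset N.V) : Prop :=
  ∃ v : N.V, ∀ (N' : Net.{u}) (v' : N'.V), View v v' → Matched X N'

section Cases

variable {a b c u v w x y x₁ y₁ : N.V} {a' b' c' : N'.V}

theorem Leaves.mem_cov_iff_of_apart (h : Leaves v x y) (ha : Apart v w) :
    s(x, y) ∈ cov w ↔ Sub w y := by
  rw [Net.mem_cov]
  have := ha.not_sub h.1
  have := h.2.1
  tauto

theorem Leaves.mem_cov_iff_of_sub (h : Leaves v x y) (hu : Sub v u) :
    s(x, y) ∈ cov u ↔ Sub u x := by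
  rw [Net.mem_cov]
  have : ¬ Sub u y := fun h' => h.2.2 (hu.trans h')
  have := h.2.1
  tauto

theorem exists_link_of_apart (ha : Apart u v) (h : (cov u ∩ cov v).Nonempty) :
    ∃ x y, Leaves u x y ∧ Sub v y := by
  obtain ⟨e, he⟩ := h
  rw [cov_inter_of_apart ha] at he
  simp only [edgesOf, Finset.mem_filter, Finset.mem_univ, true_and] at he
  obtain ⟨x, y, hn, ⟨h1, h2⟩, -⟩ := he
  exact ⟨x, y, ⟨h1, hn, ha.symm.not_sub h2⟩, h2⟩

/-! #### One tree edge -/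

/-- The certifying node is the inner end of a covering edge: it knows this edge and, from its
ancestor `a`, the label sum of both covering edges. -/
theorem certified_one (ha : a ≠ N.root) (h : (cov a).card = 2) : Certified {a} := by
  obtain ⟨x, y, hx, hn, hy⟩ := exists_leaving (v := a) (Finset.card_pos.1 (by omega))
  refine ⟨x, fun N' x' hv => ?_⟩
  obtain ⟨y', hadj, hsy⟩ := hv.exists_adj hn.1
  obtain ⟨a', ta, hx'⟩ := hv.1.twin.exists_ancestor hx
  have hsa := hv.1.ancestor hx ta
  have hro : N'.root ∉ ({a'} : Finset N'.V) := by
    rw [Finset.mem_singleton]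
    exact fun e => ha (ta.eq_root_iff.2 e.symm)
  have hl' : Leaves a' x' y' := ⟨hx', ⟨hadj, fun e => hn.2.1 ((hv.1.twin.par.eq_iff hsy.twin).2 e),
    fun e => hn.2.2 ((hsy.twin.par.eq_iff hv.1.twin).2 e)⟩, fun e => hy ((ta.sub_iff hsy.twin).2 e)⟩
  have hl : Leaves a x y := ⟨hx, hn, hy⟩
  have hc := hsa.card
  refine ⟨{a'}, hro, ?_, ?_⟩
  · rw [oddEdges_one, Finset.card_singleton]
    omega
  · rw [names_cutOf (by simpa [eq_comm] using ha), names_cutOf hro, oddEdges_one, oddEdges_one,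
      Finset.image_singleton, Finset.image_singleton, ta.map_up,
      names_eq_of_card_eq_two h (by omega) hl.mem_cov hl'.mem_cov _ hsa.weight]
    rw [weight_mk, weight_mk, hv.1.twin.ident_eq, hsy.twin.ident_eq]

/-! #### Two tree edges -/

/-- By inclusion-exclusion the given sizes and label sums yield the size of the symmetric difference
and the label of its only edge. -/
theorem matched_two (hab : a ≠ b) (ha : a ≠ N.root) (hb : b ≠ N.root)
    (h : (symmDiff (cov a) (cov b)).card = 1) (ta : Twin a a') (tb : Twin b b')
    (ca : (cov a).card = (cov a').card) (cb : (cov b).card = (cov b').card)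
    (ci : (cov a ∩ cov b).card = (cov a' ∩ cov b').card)
    (wa : ∑ e ∈ cov a, weight e = ∑ e ∈ cov a', weight e)
    (wb : ∑ e ∈ cov b, weight e = ∑ e ∈ cov b', weight e)
    (wi : ∑ e ∈ cov a ∩ cov b, weight e = ∑ e ∈ cov a' ∩ cov b', weight e) :
    Matched {a, b} N' := by
  have hab' : a' ≠ b' := fun e => hab ((ta.eq_iff tb).2 e)
  have hro : N.root ∉ ({a, b} : Finset N.V) := by
    simp only [Finset.mem_insert, Finset.mem_singleton, not_or]
    exact ⟨ha.symm, hb.symm⟩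
  have hro' : N'.root ∉ ({a', b'} : Finset N'.V) := by
    simp only [Finset.mem_insert, Finset.mem_singleton, not_or]
    exact ⟨fun e => ha (ta.eq_root_iff.2 e.symm), fun e => hb (tb.eq_root_iff.2 e.symm)⟩
  have h1 := card_symmDiff_add (cov a) (cov b)
  have h2 := card_symmDiff_add (cov a') (cov b')
  have h3 := sum_symmDiff_add (cov a) (cov b) weight
  have h4 := sum_symmDiff_add (cov a') (cov b') weight
  refine ⟨{a', b'}, hro', ?_, ?_⟩
  · rw [oddEdges_two hab', Finset.card_pair hab']
    omega
  · have hn : names (symmDiff (cov a) (cov b)) = names (symmDiff (cov a') (cov b')) :=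
      names_eq_of_card_eq_one h (by omega) (by omega)
    rw [names_cutOf hro, names_cutOf hro', oddEdges_two hab, oddEdges_two hab', hn]
    simp only [Finset.image_insert, Finset.image_singleton, ta.map_up, tb.map_up]

theorem certified_two_of_sub (hab : a ≠ b) (ha : a ≠ N.root) (hb : b ≠ N.root)
    (h : (symmDiff (cov a) (cov b)).card = 1) (hs : Sub b a) : Certified {a, b} := by
  refine ⟨a, fun N' a' hv => ?_⟩
  obtain ⟨b', tb, -⟩ := hv.1.twin.exists_ancestor hs
  have hsb := hv.1.ancestor hs tb
  exact matched_two hab ha hb h hv.1.twin tb hv.1.card hsb.card (hv.1.inter hs tb) hv.1.weight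
    hsb.weight (hv.1.inter_weight hs tb)

/-- Every link leaving the subtree of `a` covers `b` and hence ends below `b`. So `b` lies on the
outer root path of the first selected link, where `a` has the needed counts and sums. -/
theorem certified_two_of_apart (hcov : ∀ a : N.V, a ≠ N.root → (cov a).Nonempty) (ha : a ≠ N.root)
    (hb : b ≠ N.root) (h : (symmDiff (cov a) (cov b)).card = 1) (hs : Apart a b)
    (hsub : cov a ⊆ cov b) : Certified {a, b} := by
  refine ⟨a, fun N' a' hv => ?_⟩
  obtain ⟨x, y, -, -, -, -, hsel, -⟩ := exists_selects (hcov a ha)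
  have hby : Sub b y := (hsel.1.mem_cov_iff_of_apart hs).1 (hsub hsel.1.mem_cov)
  obtain ⟨x', y', hsel', tx, ty⟩ := hv.1.selects hsel
  obtain ⟨b', tb, -⟩ := ty.exists_ancestor hby
  have h1 := hv.1.outer hsel hby tb
  have h2 := hv.1.outer_inter hsel hby hs tb
  exact matched_two hs.ne ha hb h hv.1.twin tb hv.1.card h1.1 h2.1 hv.1.weight h1.2 h2.2

theorem certified_two (hcov : ∀ a : N.V, a ≠ N.root → (cov a).Nonempty) (hab : a ≠ b)
    (ha : a ≠ N.root) (hb : b ≠ N.root) (h : (symmDiff (cov a) (cov b)).card = 1) :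
    Certified {a, b} := by
  have h' : (symmDiff (cov b) (cov a)).card = 1 := by rwa [symmDiff_comm]
  by_cases h1 : Sub b a
  · exact certified_two_of_sub hab ha hb h h1
  by_cases h2 : Sub a b
  · rw [Finset.pair_comm]
    exact certified_two_of_sub hab.symm hb ha h' h2
  have hap : Apart a b := ⟨h2, h1⟩
  -- The covering sets differ in a single edge, so the one that lacks it is contained in the other.
  obtain ⟨e, he⟩ := Finset.card_eq_one.1 h
  by_cases h3 : e ∈ cov a
  · rw [Finset.pair_comm]
    refine certified_two_of_apart hcov hb ha h' hap.symm fun e' h4 => ?_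
    by_contra h5
    have : e' ∈ symmDiff (cov a) (cov b) := Finset.mem_symmDiff.2 (Or.inr ⟨h4, h5⟩)
    rw [he, Finset.mem_singleton] at this
    exact h5 (this ▸ h3)
  · refine certified_two_of_apart hcov ha hb h hap fun e' h4 => ?_
    by_contra h5
    have : e' ∈ symmDiff (cov a) (cov b) := Finset.mem_symmDiff.2 (Or.inl ⟨h4, h5⟩)
    rw [he, Finset.mem_singleton] at this
    exact h3 (this ▸ h4)

/-! #### Three tree edges -/

/-- The tree edges above the three nodes form a cut. -/
structure IsTriple (a b c : N.V) : Prop where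
  ne_ab : a ≠ b
  ne_ac : a ≠ c
  ne_bc : b ≠ c
  root_a : a ≠ N.root
  root_b : b ≠ N.root
  root_c : c ≠ N.root
  eq_empty : symmDiff (cov a) (symmDiff (cov b) (cov c)) = ∅

theorem IsTriple.swap (h : IsTriple a b c) : IsTriple b a c :=
  ⟨h.ne_ab.symm, h.ne_bc, h.ne_ac, h.root_b, h.root_a, h.root_c, by
    rw [symmDiff_left_comm]; exact h.eq_empty⟩

theorem IsTriple.swap_right (h : IsTriple a b c) : IsTriple a c b :=
  ⟨h.ne_ac, h.ne_ab, h.ne_bc.symm, h.root_a, h.root_c, h.root_b, by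
    rw [symmDiff_comm (cov c)]; exact h.eq_empty⟩

theorem IsTriple.mem (h : IsTriple a b c) {e : Sym2 N.V} (he : e ∈ cov a) :
    e ∈ cov b ∧ e ∉ cov c ∨ e ∉ cov b ∧ e ∈ cov c := by
  have h1 : e ∉ symmDiff (cov a) (symmDiff (cov b) (cov c)) := by
    rw [h.eq_empty]; exact Finset.notMem_empty e
  rw [Finset.mem_symmDiff, Finset.mem_symmDiff] at h1
  tauto

theorem IsTriple.matched (h : IsTriple a b c) (ta : Twin a a') (tb : Twin b b') (tc : Twin c c')
    (h' : symmDiff (cov a') (symmDiff (cov b') (cov c')) = ∅) : Matched {a, b, c} N' := by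
  have hab : a' ≠ b' := fun e => h.ne_ab ((ta.eq_iff tb).2 e)
  have hac : a' ≠ c' := fun e => h.ne_ac ((ta.eq_iff tc).2 e)
  have hbc : b' ≠ c' := fun e => h.ne_bc ((tb.eq_iff tc).2 e)
  have hro : N.root ∉ ({a, b, c} : Finset N.V) := by
    simp only [Finset.mem_insert, Finset.mem_singleton, not_or]
    exact ⟨h.root_a.symm, h.root_b.symm, h.root_c.symm⟩
  have hro' : N'.root ∉ ({a', b', c'} : Finset N'.V) := by
    simp only [Finset.mem_insert, Finset.mem_singleton, not_or]
    exact ⟨fun e => h.root_a (ta.eq_root_iff.2 e.symm), fun e => h.root_b (tb.eq_root_iff.2 e.symm),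
      fun e => h.root_c (tc.eq_root_iff.2 e.symm)⟩
  refine ⟨{a', b', c'}, hro', ?_, ?_⟩
  · rw [oddEdges_three hab hac hbc, h', Finset.card_empty,
      Finset.card_eq_three.2 ⟨a', b', c', hab, hac, hbc, rfl⟩]
  · rw [names_cutOf hro, names_cutOf hro', oddEdges_three h.ne_ab h.ne_ac h.ne_bc,
      oddEdges_three hab hac hbc, h', h.eq_empty]
    simp only [Finset.image_insert, Finset.image_singleton, ta.map_up, tb.map_up, tc.map_up, names,
      Finset.map_empty]

/-- All three pairs are nested, and the lowest node has the records of its ancestors. -/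
theorem IsTriple.certified_of_chain (t : IsTriple u v w) (huv : Sub v u) (hvw : Sub w v) :
    Certified {u, v, w} := by
  refine ⟨u, fun N' u' hview => ?_⟩
  have hu := hview.1
  have huw := hvw.trans huv
  obtain ⟨v', tv, huv'⟩ := hu.twin.exists_ancestor huv
  obtain ⟨w', tw, huw'⟩ := hu.twin.exists_ancestor huw
  have hv := hu.ancestor huv tv
  have hw := hu.ancestor huw tw
  refine t.matched hu.twin tv tw ?_
  have h1 := symmDiff_three_eq_empty_iff.1 t.eq_empty
  rw [cov_inter_three_of_chain huv hvw, ← Finset.card_eq_zero] at h1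
  rw [symmDiff_three_eq_empty_iff,
    cov_inter_three_of_chain huv' ((tw.sub_iff tv).1 hvw), ← Finset.card_eq_zero,
    ← hu.card, ← hv.card, ← hw.card, ← hu.inter huv tv, ← hu.inter huw tw, ← hv.inter hvw tw]
  exact h1

/-- Node `w` learns the sizes for `u` and `v` on the inner root paths of its two links. That `u` and
`v` share no covering edge is not counted directly: it follows in the other network because the
covering set of `u` lies in that of `w`. -/
theorem IsTriple.certified_of_fork_of_select (t : IsTriple u v w) (huv : Apart u v) (hu : Sub w u)
    (hv : Sub w v) (he : cov u ∩ cov v = ∅) (hs : Selects 0 w x y) (hux : Sub u x)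
    (hs₁ : Selects 1 w x₁ y₁) (hvx : Sub v x₁) : Certified {u, v, w} := by
  refine ⟨w, fun N' w' hview => ?_⟩
  have hw := hview.1
  obtain ⟨x', y', hs', tx, ty⟩ := hw.selects hs
  obtain ⟨x₁', y₁', hs₁', tx₁, ty₁⟩ := hw.selects hs₁
  obtain ⟨u', tu, -⟩ := tx.exists_ancestor hux
  obtain ⟨v', tv, -⟩ := tx₁.exists_ancestor hvx
  refine t.matched tu tv hw.twin ?_
  obtain ⟨-, h1, h2, h3⟩ := symmDiff_three_eq_empty_iff.1 t.eq_empty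
  obtain ⟨a1, a2⟩ := hw.inner hs hux hu tu
  obtain ⟨b1, b2⟩ := hw.inner hs₁ hvx hv tv
  have hc := hw.card
  have h4 := cov_inter_three_of_fork ((tu.apart_iff tv).1 huv) ((hw.twin.sub_iff tu).1 hu)
    ((hw.twin.sub_iff tv).1 hv)
  rw [he, Finset.card_empty] at h1 h2
  have h5 : (cov u' ∩ cov v').card = 0 := by
    rw [inter_eq_empty_of_card (by omega) h4, Finset.card_empty]
  rw [symmDiff_three_eq_empty_iff]
  exact ⟨h4, by omega, by omega, by omega⟩

theorem IsTriple.certified_of_fork_of_disjoint (hcov : ∀ a : N.V, a ≠ N.root → (cov a).Nonempty)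
    (t : IsTriple u v w) (huv : Apart u v) (hu : Sub w u) (hv : Sub w v)
    (he : cov u ∩ cov v = ∅) : Certified {u, v, w} := by
  obtain ⟨x, y, x₁, y₁, -, -, hs, hs₁, -, -, hin, -⟩ := exists_selects (hcov w t.root_c)
  -- If the first link of `w` starts below `u`, the second starts below `v`: otherwise minimality of
  -- its common prefix would force every link leaving the subtree of `w` to start below `u`,
  -- including those from below `v`.
  have key : ∀ {u v : N.V}, IsTriple u v w → Apart u v → Sub w u → Sub w v →
      cov u ∩ cov v = ∅ → Sub u x → Sub v x₁ := by
    intro u v t huv hu hv he hux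
    obtain ⟨x', y', hl⟩ := exists_leaving (hcov v t.root_b)
    have h1 : s(x', y') ∈ cov w := by
      rcases t.swap.mem (Leaves.mem_cov hl) with h | h
      · have : s(x', y') ∈ cov u ∩ cov v := Finset.mem_inter.2 ⟨h.1, Leaves.mem_cov hl⟩
        rw [he] at this
        exact absurd this (Finset.notMem_empty _)
      · exact h.2
    have h2 : Sub w x' := hv.trans hl.1
    have h3 : Leaves w x' y' := ⟨h2, hl.2.1, fun h => (Net.mem_cov.1 h1).2 (iff_of_true h2 h)⟩
    have h4 : ¬ Sub u x₁ := fun h => by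
      have h5 := (lt_agree_iff hux).2 h
      exact huv.symm.not_sub hl.1 ((lt_agree_iff hux).1 (h5.trans_le (hin _ _ h3)))
    rw [← hs₁.1.mem_cov_iff_of_sub hu] at h4
    rw [← hs₁.1.mem_cov_iff_of_sub hv]
    rcases t.swap_right.swap.mem hs₁.1.mem_cov with h | h
    · exact absurd h.1 h4
    · exact h.2
  rcases t.swap_right.swap.mem hs.1.mem_cov with h | h
  · have hux := (hs.1.mem_cov_iff_of_sub hu).1 h.1
    exact t.certified_of_fork_of_select huv hu hv he hs hux hs₁ (key t huv hu hv he hux)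
  · have hvx := (hs.1.mem_cov_iff_of_sub hv).1 h.2
    rw [Finset.inter_comm] at he
    rw [Finset.insert_comm]
    exact t.swap.certified_of_fork_of_select huv.symm hv hu he hs hvx hs₁
      (key t.swap huv.symm hv hu he hvx)

/-- A link between the subtrees of `u` and `v` has a common ancestor of its ends at or below `w`. By
maximality the first selected link of `u` also stays below `w`, hence ends below `v`. The certifying
node is the inner end of such a link, which reads the record of `v` from its neighbour. -/
theorem IsTriple.certified_of_fork_of_link (hcov : ∀ a : N.V, a ≠ N.root → (cov a).Nonempty)
    (t : IsTriple u v w) (huv : Apart u v) (hu : Sub w u) (hv : Sub w v)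
    (he : (cov u ∩ cov v).Nonempty) : Certified {u, v, w} := by
  obtain ⟨p, q, -, -, -, -, hs, -, -, hmax, -⟩ := exists_selects (hcov u t.root_a)
  obtain ⟨x, y, hl, hvy⟩ := exists_link_of_apart huv he
  have hvq : Sub v q := by
    have hwp : Sub w p := hu.trans hs.1.1
    have h1 := (lt_agree_iff (hu.trans hl.1)).2 (hv.trans hvy)
    have h2 : Sub w q := (lt_agree_iff hwp).1 (h1.trans_le (hmax _ _ hl))
    have h3 : s(p, q) ∉ cov w := fun h => (Net.mem_cov.1 h).2 (iff_of_true hwp h2)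
    rw [← hs.1.mem_cov_iff_of_apart huv]
    rcases t.mem hs.1.mem_cov with h | h
    · exact h.1
    · exact absurd h.2 h3
  refine ⟨x, fun N' x' hview => ?_⟩
  have hx := hview.1
  obtain ⟨y', -, hy⟩ := hview.exists_adj hl.2.1.1
  obtain ⟨u', tu, -⟩ := hx.twin.exists_ancestor hl.1
  obtain ⟨w', tw, -⟩ := hx.twin.exists_ancestor (hu.trans hl.1)
  obtain ⟨v', tv, -⟩ := hy.twin.exists_ancestor hvy
  have su := hx.ancestor hl.1 tu
  have sw := hx.ancestor (hu.trans hl.1) tw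
  have sv := hy.ancestor hvy tv
  refine t.matched tu tv tw ?_
  have h1 := (symmDiff_three_eq_empty_iff.1 t.eq_empty).2
  rw [symmDiff_three_eq_empty_iff, ← su.card, ← sv.card, ← sw.card,
    ← (su.outer_inter hs hvq huv tv).1, ← su.inter hu tw, ← sv.inter hv tw]
  exact ⟨cov_inter_three_of_fork ((tu.apart_iff tv).1 huv) ((tw.sub_iff tu).1 hu)
    ((tw.sub_iff tv).1 hv), h1⟩

theorem IsTriple.certified_of_side_of_select (t : IsTriple u v w) (huv : Sub v u)
    (hvw : Apart v w) {σ τ : Fin 3} (hs : Selects σ v x y) (hw : Sub w y)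
    (hs₁ : Selects τ v x₁ y₁) (hu : Sub u x₁) : Certified {u, v, w} := by
  refine ⟨v, fun N' v' hview => ?_⟩
  have hv := hview.1
  obtain ⟨x', y', hs', tx, ty⟩ := hv.selects hs
  obtain ⟨x₁', y₁', hs₁', tx₁, ty₁⟩ := hv.selects hs₁
  obtain ⟨w', tw, -⟩ := ty.exists_ancestor hw
  obtain ⟨u', tu, -⟩ := tx₁.exists_ancestor hu
  refine t.matched tu hv.twin tw ?_
  obtain ⟨h0, h1, h2, h3⟩ := symmDiff_three_eq_empty_iff.1 t.eq_empty
  rw [cov_inter_three_of_side huv hvw] at h0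
  have h4 := hv.inter_eq_empty hs hw hvw tw hs₁ hu huv tu h0
  obtain ⟨a1, a2⟩ := hv.inner hs₁ hu huv tu
  have b1 := (hv.outer hs hw tw).1
  have b2 := (hv.outer_inter hs hw hvw tw).1
  rw [symmDiff_three_eq_empty_iff, cov_inter_three_of_side ((hv.twin.sub_iff tu).1 huv)
    ((hv.twin.apart_iff tw).1 hvw), h4, ← a1, ← a2, ← b1, ← b2, ← hv.card]
  rw [h0] at h1 h3
  exact ⟨rfl, h1, h2, h3⟩

/-- Here the covering set of `v` is the disjoint union of those of `u` and `w`. The first link of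
`v` covers one of them; if it starts below `u`, the link farthest at the inner end runs to `w`, and
if it runs to `w`, the link farthest at the outer end starts below `u`. -/
theorem IsTriple.certified_of_side (hcov : ∀ a : N.V, a ≠ N.root → (cov a).Nonempty)
    (t : IsTriple u v w) (huv : Sub v u) (hvw : Apart v w) : Certified {u, v, w} := by
  obtain ⟨x, y, x₁, y₁, x₂, y₂, hs, hs₁, hs₂, -, hin, hout⟩ := exists_selects (hcov v t.root_b)
  have h0 := (symmDiff_three_eq_empty_iff.1 t.eq_empty).1
  rw [cov_inter_three_of_side huv hvw] at h0
  rcases t.swap.mem hs.1.mem_cov with ⟨h1, h1'⟩ | ⟨h1, h1'⟩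
  · have hux := (hs.1.mem_cov_iff_of_sub huv).1 h1
    refine t.certified_of_side_of_select huv hvw hs₁ ?_ hs hux
    obtain ⟨y', x', hl⟩ := exists_leaving (hcov w t.root_c)
    have hl' := Leaves.mem_cov hl
    have h2 : s(y', x') ∉ cov u := fun h => by
      have := Finset.mem_inter.2 ⟨h, hl'⟩
      rw [h0] at this
      exact Finset.notMem_empty _ this
    have h3 : s(y', x') ∈ cov v := by
      rcases t.swap_right.swap.mem hl' with h | h
      · exact absurd h.1 h2
      · exact h.2
    have h4 : Sub v x' := (Leaves.mem_cov_iff_of_apart hl hvw.symm).1 h3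
    have h5 : Leaves v x' y' := ⟨h4, hl.2.1.symm, hvw.symm.not_sub hl.1⟩
    have h6 : ¬ Sub u x' := fun h => h2 (by
      rw [Sym2.eq_swap]
      exact (h5.mem_cov_iff_of_sub huv).2 h)
    have h7 : ¬ Sub u x₁ := fun h => h6 ((lt_agree_iff hux).1
      (((lt_agree_iff hux).2 h).trans_le (hin _ _ h5)))
    rw [← hs₁.1.mem_cov_iff_of_sub huv] at h7
    rw [← hs₁.1.mem_cov_iff_of_apart hvw]
    rcases t.swap.mem hs₁.1.mem_cov with h | h
    · exact absurd h.1 h7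
    · exact h.2
  · have hwy := (hs.1.mem_cov_iff_of_apart hvw).1 h1'
    refine t.certified_of_side_of_select huv hvw hs hwy hs₂ ?_
    obtain ⟨x', y', hl⟩ := exists_leaving (hcov u t.root_a)
    have hl' := Leaves.mem_cov hl
    have h2 : s(x', y') ∉ cov w := fun h => by
      have := Finset.mem_inter.2 ⟨hl', h⟩
      rw [h0] at this
      exact Finset.notMem_empty _ this
    have h3 : s(x', y') ∈ cov v := by
      rcases t.mem hl' with h | h
      · exact h.1
      · exact absurd h.2 h2
    have h4 : Sub v x' := huv.trans hl.1
    have h5 : Leaves v x' y' := ⟨h4, hl.2.1, fun h => (Net.mem_cov.1 h3).2 (iff_of_true h4 h)⟩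
    have h6 : ¬ Sub w y' := fun h => h2 ((h5.mem_cov_iff_of_apart hvw).2 h)
    have h7 : ¬ Sub w y₂ := fun h => h6 ((lt_agree_iff hwy).1
      (((lt_agree_iff hwy).2 h).trans_le (hout _ _ h5)))
    rw [← hs₂.1.mem_cov_iff_of_apart hvw] at h7
    rw [← hs₂.1.mem_cov_iff_of_sub huv]
    rcases t.swap.mem hs₂.1.mem_cov with h | h
    · exact h.1
    · exact absurd h.2 h7

/-- Links leaving the subtree of `v` end below `u` or below `w`. If the first selected link ends
below `u`, the one farthest at the outer end must end below `w`, since some link does. -/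
theorem IsTriple.exists_selects_into (t : IsTriple v u w) (hvu : Apart v u) (hvw : Apart v w)
    (huw : Apart u w) (h : (cov v ∩ cov w).Nonempty) :
    ∃ σ x y, Selects σ v x y ∧ Sub w y := by
  obtain ⟨x, y, -, -, x₂, y₂, hs, -, hs₂, -, -, hout⟩ :=
    exists_selects (h.mono Finset.inter_subset_left)
  rcases t.mem hs.1.mem_cov with ⟨h1, -⟩ | ⟨-, h1⟩
  · have huy := (hs.1.mem_cov_iff_of_apart hvu).1 h1
    refine ⟨2, x₂, y₂, hs₂, ?_⟩
    obtain ⟨x', y', hl, hwy⟩ := exists_link_of_apart hvw h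
    have h2 : ¬ Sub u y₂ := fun h => huw.symm.not_sub hwy ((lt_agree_iff huy).1
      (((lt_agree_iff huy).2 h).trans_le (hout _ _ hl)))
    rw [← hs₂.1.mem_cov_iff_of_apart hvu] at h2
    rw [← hs₂.1.mem_cov_iff_of_apart hvw]
    rcases t.mem hs₂.1.mem_cov with h | h
    · exact absurd h.1 h2
    · exact h.2
  · exact ⟨0, x, y, hs, (hs.1.mem_cov_iff_of_apart hvw).1 h1⟩

/-- The inner end of a link from `a` to `b` has the records of `a` and, through its neighbour, those
of `b`. The pair of `b` and `c` is counted by `b` if it has a common covering edge; otherwise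
emptiness follows from the other counts. -/
theorem IsTriple.certified_of_apart_of_links (t : IsTriple a b c) (hab : Apart a b)
    (hac : Apart a c) (hbc : Apart b c) (eab : (cov a ∩ cov b).Nonempty)
    (eac : (cov a ∩ cov c).Nonempty) : Certified {a, b, c} := by
  obtain ⟨σ, p, q, hs, hq⟩ := t.swap_right.exists_selects_into hac hab hbc.symm eab
  obtain ⟨τ, p₁, q₁, hs₁, hq₁⟩ := t.exists_selects_into hab hac hbc eac
  obtain ⟨x, y, hl, hby⟩ := exists_link_of_apart hab eab
  refine ⟨x, fun N' x' hview => ?_⟩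
  obtain ⟨y', -, hy⟩ := hview.exists_adj hl.2.1.1
  obtain ⟨a', ta, -⟩ := hview.1.twin.exists_ancestor hl.1
  obtain ⟨b', tb, -⟩ := hy.twin.exists_ancestor hby
  have sa := hview.1.ancestor hl.1 ta
  have sb := hy.ancestor hby tb
  obtain ⟨p₁', q₁', hs₁', -, tq₁⟩ := sa.selects hs₁
  obtain ⟨c', tc, -⟩ := tq₁.exists_ancestor hq₁
  refine t.matched ta tb tc ?_
  obtain ⟨-, h1, h2, h3⟩ := symmDiff_three_eq_empty_iff.1 t.eq_empty
  have h0 := cov_inter_three_of_apart ((ta.apart_iff tb).1 hab) ((ta.apart_iff tc).1 hac)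
    ((tb.apart_iff tc).1 hbc)
  have e1 := sa.card
  have e2 := sb.card
  have e3 := (sa.outer hs₁ hq₁ tc).1
  have e4 := (sa.outer_inter hs hq hab tb).1
  have e5 := (sa.outer_inter hs₁ hq₁ hac tc).1
  have e6 : (cov b ∩ cov c).card = (cov b' ∩ cov c').card := by
    rcases (cov b ∩ cov c).eq_empty_or_nonempty with hz | hz
    · have : cov b' ∩ cov c' = ∅ := by
        refine inter_eq_empty_of_card (C := cov a') ?_ ?_
        · rw [hz, Finset.card_empty] at h2
          rw [Finset.inter_comm]
          omega
        · rw [← h0, Finset.inter_comm, Finset.inter_assoc]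
      rw [hz, this, Finset.card_empty, Finset.card_empty]
    · obtain ⟨ρ, p₂, q₂, hs₂, hq₂⟩ := t.swap.exists_selects_into hab.symm hbc hac hz
      exact (sb.outer_inter hs₂ hq₂ hbc tc).1
  rw [symmDiff_three_eq_empty_iff]
  exact ⟨h0, by omega, by omega, by omega⟩

/-- Each covering set is nonempty and split by the other two, so at most one of the three pairwise
intersections is empty; a permutation makes it the one of `b` and `c`. -/
theorem IsTriple.certified_of_apart (hcov : ∀ a : N.V, a ≠ N.root → (cov a).Nonempty)
    (t : IsTriple a b c) (hab : Apart a b) (hac : Apart a c) (hbc : Apart b c) :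
    Certified {a, b, c} := by
  obtain ⟨-, h1, h2, h3⟩ := symmDiff_three_eq_empty_iff.1 t.eq_empty
  have p1 := Finset.card_pos.2 (hcov a t.root_a)
  have p2 := Finset.card_pos.2 (hcov b t.root_b)
  have p3 := Finset.card_pos.2 (hcov c t.root_c)
  by_cases h4 : (cov a ∩ cov b).card = 0
  · have e : ({a, b, c} : Finset N.V) = {c, a, b} := by
      rw [Finset.insert_comm c a, Finset.pair_comm c b]
    rw [e]
    refine t.swap_right.swap.certified_of_apart_of_links hac.symm hbc.symm hab ?_ ?_
    · rw [← Finset.card_pos, Finset.inter_comm]; omega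
    · rw [← Finset.card_pos, Finset.inter_comm]; omega
  by_cases h5 : (cov a ∩ cov c).card = 0
  · rw [Finset.insert_comm]
    refine t.swap.certified_of_apart_of_links hab.symm hbc hac ?_ ?_
    · rw [← Finset.card_pos, Finset.inter_comm]; omega
    · rw [← Finset.card_pos]; omega
  · exact t.certified_of_apart_of_links hab hac hbc (Finset.card_pos.1 (by omega))
      (Finset.card_pos.1 (by omega))

theorem IsTriple.certified_of_sub (hcov : ∀ a : N.V, a ≠ N.root → (cov a).Nonempty)
    (t : IsTriple u v w) (huv : Sub v u) : Certified {u, v, w} := by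
  by_cases h1 : Sub w v
  · exact t.certified_of_chain huv h1
  by_cases h2 : Sub v w
  · rw [Finset.pair_comm]
    by_cases h3 : Sub w u
    · exact t.swap_right.certified_of_chain h3 h2
    by_cases h4 : Sub u w
    · rw [Finset.insert_comm]
      exact t.swap_right.swap.certified_of_chain h4 huv
    rcases (cov u ∩ cov w).eq_empty_or_nonempty with h5 | h5
    · exact t.swap_right.certified_of_fork_of_disjoint hcov ⟨h4, h3⟩ huv h2 h5
    · exact t.swap_right.certified_of_fork_of_link hcov ⟨h4, h3⟩ huv h2 h5
  · exact t.certified_of_side hcov huv ⟨h2, h1⟩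

theorem IsTriple.certified (hcov : ∀ a : N.V, a ≠ N.root → (cov a).Nonempty)
    (t : IsTriple a b c) : Certified {a, b, c} := by
  have e1 : ({a, b, c} : Finset N.V) = {b, a, c} := Finset.insert_comm _ _ _
  have e2 : ({a, b, c} : Finset N.V) = {a, c, b} := by rw [Finset.pair_comm]
  have e3 : ({a, b, c} : Finset N.V) = {c, a, b} := by rw [e2, Finset.insert_comm]
  have e4 : ({a, b, c} : Finset N.V) = {b, c, a} := by rw [e1, Finset.pair_comm]
  have e5 : ({a, b, c} : Finset N.V) = {c, b, a} := by rw [e4, Finset.insert_comm]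
  by_cases h1 : Sub b a
  · exact t.certified_of_sub hcov h1
  by_cases h2 : Sub a b
  · rw [e1]; exact t.swap.certified_of_sub hcov h2
  by_cases h3 : Sub c a
  · rw [e2]; exact t.swap_right.certified_of_sub hcov h3
  by_cases h4 : Sub a c
  · rw [e3]; exact t.swap_right.swap.certified_of_sub hcov h4
  by_cases h5 : Sub c b
  · rw [e4]; exact t.swap.swap_right.certified_of_sub hcov h5
  by_cases h6 : Sub b c
  · rw [e5]; exact t.swap.swap_right.swap.certified_of_sub hcov h6
  · exact t.certified_of_apart hcov ⟨h2, h1⟩ ⟨h4, h3⟩ ⟨h6, h5⟩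

end Cases

/-- Every cut with three edges is certified if there are no smaller cuts. -/
theorem certified_of_not_hasSmallCut (h : ¬ HasSmallCut N) {X : Finset N.V} (hX : N.root ∉ X)
    (hc : X.card + (oddEdges X).card = 3) : Certified X := by
  have hcov : ∀ a : N.V, a ≠ N.root → (cov a).Nonempty := by
    intro a ha
    by_contra hn
    refine h ⟨{a}, by simpa [eq_comm] using ha, ⟨a, by simp⟩, ?_⟩
    rw [oddEdges_one, Finset.not_nonempty_iff_eq_empty.1 hn]
    simp
  have hne : X.card ≠ 0 := fun h0 => by
    rw [Finset.card_eq_zero] at h0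
    subst h0
    simp [oddEdges_empty] at hc
  obtain h1 | h1 | h1 : X.card = 1 ∨ X.card = 2 ∨ X.card = 3 := by omega
  · obtain ⟨a, rfl⟩ := Finset.card_eq_one.1 h1
    rw [oddEdges_one] at hc
    exact certified_one (by simpa [eq_comm] using hX) (by omega)
  · obtain ⟨a, b, hab, rfl⟩ := Finset.card_eq_two.1 h1
    rw [oddEdges_two hab] at hc
    simp only [Finset.mem_insert, Finset.mem_singleton, not_or] at hX
    exact certified_two hcov hab (Ne.symm hX.1) (Ne.symm hX.2) (by omega)
  · obtain ⟨a, b, c, hab, hac, hbc, rfl⟩ := Finset.card_eq_three.1 h1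
    rw [oddEdges_three hab hac hbc] at hc
    simp only [Finset.mem_insert, Finset.mem_singleton, not_or] at hX
    exact IsTriple.certified hcov ⟨hab, hac, hbc, Ne.symm hX.1, Ne.symm hX.2.1, Ne.symm hX.2.2,
      Finset.card_eq_zero.1 (by omega)⟩

/-! ### The algorithm -/

/-- The names of the minimum cuts with three edges. -/
noncomputable def threeCuts (N : Net.{u}) : Finset (Finset (Sym2 ℕ)) :=
  (Finset.univ.filter fun F : Finset (Sym2 N.V) => IsMinCut N.G F ∧ F.card = 3).image names

theorem mem_threeCuts {S : Finset (Sym2 ℕ)} : S ∈ threeCuts N ↔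
    ¬ HasSmallCut N ∧ ∃ X : Finset N.V, N.root ∉ X ∧ X.card + (oddEdges X).card = 3 ∧
      S = names (cutOf X) := by
  simp only [threeCuts, Finset.mem_image, Finset.mem_filter, Finset.mem_univ, true_and]
  constructor
  · rintro ⟨F, ⟨⟨hF, hmin⟩, hc⟩, rfl⟩
    obtain ⟨X, hX, -, rfl⟩ := isCutSet_iff.1 hF
    refine ⟨?_, X, hX, by rw [← card_cutOf hX, hc], rfl⟩
    rintro ⟨Y, hY, hYne, hYc⟩
    have := hmin _ (isCutSet_iff.2 ⟨Y, hY, hYne, rfl⟩)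
    rw [card_cutOf hY] at this
    omega
  · rintro ⟨hs, X, hX, hc, rfl⟩
    have hne : X.Nonempty := by
      rw [Finset.nonempty_iff_ne_empty]
      rintro rfl
      simp [oddEdges_empty] at hc
    refine ⟨cutOf X, ⟨⟨isCutSet_iff.2 ⟨X, hX, hne, rfl⟩, ?_⟩, by rw [card_cutOf hX, hc]⟩, rfl⟩
    intro F' hF'
    obtain ⟨Y, hY, hYne, rfl⟩ := isCutSet_iff.1 hF'
    rw [card_cutOf hX, card_cutOf hY, hc]
    by_contra hlt
    exact hs ⟨Y, hY, hYne, by omega⟩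

end Net

/-- The minimum cuts with three edges that can be found with the knowledge of a node. -/
noncomputable def found : Lab.{u} (Finset (Finset (Sym2 ℕ))) := fun N v =>
  (threeCuts N).filter fun S => ∀ (N' : Net.{u}) (v' : N'.V),
    knows flags N' v' = knows flags N v → S ∈ threeCuts N'

theorem mem_found {N : Net.{u}} {v : N.V} {S : Finset (Sym2 ℕ)} : S ∈ found N v ↔
    ∀ (N' : Net.{u}) (v' : N'.V), knows flags N' v' = knows flags N v → S ∈ threeCuts N' := by
  rw [found, Finset.mem_filter, and_iff_right_iff_imp]
  exact fun h => h N v rfl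

theorem det_found : Det (knows flags.{u}) found.{u} := by
  intro N v N' v' h
  ext S
  rw [mem_found, mem_found, h]

/-- Soundness is the case of the true network. For completeness, the certificate transfers the cut,
and the flag from the root transfers the absence of smaller cuts. -/
theorem exists_mem_found_iff {N : Net.{u}} {S : Finset (Sym2 ℕ)} :
    (∃ v, S ∈ found N v) ↔ S ∈ threeCuts N := by
  refine ⟨fun ⟨v, h⟩ => mem_found.1 h N v rfl, fun h => ?_⟩
  obtain ⟨hs, X, hX, hc, rfl⟩ := mem_threeCuts.1 h
  obtain ⟨v, hv⟩ := certified_of_not_hasSmallCut hs hX hc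
  refine ⟨v, mem_found.2 fun N' v' hk => ?_⟩
  simp only [knows, Prod.mk.injEq] at hk
  obtain ⟨-, h1, h2⟩ := hk
  obtain ⟨X', hX', hc', he⟩ := hv N' v' ⟨funext fun i => congrArg Prod.fst (congrFun h1.symm i),
    inb_map_congr h2.symm fun I i => (I i).1⟩
  exact mem_threeCuts.2 ⟨fun hn => hs ((hasSmallCut_congr h1).1 hn), X', hX', hc', he⟩

theorem Net.one_le_diam (N : Net.{u}) : 1 ≤ N.G.diam := by
  have := N.nontriv
  exact Nat.one_le_iff_ne_zero.2 (SimpleGraph.connected_iff_diam_ne_zero.1 N.conn)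

/-- With the height at most `D` and `D` at least `1`: the four phases cost `16 + 8 + 36 + 1 = 61`
times at most `15 * D ^ 2`, the broadcast of places at most `24 * D ^ 2`, and the election at most
`4 * D ^ 2`. -/
theorem exists_solvable_found : ∃ T : Net.{u} → ℕ, Solvable T found.{u} ∧
    ∀ N, T N ≤ 943 * N.G.diam ^ 2 := by
  refine ⟨_, (solvable_flags (solvable_stats (solvable_fars solvable_counts))).det det_found,
    fun N => ?_⟩
  have h1 := N.height_le_diam
  have h2 := N.one_le_diam
  generalize N.height = H at *
  generalize N.G.diam = D at *
  have a1 : 3 * H + 2 ≤ 5 * D := by omega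
  have a2 : H + 2 ≤ 3 * D := by omega
  have a3 : H + 1 ≤ 2 * D := by omega
  have b1 : (3 * H + 2) * (H + 2) ≤ (5 * D) * (3 * D) := Nat.mul_le_mul a1 a2
  have b2 : (H + 1) * (H + 2) ≤ (2 * D) * (3 * D) := Nat.mul_le_mul a3 a2
  have b3 : D * 1 ≤ D * D := Nat.mul_le_mul_left _ h2
  nlinarith

theorem not_isCutSet_of_subsingleton {V : Type*} [Fintype V] [Subsingleton V] {G : SimpleGraph V}
    {F : Finset (Sym2 V)} : ¬ IsCutSet G F := by
  rintro ⟨A, ⟨a, ha⟩, hA, -⟩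
  exact hA (Finset.eq_univ_iff_forall.2 fun x => Subsingleton.elim a x ▸ ha)

theorem reports_found (N : Net.{u}) : ReportsAllMinCutsOfSize N.G N.ident 3 (found N) := by
  intro S
  rw [exists_mem_found_iff]
  simp only [threeCuts, names, Finset.mem_image, Finset.mem_filter, Finset.mem_univ, true_and,
    and_assoc, eq_comm]

end

theorem mainTheorem1 :
    ∃ (𝒜 : DistributedAlgorithm (Finset (Finset (Sym2 ℕ)))) (C : ℕ), ∀ c : ℕ, ∃ B : ℕ,
      ∀ (V : Type*) [Fintype V] (G : SimpleGraph V) (ident : V ↪ ℕ),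
        G.Connected → (∀ v, ident v < Fintype.card V ^ c) →
          𝒜.RespectsBandwidth G ident (B * Nat.log 2 (Fintype.card V)) ∧
          ∃ out : V → Finset (Finset (Sym2 ℕ)),
            𝒜.TerminatesWithin G ident (C * G.diam ^ 2) out ∧
            ReportsAllMinCutsOfSize G ident 3 out := by
  obtain ⟨T, hT, hle⟩ := exists_solvable_found
  obtain ⟨𝒜, h𝒜⟩ := hT.exists_algorithm ∅
  refine ⟨𝒜, 943, fun c => ?_⟩
  obtain ⟨B, hB, hB'⟩ := h𝒜 c
  refine ⟨B, fun V _ G ident hconn hid => ?_⟩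
  -- A single node has diameter `0` and must stop without any round; it has no cuts.
  rcases subsingleton_or_nontrivial V with hV | hV
  · obtain ⟨h1, h2⟩ := hB V G ident
    refine ⟨h1, fun _ => ∅, h2 _, fun S => ?_⟩
    constructor
    · rintro ⟨v, hv⟩
      exact absurd hv (Finset.notMem_empty S)
    · rintro ⟨F, hF, -⟩
      exact absurd hF.1 not_isCutSet_of_subsingleton
  · let N : Net := ⟨V, G, ident, hconn, hV⟩
    obtain ⟨h1, h2⟩ := hB' N hid
    exact ⟨h1, found N, h2 _ (hle N), reports_found N⟩
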